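/- Write $\langle x\rangle=(1+x^2)^{1/2}$, $\hat f(\xi)=\int e^{-ix\xi}f(x)\,dx$ and $\|f\|_{H^s}^2=\int|\hat f(\xi)|^2\langle\xi\rangle^{2s}\,d\xi$. For $u\in L^2(\mathbb R^2)$, $u=u(t,x)$, let $\hat u(\xi,\tau)=\iint e^{-ix\xi-it\tau}u(t,x)\,dx\,dt$ and $$\|u\|_{X^{0,b}}^2=\iint|\hat u(\xi,\tau)|^2\langle\tau+\xi^2\rangle^{2b}\,d\xi\,d\tau ,$$ let $P_{<N}$ be the Fourier multiplier with symbol $1_{|\xi|\le N}$, let $T_\lambda u(t,x)=\lambda u(\lambda^2t,\lambda x)$, and, for a fixed $\eta\in C_0^\infty(\mathbb R)$ with $\eta(0)\ne0$, let $$\|u\|_{Y^{s,b}}=\sup_{t_0\in\mathbb R}\,\sup_{N\ge1}\big\|\eta(t-t_0)\,T_{N^{2s}}(P_{<N}u)\big\|_{X^{0,b}} .$$ Let $\zeta_0,\zeta_1\in C_0^\infty(-2T,2T)$ be real-valued with $\zeta_0\equiv1$ on $[0,T]$ and $\zeta_1\zeta_0\equiv\zeta_0$, let $\omega=\pm1$,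 and consider the modified Cauchy problem $$iu_t+u_{xx}+\zeta_0(t)\,\omega|u|^2u=0,\qquad u(0,x)=u_0(x). \tag{NLS*}$$ **Proposition.** Let $T_0<\infty$, $s\in(-\tfrac12,0)$, $b\in(\tfrac12,1)$ with $-s<\tfrac14(1+4b)^{-1}$, and let $B<\infty$. There is a constant $C<\infty$, depending only on $T_0,s,b,\eta,B$, such that for every $T\in[0,T_0]$, all cutoffs $\zeta_0,\zeta_1$ as above with $\int|\zeta_0'|\,dt\le B$, both signs $\omega$, and every classical solution $u\in C^0(\mathbb R,H^{10})$ of (NLS*) on $\mathbb R\times\mathbb R$, $$\sup_{t\in[-2T,2T]}\|u(t)\|_{H^s}^2\le\|u_0\|_{H^s}^2+C\,\|\zeta_1u\|_{Y^{s,b}}^4 .$$ -/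

import Mathlib

open MeasureTheory Filter Topology Set
open scoped ENNReal NNReal FourierTransform

noncomputable section

/-- The Japanese bracket `⟨x⟩ = (1 + x²)^{1/2}`. -/
def bracket (x : ℝ) : ℝ := Real.sqrt (1 + x ^ 2)

/-- Space-time `ℝ²` with Lebesgue measure. A point `p` has time coordinate `p 0 = t` and space
coordinate `p 1 = x`; a frequency `q` has coordinates `q 0 = τ` and `q 1 = ξ`. -/
abbrev SpaceTime : Type := EuclideanSpace ℝ (Fin 2)

section Fourier

variable {V : Type*} [NormedAddCommGroup V] [InnerProductSpace ℝ V] [FiniteDimensional ℝ V]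
  [MeasurableSpace V] [BorelSpace V]

open Classical in
/-- A representative of the `L²` Fourier transform (normalized by `e^{-2πi⟨v,q⟩}`) of a
square integrable function; by convention `0` if `f` is not in `L²`. -/
def fourierL2 (f : V → ℂ) : V → ℂ :=
  if h : MemLp f 2 (volume : Measure V) then ⇑(𝓕 (h.toLp f) : Lp ℂ 2 (volume : Measure V)) else 0

open Classical in
/-- A representative of the `L²` inverse Fourier transform, the inverse of `fourierL2`. -/
def fourierInvL2 (f : V → ℂ) : V → ℂ :=
  if h : MemLp f 2 (volume : Measure V) then ⇑(𝓕⁻ (h.toLp f) : Lp ℂ 2 (volume : Measure V)) else 0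

/-- The Fourier transform in angular frequencies, `∫ e^{-i⟨v,q⟩} f(v) dv`, understood in the
`L²` sense. -/
def hat (f : V → ℂ) (q : V) : ℂ := fourierL2 f ((2 * Real.pi)⁻¹ • q)

end Fourier

open Classical in
/-- The Sobolev norm `‖f‖_{H^s} = (∫ |f̂(ξ)|² ⟨ξ⟩^{2s} dξ)^{1/2}` of `f ∈ L²(ℝ)`, with values in
`[0, ∞]`; it is set to `∞` if `f` is not in `L²`. (For `s ≥ 0` this is the `H^s` norm of
arbitrary functions; for `s < 0` it is only used for functions in `L²`.) -/
def hsNorm (s : ℝ) (f : ℝ → ℂ) : ℝ≥0∞ :=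
  if MemLp f 2 (volume : Measure ℝ) then
    (∫⁻ ξ : ℝ, ‖hat f ξ‖ₑ ^ 2 * ENNReal.ofReal (bracket ξ ^ (2 * s))) ^ (1 / 2 : ℝ)
  else ⊤

open Classical in
/-- The norm of `X^{0,b}`, `b ≥ 0`, with values in `[0, ∞]`:
`‖u‖_{X^{0,b}}² = ∫∫ |û(ξ,τ)|² ⟨τ + ξ²⟩^{2b} dξ dτ`, where
`û(ξ,τ) = ∫∫ e^{-ixξ} e^{-itτ} u(t,x) dx dt`. With this sign of the transform, solutions of
`i u_t + u_xx = 0` have `û` supported on `τ = -ξ²`, where the weight is smallest.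
Since `b ≥ 0`, a function outside `L²` has norm `∞`. -/
def xNorm (b : ℝ) (u : SpaceTime → ℂ) : ℝ≥0∞ :=
  if MemLp u 2 (volume : Measure SpaceTime) then
    (∫⁻ q : SpaceTime,
      ‖hat u q‖ₑ ^ 2 * ENNReal.ofReal (bracket (q 0 + q 1 ^ 2) ^ (2 * b))) ^ (1 / 2 : ℝ)
  else ⊤

/-- The rough Littlewood-Paley projection `P_{<N}` on `L²(ℝ²)`, which multiplies the space-time
Fourier transform by the indicator function of `|ξ| ≤ N`. The factor `2π` converts the
frequency variable of `fourierL2` to the angular frequency `ξ`. -/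
def lpProj (N : ℝ) (u : SpaceTime → ℂ) : SpaceTime → ℂ :=
  fourierInvL2 ({q : SpaceTime | |2 * Real.pi * q 1| ≤ N}.indicator (fourierL2 u))

/-- The scaling operator `T_ℓ u(t,x) = ℓ u(ℓ² t, ℓ x)`. -/
def scaleOp (l : ℝ) (u : SpaceTime → ℂ) : SpaceTime → ℂ :=
  fun p => (l : ℂ) * u !₂[l ^ 2 * p 0, l * p 1]

/-- The norm of `Y^{s,b}` (for functions in `L²(ℝ²)`), relative to the cutoff function `η`:
`‖u‖_{Y^{s,b}} = sup_{t₀ ∈ ℝ} sup_{N ≥ 1} ‖η(t - t₀) T_{N^{2s}} (P_{<N} u)‖_{X^{0,b}}`. -/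
def yNorm (η : ℝ → ℂ) (s b : ℝ) (u : SpaceTime → ℂ) : ℝ≥0∞ :=
  ⨆ (t₀ : ℝ) (N : ℝ) (_ : 1 ≤ N),
    xNorm b (fun p => η (p 0 - t₀) * scaleOp (N ^ (2 * s)) (lpProj N u) p)

/-- The norm of `C⁰([-2T,2T], H^s)`, for `u` with time slices `u t : ℝ → ℂ`. -/
def c0HsNorm (T s : ℝ) (u : ℝ → ℝ → ℂ) : ℝ≥0∞ :=
  ⨆ t ∈ Icc (-(2 * T)) (2 * T), hsNorm s (u t)

/-- The conditions on the two time cutoffs: both are smooth, real valued and compactly supported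
in `(-2T,2T)`, `ζ₀ ≡ 1` on `[0,T]`, and `ζ₁ ζ₀ ≡ ζ₀`. -/
structure IsCutoffPair (T : ℝ) (ζ₀ ζ₁ : ℝ → ℝ) : Prop where
  smooth₀ : ContDiff ℝ (⊤ : ℕ∞) ζ₀
  smooth₁ : ContDiff ℝ (⊤ : ℕ∞) ζ₁
  tsupport₀ : tsupport ζ₀ ⊆ Ioo (-(2 * T)) (2 * T)
  tsupport₁ : tsupport ζ₁ ⊆ Ioo (-(2 * T)) (2 * T)
  eq_one : ∀ t ∈ Icc 0 T, ζ₀ t = 1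
  mul_eq : ∀ t, ζ₁ t * ζ₀ t = ζ₀ t

/-- `u ∈ C⁰(ℝ, H^{10})` is a classical solution on `ℝ × ℝ` of the modified Cauchy problem
`i u_t + u_xx + ζ₀(t) ω |u|² u = 0`, `u(0,x) = u₀(x)`. -/
structure IsSmoothSolution (ω : ℝ) (ζ₀ : ℝ → ℝ) (u₀ : ℝ → ℂ) (u : ℝ → ℝ → ℂ) : Prop where
  mem : ∀ t, hsNorm 10 (u t) < ⊤
  continuous : ∀ t, Tendsto (fun t' => hsNorm 10 (u t' - u t)) (𝓝 t) (𝓝 0)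
  contDiff_space : ∀ t, ContDiff ℝ 2 (u t)
  differentiable_time : ∀ x, Differentiable ℝ (fun t => u t x)
  equation : ∀ t x, Complex.I * deriv (fun t' => u t' x) t + iteratedDeriv 2 (u t) x
    + (ζ₀ t : ℂ) * (ω : ℂ) * (‖u t x‖ : ℂ) ^ 2 * u t x = 0
  initial : u 0 = u₀

end

/-! The linear flow conserves the $H^s$ norm, so the increment of $\|u(t)\|_{H^s}^2$ is the time
integral of a quadrilinear form in $\hat u$ at the frequencies $\xi,\ \xi-\alpha,\ \xi-\beta,\
\xi-\alpha-\beta$ with symbol $\langle\xi\rangle^{2s}$. Relabelling the frequencies fixes or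
conjugates this form, so the symbol may be replaced by the mixed second difference of
$\langle\cdot\rangle^{2s}$ (`two_mul_sub_conj_integral_weight`, `IsSmoothSolution.energy_identity`).
That difference vanishes for $\alpha=0$ or $\beta=0$. For $|\alpha|\le|\beta|$ it is
$O(|\alpha\beta|/(m_1m_2))$, where $m_1,m_2$ are the larger brackets in the pairs $(\xi,\xi-\alpha)$
and $(\xi-\beta,\xi-\alpha-\beta)$; the other case is symmetric (`abs_mixedDiff_le`).

The $Y^{s,b}$ norm sees $P_{<N}u$ on time windows of length about $N^{4s}$. Averaging over the
window position with Plancherel recovers the $X^{0,b}$ norm of $P_{<N}u$ with a loss $N^{-s(1+4b)}$.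
Summing over dyadic $N$ then bounds $\hat u$ in $L^2$ with weight
$\langle\xi\rangle^{-a}\langle\tau+\xi^2\rangle^{b}$ for every $a>-s(1+4b)$
(`exists_lintegral_timeFourier_le_yNorm`). The hypothesis on $s$ leaves room for $a<1/4$. Charging
$\langle\cdot\rangle^a$ at each of the four frequencies to the symbol leaves
$|\alpha\beta|(\langle\alpha\rangle\langle\beta\rangle)^{-\theta}$ with $\theta=1-2a>1/2$
(`enorm_symbol_mul_le`).

The factor $|\alpha\beta|$ is paid for by resonance:
$\xi^2-(\xi-\alpha)^2-(\xi-\beta)^2+(\xi-\alpha-\beta)^2=2\alpha\beta$, so either one of the four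
modulations or the frequency of the time cutoff is at least comparable to $\alpha\beta$
(`jap_neg_one_mul_prod_le`). If it is the cutoff, the remaining weight is integrable because
$2\theta>1$. If it is a modulation, half a power of the resonance is used twice through
Cauchy–Schwarz, and the change of variables $\beta\mapsto\alpha\beta$ supplies a Jacobian
(`lintegral_kernel_mul_le`). Together these give `exists_quadrilinear_le`. The integral of $\zeta_0$
over $[0,t]$ has Fourier decay $\langle y\rangle^{-1}$ with a constant controlled by
$\int|\zeta_0'|$ and $T_0$ (`enorm_oscillatory_le`), which is why $C$ depends on the cutoffs only
through $B$.

The representatives of $\hat u(t)$ are chosen separately for each $t$ and have no joint regularity.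
They are replaced by `duhamel`, which is jointly measurable and differentiable in $t$ at every
$\xi$. -/

open scoped SchwartzMap ComplexConjugate Convolution

/-! ### The $L^2$ Fourier transform and its representatives. -/

section FourierLTwo

variable {V : Type*} [NormedAddCommGroup V] [InnerProductSpace ℝ V] [FiniteDimensional ℝ V]
  [MeasurableSpace V] [BorelSpace V]

theorem memLp_fourierL2 (f : V → ℂ) : MemLp (fourierL2 f) 2 (volume : Measure V) := by
  unfold fourierL2
  split_ifs with h
  · exact Lp.memLp _
  · exact MemLp.zero

theorem fourierL2_of_memLp {f : V → ℂ} (h : MemLp f 2 (volume : Measure V)) :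
    fourierL2 f = ⇑(𝓕 (h.toLp f) : Lp ℂ 2 (volume : Measure V)) := by
  simp [fourierL2, h]

theorem fourierInvL2_of_memLp {f : V → ℂ} (h : MemLp f 2 (volume : Measure V)) :
    fourierInvL2 f = ⇑(𝓕⁻ (h.toLp f) : Lp ℂ 2 (volume : Measure V)) := by
  simp [fourierInvL2, h]

theorem fourierL2_congr {f g : V → ℂ} (h : f =ᵐ[volume] g) : fourierL2 f = fourierL2 g := by
  by_cases hf : MemLp f 2 (volume : Measure V)
  · have hg := (memLp_congr_ae h).1 hf
    rw [fourierL2_of_memLp hf, fourierL2_of_memLp hg, (MemLp.toLp_eq_toLp_iff hf hg).2 h]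
  · have hg : ¬ MemLp g 2 (volume : Measure V) := fun hg => hf ((memLp_congr_ae h).2 hg)
    simp [fourierL2, hf, hg]

theorem fourierInvL2_congr {f g : V → ℂ} (h : f =ᵐ[volume] g) :
    fourierInvL2 f = fourierInvL2 g := by
  by_cases hf : MemLp f 2 (volume : Measure V)
  · have hg := (memLp_congr_ae h).1 hf
    rw [fourierInvL2_of_memLp hf, fourierInvL2_of_memLp hg, (MemLp.toLp_eq_toLp_iff hf hg).2 h]
  · have hg : ¬ MemLp g 2 (volume : Measure V) := fun hg => hf ((memLp_congr_ae h).2 hg)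
    simp [fourierInvL2, hf, hg]

theorem fourierInvL2_fourierL2 {f : V → ℂ} (h : MemLp f 2 (volume : Measure V)) :
    fourierInvL2 (fourierL2 f) =ᵐ[volume] f := by
  rw [fourierInvL2_of_memLp (memLp_fourierL2 f)]
  have : (memLp_fourierL2 f).toLp (fourierL2 f) = 𝓕 (h.toLp f) := by
    apply Lp.ext
    filter_upwards [(memLp_fourierL2 f).coeFn_toLp] with x hx
    rw [hx, fourierL2_of_memLp h]
  rw [this, FourierTransform.fourierInv_fourier_eq]
  exact h.coeFn_toLp

theorem fourierL2_sub {f g : V → ℂ} (hf : MemLp f 2 (volume : Measure V))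
    (hg : MemLp g 2 (volume : Measure V)) :
    fourierL2 (f - g) =ᵐ[volume] fourierL2 f - fourierL2 g := by
  rw [fourierL2_of_memLp (hf.sub hg), fourierL2_of_memLp hf, fourierL2_of_memLp hg,
    MemLp.toLp_sub hf hg]
  have : (𝓕 (hf.toLp f - hg.toLp g) : Lp ℂ 2 (volume : Measure V))
      = 𝓕 (hf.toLp f) - 𝓕 (hg.toLp g) := (Lp.fourierTransformₗᵢ V ℂ).map_sub _ _
  rw [this]
  exact Lp.coeFn_sub _ _

theorem eLpNorm_fourierL2 {f : V → ℂ} (hf : MemLp f 2 (volume : Measure V)) :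
    eLpNorm (fourierL2 f) 2 volume = eLpNorm f 2 volume := by
  rw [fourierL2_of_memLp hf]
  have h1 := Lp.norm_fourier_eq (hf.toLp f)
  rw [Lp.norm_def, Lp.norm_def] at h1
  rw [(ENNReal.toReal_eq_toReal_iff' (Lp.eLpNorm_ne_top _) (Lp.eLpNorm_ne_top _)).1 h1]
  exact eLpNorm_congr_ae hf.coeFn_toLp

theorem eLpNorm_two_sq {α : Type*} [MeasurableSpace α] {μ : Measure α} (f : α → ℂ) :
    eLpNorm f 2 μ ^ 2 = ∫⁻ x, ‖f x‖ₑ ^ 2 ∂μ := by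
  rw [eLpNorm_eq_lintegral_rpow_enorm_toReal (by norm_num) (by norm_num), ← ENNReal.rpow_natCast,
    ← ENNReal.rpow_mul]
  simp

theorem lintegral_fourierL2_sq {f : V → ℂ} (hf : MemLp f 2 (volume : Measure V)) :
    ∫⁻ x, ‖fourierL2 f x‖ₑ ^ 2 = ∫⁻ x, ‖f x‖ₑ ^ 2 := by
  rw [← eLpNorm_two_sq, ← eLpNorm_two_sq, eLpNorm_fourierL2 hf]

theorem memLp_two_iff_lintegral {α : Type*} [MeasurableSpace α] {μ : Measure α} {f : α → ℂ}
    (hf : AEStronglyMeasurable f μ) : MemLp f 2 μ ↔ ∫⁻ x, ‖f x‖ₑ ^ 2 ∂μ < ∞ := by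
  rw [← eLpNorm_two_sq, ENNReal.pow_lt_top_iff]
  simp [MemLp, hf]

theorem integral_fourierL2_mul_schwartz {f : V → ℂ} (hf : MemLp f 2 (volume : Measure V))
    (h : 𝓢(V, ℂ)) : ∫ x, h x * fourierL2 f x = ∫ x, 𝓕 (h : V → ℂ) x * f x := by
  have h1 := DFunLike.congr_fun (Lp.fourier_toTemperedDistribution_eq (hf.toLp f)) h
  rw [TemperedDistribution.fourier_apply, Lp.toTemperedDistribution_apply,
    Lp.toTemperedDistribution_apply] at h1
  simp only [smul_eq_mul] at h1
  rw [fourierL2_of_memLp hf, ← h1]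
  apply integral_congr_ae
  filter_upwards [hf.coeFn_toLp] with x hx
  rw [hx, SchwartzMap.fourier_coe]

theorem ae_eq_of_forall_schwartz {f g : V → ℂ} (hf : LocallyIntegrable f (volume : Measure V))
    (hg : LocallyIntegrable g (volume : Measure V))
    (h : ∀ φ : 𝓢(V, ℂ), ∫ x, φ x * f x = ∫ x, φ x * g x) : f =ᵐ[volume] g := by
  refine ae_eq_of_integral_contDiff_smul_eq hf hg fun φ h1 h2 => ?_
  have hg₁ : HasCompactSupport (Complex.ofRealCLM ∘ φ) := h2.comp_left rfl
  have hg₂ : ContDiff ℝ (⊤ : ℕ∞) (Complex.ofRealCLM ∘ φ) := by fun_prop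
  have := h (hg₁.toSchwartzMap hg₂)
  simpa using this

/-- Identification by duality: an explicit candidate for the $L^2$ transform only has to satisfy the
flip formula against Schwartz functions. The explicit transforms computed below all come from this.
-/
theorem fourierL2_ae_eq_of_forall_schwartz {f G : V → ℂ} (hf : MemLp f 2 (volume : Measure V))
    (hG : LocallyIntegrable G (volume : Measure V))
    (h : ∀ φ : 𝓢(V, ℂ), ∫ x, φ x * G x = ∫ x, 𝓕 (φ : V → ℂ) x * f x) :
    fourierL2 f =ᵐ[volume] G := by
  refine ae_eq_of_forall_schwartz ((memLp_fourierL2 f).locallyIntegrable (by norm_num)) hG ?_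
  intro φ
  rw [integral_fourierL2_mul_schwartz hf, h]

theorem integral_fourier_mul_eq_flip {f g : V → ℂ} (hf : Integrable f) (hg : Integrable g) :
    ∫ x, 𝓕 f x * g x = ∫ x, f x * 𝓕 g x := by
  have := VectorFourier.integral_fourierIntegral_smul_eq_flip (μ := (volume : Measure V))
    (ν := (volume : Measure V)) (L := innerₗ V) (f := f) (g := g) Real.continuous_fourierChar
    continuous_inner hf hg
  simp only [smul_eq_mul, flip_innerₗ] at this
  exact this

theorem integral_fourierInv_mul_eq_flip {f g : V → ℂ} (hf : Integrable f) (hg : Integrable g) :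
    ∫ x, 𝓕⁻ f x * g x = ∫ x, f x * 𝓕⁻ g x := by
  simp only [Real.fourierInv_eq_fourier_comp_neg]
  rw [integral_fourier_mul_eq_flip hf.comp_neg hg]
  rw [← integral_neg_eq_self]
  simp [Real.fourierInv_eq_fourier_neg, ← Real.fourierInv_eq_fourier_comp_neg]

theorem continuous_fourier {f : V → ℂ} (hf : Integrable f) : Continuous (𝓕 f) :=
  VectorFourier.fourierIntegral_continuous Real.continuous_fourierChar continuous_inner hf

theorem continuous_fourierInv {f : V → ℂ} (hf : Integrable f) : Continuous (𝓕⁻ f) := by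
  rw [Real.fourierInv_eq_fourier_comp_neg]
  exact continuous_fourier hf.comp_neg

theorem fourierL2_ae_eq_fourier {f : V → ℂ} (hf : MemLp f 2 (volume : Measure V))
    (hf1 : Integrable f) : fourierL2 f =ᵐ[volume] 𝓕 f := by
  refine fourierL2_ae_eq_of_forall_schwartz hf (continuous_fourier hf1).locallyIntegrable ?_
  intro φ
  rw [integral_fourier_mul_eq_flip φ.integrable hf1]

theorem memLp_fourier {f : V → ℂ} (hf : MemLp f 2 (volume : Measure V)) (hf1 : Integrable f) :
    MemLp (𝓕 f) 2 (volume : Measure V) :=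
  (memLp_congr_ae (fourierL2_ae_eq_fourier hf hf1)).1 (memLp_fourierL2 f)

theorem lintegral_fourier_sq {f : V → ℂ} (hf : MemLp f 2 (volume : Measure V))
    (hf1 : Integrable f) : ∫⁻ x, ‖𝓕 f x‖ₑ ^ 2 = ∫⁻ x, ‖f x‖ₑ ^ 2 := by
  rw [← lintegral_fourierL2_sq hf]
  refine lintegral_congr_ae ?_
  filter_upwards [fourierL2_ae_eq_fourier hf hf1] with x hx
  rw [hx]

theorem memLp_comp_neg {f : V → ℂ} (hf : MemLp f 2 (volume : Measure V)) :
    MemLp (fun x => f (-x)) 2 (volume : Measure V) :=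
  hf.comp_measurePreserving (Measure.measurePreserving_neg volume)

theorem memLp_fourierInv {f : V → ℂ} (hf : MemLp f 2 (volume : Measure V)) (hf1 : Integrable f) :
    MemLp (𝓕⁻ f) 2 (volume : Measure V) := by
  rw [Real.fourierInv_eq_fourier_comp_neg]
  exact memLp_fourier (memLp_comp_neg hf) hf1.comp_neg

theorem lintegral_fourierInv_sq {f : V → ℂ} (hf : MemLp f 2 (volume : Measure V))
    (hf1 : Integrable f) : ∫⁻ x, ‖𝓕⁻ f x‖ₑ ^ 2 = ∫⁻ x, ‖f x‖ₑ ^ 2 := by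
  rw [Real.fourierInv_eq_fourier_comp_neg, lintegral_fourier_sq (memLp_comp_neg hf) hf1.comp_neg]
  exact (Measure.measurePreserving_neg (volume : Measure V)).lintegral_comp_emb
    (MeasurableEquiv.neg V).measurableEmbedding (fun x => ‖f x‖ₑ ^ 2)

theorem integral_fourier_schwartz_mul_fourierInv (φ : 𝓢(V, ℂ)) {g : V → ℂ} (hg : Integrable g) :
    ∫ x, 𝓕 (φ : V → ℂ) x * 𝓕⁻ g x = ∫ x, φ x * g x := by
  rw [← SchwartzMap.fourier_coe, ← integral_fourierInv_mul_eq_flip (𝓕 φ).integrable hg]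
  congr 1; ext x
  rw [← SchwartzMap.fourierInv_coe, FourierTransform.fourierInv_fourier_eq]

theorem fourierL2_fourierInv {g : V → ℂ} (hg : MemLp g 2 (volume : Measure V))
    (hg1 : Integrable g) : fourierL2 (𝓕⁻ g) =ᵐ[volume] g := by
  refine fourierL2_ae_eq_of_forall_schwartz (memLp_fourierInv hg hg1) hg1.locallyIntegrable ?_
  intro φ
  rw [integral_fourier_schwartz_mul_fourierInv φ hg1]

theorem ae_eq_of_fourierL2_ae_eq {f g : V → ℂ} (hf : MemLp f 2 (volume : Measure V))
    (hg : MemLp g 2 (volume : Measure V)) (h : fourierL2 f =ᵐ[volume] fourierL2 g) :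
    f =ᵐ[volume] g := by
  have h1 := fourierInvL2_congr h
  exact (fourierInvL2_fourierL2 hf).symm.trans (h1 ▸ fourierInvL2_fourierL2 hg)

theorem ae_eq_fourierInv_fourierL2 {f : V → ℂ} (hf : MemLp f 2 (volume : Measure V))
    (h : Integrable (fourierL2 f)) : f =ᵐ[volume] 𝓕⁻ (fourierL2 f) :=
  ae_eq_of_fourierL2_ae_eq hf (memLp_fourierInv (memLp_fourierL2 f) h)
    (fourierL2_fourierInv (memLp_fourierL2 f) h).symm

theorem integral_conj_mul_fourierL2 {f g : V → ℂ} (hf : MemLp f 2 (volume : Measure V))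
    (hg : MemLp g 2 (volume : Measure V)) :
    ∫ x, conj (fourierL2 f x) * fourierL2 g x = ∫ x, conj (f x) * g x := by
  have h1 := Lp.inner_fourier_eq (hf.toLp f) (hg.toLp g)
  rw [L2.inner_def, L2.inner_def] at h1
  rw [fourierL2_of_memLp hf, fourierL2_of_memLp hg]
  simp only [RCLike.inner_apply] at h1
  calc _ = _ := by congr 1; ext x; rw [mul_comm]
    _ = _ := h1
    _ = _ := by
      apply integral_congr_ae
      filter_upwards [hf.coeFn_toLp, hg.coeFn_toLp] with x h1 h2
      rw [h1, h2, mul_comm]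

theorem integral_conj_fourierInv_mul {f g : V → ℂ} (hf : MemLp f 2 (volume : Measure V))
    (hf1 : Integrable f) (hg : MemLp g 2 (volume : Measure V)) (hg1 : Integrable g) :
    ∫ x, conj (𝓕⁻ f x) * 𝓕⁻ g x = ∫ x, conj (f x) * g x := by
  rw [← integral_conj_mul_fourierL2 (memLp_fourierInv hf hf1) (memLp_fourierInv hg hg1)]
  apply integral_congr_ae
  filter_upwards [fourierL2_fourierInv hf hf1, fourierL2_fourierInv hg hg1] with x h1 h2
  rw [h1, h2]

end FourierLTwo

/-! ### Partial Fourier transforms on space-time. -/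

/-- Space-time as a product of the time axis and the space axis. -/
noncomputable def spaceTimeEquiv : SpaceTime ≃ᵐ ℝ × ℝ :=
  (MeasurableEquiv.toLp 2 (Fin 2 → ℝ)).symm.trans MeasurableEquiv.finTwoArrow

theorem spaceTimeEquiv_apply (p : SpaceTime) : spaceTimeEquiv p = (p 0, p 1) := rfl

theorem spaceTimeEquiv_symm_apply (p : ℝ × ℝ) : spaceTimeEquiv.symm p = !₂[p.1, p.2] := by
  rw [MeasurableEquiv.symm_apply_eq]
  simp [spaceTimeEquiv_apply]

theorem measurePreserving_spaceTimeEquiv :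
    MeasurePreserving spaceTimeEquiv (volume : Measure SpaceTime) (volume.prod volume) :=
  (EuclideanSpace.volume_preserving_symm_measurableEquiv_toLp (Fin 2)).trans
    (volume_preserving_finTwoArrow ℝ)

theorem lintegral_spaceTime {F : ℝ → ℝ → ℝ≥0∞} (hF : Measurable (Function.uncurry F)) :
    ∫⁻ p : SpaceTime, F (p 0) (p 1) = ∫⁻ t, ∫⁻ x, F t x := by
  have := measurePreserving_spaceTimeEquiv.lintegral_comp_emb
    spaceTimeEquiv.measurableEmbedding (Function.uncurry F)
  rw [lintegral_prod _ hF.aemeasurable] at this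
  exact this

theorem measurable_spaceTime {β : Type*} [MeasurableSpace β] {F : ℝ → ℝ → β}
    (hF : Measurable (Function.uncurry F)) :
    Measurable (fun p : SpaceTime => F (p 0) (p 1)) :=
  hF.comp spaceTimeEquiv.measurable

theorem integral_spaceTime (F : ℝ → ℝ → ℂ) (hF : Integrable (fun p : SpaceTime => F (p 0) (p 1))) :
    ∫ p : SpaceTime, F (p 0) (p 1) = ∫ t, ∫ x, F t x := by
  have h1 := measurePreserving_spaceTimeEquiv.integral_comp' (Function.uncurry F)
  have h2 := (measurePreserving_spaceTimeEquiv.integrable_comp_emb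
    spaceTimeEquiv.measurableEmbedding (g := Function.uncurry F)).1 hF
  rw [integral_prod _ h2] at h1
  exact h1

/-- The inverse Fourier transform in space of a function of time and frequency. -/
noncomputable def spaceInv (g : ℝ → ℝ → ℂ) (t x : ℝ) : ℂ := 𝓕⁻ (g t) x

/-- The Fourier transform in time of a function of time and frequency. -/
noncomputable def timeFourier (g : ℝ → ℝ → ℂ) (τ ξ : ℝ) : ℂ := 𝓕 (fun t => g t ξ) τ

theorem measurable_spaceInv {g : ℝ → ℝ → ℂ} (hg : Measurable (Function.uncurry g)) :
    Measurable (Function.uncurry (spaceInv g)) := by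
  have h : StronglyMeasurable (fun p : (ℝ × ℝ) × ℝ =>
      (Real.fourierChar (inner ℝ p.2 p.1.2) : ℂ) * g p.1.1 p.2) := by
    apply Measurable.stronglyMeasurable
    apply Measurable.mul
    · exact (continuous_subtype_val.comp (Real.continuous_fourierChar.comp
        (by fun_prop))).measurable
    · exact hg.comp (by fun_prop : Measurable fun p : (ℝ × ℝ) × ℝ => (p.1.1, p.2))
  have := h.integral_prod_right' (ν := volume)
  refine (congrArg Measurable ?_).mp this.measurable
  ext p
  simp [Function.uncurry, spaceInv, Real.fourierInv_eq, Circle.smul_def]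

theorem measurable_timeFourier {g : ℝ → ℝ → ℂ} (hg : Measurable (Function.uncurry g)) :
    Measurable (Function.uncurry (timeFourier g)) := by
  have h : StronglyMeasurable (fun p : (ℝ × ℝ) × ℝ =>
      (Real.fourierChar (-inner ℝ p.2 p.1.1) : ℂ) * g p.2 p.1.2) := by
    apply Measurable.stronglyMeasurable
    apply Measurable.mul
    · exact (continuous_subtype_val.comp (Real.continuous_fourierChar.comp
        (by fun_prop))).measurable
    · exact hg.comp (by fun_prop : Measurable fun p : (ℝ × ℝ) × ℝ => (p.2, p.1.2))
  have := h.integral_prod_right' (ν := volume)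
  refine (congrArg Measurable ?_).mp this.measurable
  ext p
  simp [Function.uncurry, timeFourier, Real.fourier_eq, Circle.smul_def]

theorem ae_memLp_slice {g : ℝ → ℝ → ℂ} (hg : Measurable (Function.uncurry g))
    (hg2 : MemLp (Function.uncurry g) 2 (volume.prod volume)) :
    ∀ᵐ t, MemLp (g t) 2 := by
  have h := (memLp_two_iff_lintegral hg2.1).1 hg2
  rw [lintegral_prod _ (by fun_prop)] at h
  filter_upwards [ae_lt_top (Measurable.lintegral_prod_right'
      (f := fun p : ℝ × ℝ => ‖Function.uncurry g p‖ₑ ^ 2) (by fun_prop)) h.ne] with t ht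
  exact (memLp_two_iff_lintegral
    (hg.comp measurable_prodMk_left).aestronglyMeasurable).2 ht

theorem ae_memLp_slice' {g : ℝ → ℝ → ℂ} (hg : Measurable (Function.uncurry g))
    (hg2 : MemLp (Function.uncurry g) 2 (volume.prod volume)) :
    ∀ᵐ ξ, MemLp (fun t => g t ξ) 2 := by
  have h := (memLp_two_iff_lintegral hg2.1).1 hg2
  rw [lintegral_prod_symm _ (by fun_prop)] at h
  filter_upwards [ae_lt_top (Measurable.lintegral_prod_left'
      (f := fun p : ℝ × ℝ => ‖Function.uncurry g p‖ₑ ^ 2) (by fun_prop)) h.ne] with t ht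
  exact (memLp_two_iff_lintegral
    (hg.comp measurable_prodMk_right).aestronglyMeasurable).2 ht

theorem memLp_spaceInv {g : ℝ → ℝ → ℂ} (hg : Measurable (Function.uncurry g))
    (hg1 : Integrable (Function.uncurry g) (volume.prod volume))
    (hg2 : MemLp (Function.uncurry g) 2 (volume.prod volume)) :
    MemLp (fun p : SpaceTime => spaceInv g (p 0) (p 1)) 2 := by
  have hm := measurable_spaceInv hg
  rw [memLp_two_iff_lintegral (measurable_spaceTime hm).aestronglyMeasurable,
    lintegral_spaceTime (F := fun t x => ‖spaceInv g t x‖ₑ ^ 2) (by fun_prop)]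
  have h := (memLp_two_iff_lintegral hg2.1).1 hg2
  rw [lintegral_prod _ (by fun_prop)] at h
  refine lt_of_eq_of_lt (lintegral_congr_ae ?_) h
  filter_upwards [ae_memLp_slice hg hg2, hg1.prod_right_ae] with t h1 h2
  exact lintegral_fourierInv_sq h1 h2

theorem lintegral_timeFourier_sq {g : ℝ → ℝ → ℂ} (hg : Measurable (Function.uncurry g))
    (hg1 : Integrable (Function.uncurry g) (volume.prod volume))
    (hg2 : MemLp (Function.uncurry g) 2 (volume.prod volume)) :
    ∫⁻ τ, ∫⁻ ξ, ‖timeFourier g τ ξ‖ₑ ^ 2 < ∞ := by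
  have hm := measurable_timeFourier hg
  rw [lintegral_lintegral_swap (by fun_prop)]
  have h := (memLp_two_iff_lintegral hg2.1).1 hg2
  rw [lintegral_prod_symm _ (by fun_prop)] at h
  refine lt_of_eq_of_lt (lintegral_congr_ae ?_) h
  filter_upwards [ae_memLp_slice' hg hg2, hg1.prod_left_ae] with t h1 h2
  exact lintegral_fourier_sq h1 h2

theorem memLp_timeFourier {g : ℝ → ℝ → ℂ} (hg : Measurable (Function.uncurry g))
    (hg1 : Integrable (Function.uncurry g) (volume.prod volume))
    (hg2 : MemLp (Function.uncurry g) 2 (volume.prod volume)) :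
    MemLp (fun p : SpaceTime => timeFourier g (p 0) (p 1)) 2 := by
  have hm := measurable_timeFourier hg
  rw [memLp_two_iff_lintegral (measurable_spaceTime hm).aestronglyMeasurable,
    lintegral_spaceTime (F := fun t x => ‖timeFourier g t x‖ₑ ^ 2) (by fun_prop)]
  exact lintegral_timeFourier_sq hg hg1 hg2

/-- Decay in one variable, uniformly in the other, makes every slice integrable and provides a
dominating function independent of the frozen variable. -/
theorem schwartz_slice_bound (φ : 𝓢(SpaceTime, ℂ)) : ∃ C, ∀ t x : ℝ,
    ‖φ !₂[t, x]‖ ≤ C * (1 + t ^ 2)⁻¹ ∧ ‖φ !₂[t, x]‖ ≤ C * (1 + x ^ 2)⁻¹ := by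
  obtain ⟨C₀, -, h0⟩ := φ.decay 0 0
  obtain ⟨C₂, -, h2⟩ := φ.decay 2 0
  refine ⟨C₀ + C₂, fun t x => ?_⟩
  have h0 := h0 !₂[t, x]
  have h2 := h2 !₂[t, x]
  rw [norm_iteratedFDeriv_zero] at h0 h2
  rw [EuclideanSpace.norm_sq_eq] at h2
  simp only [Fin.sum_univ_two, pow_zero, one_mul] at h0 h2
  simp only [Real.norm_eq_abs, sq_abs] at h2
  simp only [Matrix.cons_val_zero, Matrix.cons_val_one] at h2
  have := norm_nonneg (φ !₂[t, x])
  constructor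
  · rw [← div_eq_mul_inv, le_div_iff₀ (by positivity)]
    nlinarith [mul_nonneg (sq_nonneg x) this]
  · rw [← div_eq_mul_inv, le_div_iff₀ (by positivity)]
    nlinarith [mul_nonneg (sq_nonneg t) this]

theorem integrable_schwartz_slice_right (φ : 𝓢(SpaceTime, ℂ)) (t : ℝ) :
    Integrable (fun x => φ !₂[t, x]) := by
  obtain ⟨C, hC⟩ := schwartz_slice_bound φ
  exact (integrable_inv_one_add_sq.const_mul C).mono' (by fun_prop)
    (Eventually.of_forall fun x => (hC t x).2)

theorem integrable_schwartz_slice_left (φ : 𝓢(SpaceTime, ℂ)) (x : ℝ) :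
    Integrable (fun t => φ !₂[t, x]) := by
  obtain ⟨C, hC⟩ := schwartz_slice_bound φ
  exact (integrable_inv_one_add_sq.const_mul C).mono' (by fun_prop)
    (Eventually.of_forall fun t => (hC t x).1)

theorem eq_toLp_spaceTime (p : SpaceTime) : !₂[p 0, p 1] = p :=
  (spaceTimeEquiv_symm_apply (p 0, p 1)).symm.trans (spaceTimeEquiv.symm_apply_apply p)

theorem integrable_schwartz_prod (φ : 𝓢(SpaceTime, ℂ)) :
    Integrable (fun p : ℝ × ℝ => φ !₂[p.1, p.2]) (volume.prod volume) := by
  rw [← measurePreserving_spaceTimeEquiv.integrable_comp_emb spaceTimeEquiv.measurableEmbedding]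
  refine φ.integrable.congr (Eventually.of_forall fun p => ?_)
  simp [spaceTimeEquiv_apply, eq_toLp_spaceTime]

theorem fourierChar_add_coe (x y : ℝ) :
    ((Real.fourierChar (x + y) : Circle) : ℂ) = Real.fourierChar x * Real.fourierChar y := by
  rw [AddChar.map_add_eq_mul, Circle.coe_mul]

theorem continuous_fourierChar_coe : Continuous fun x : ℝ => (Real.fourierChar x : ℂ) :=
  continuous_subtype_val.comp Real.continuous_fourierChar

theorem fourier_schwartz_slice (φ : 𝓢(SpaceTime, ℂ)) (t x : ℝ) :
    𝓕 (φ : SpaceTime → ℂ) !₂[t, x]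
      = 𝓕 (timeFourier (fun τ ξ => φ !₂[τ, ξ]) t) x := by
  have hi := integrable_schwartz_prod φ
  set F : ℝ → ℝ → ℂ := fun τ ξ =>
    (Real.fourierChar (-(τ * t)) : ℂ) * ((Real.fourierChar (-(ξ * x)) : ℂ) * φ !₂[τ, ξ]) with hF
  have hFi : Integrable (Function.uncurry F) (volume.prod volume) := by
    refine hi.mono ?_ (Eventually.of_forall fun p => by
      simp [hF, Function.uncurry, Circle.norm_coe])
    have h1 : Continuous fun p : ℝ × ℝ => (Real.fourierChar (-(p.1 * t)) : ℂ) :=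
      continuous_fourierChar_coe.comp (by fun_prop)
    have h2 : Continuous fun p : ℝ × ℝ => (Real.fourierChar (-(p.2 * x)) : ℂ) :=
      continuous_fourierChar_coe.comp (by fun_prop)
    have h3 : Continuous fun p : ℝ × ℝ => φ !₂[p.1, p.2] := by fun_prop
    exact (h1.mul (h2.mul h3)).aestronglyMeasurable
  calc 𝓕 (φ : SpaceTime → ℂ) !₂[t, x] = ∫ p : SpaceTime, F (p 0) (p 1) := by
        rw [Real.fourier_eq]
        congr 1; ext p
        simp only [hF, eq_toLp_spaceTime, Circle.smul_def, smul_eq_mul, ← mul_assoc,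
          ← fourierChar_add_coe]
        simp only [PiLp.inner_apply, Fin.sum_univ_two]
        simp
        left; ring_nf
    _ = ∫ τ, ∫ ξ, F τ ξ := integral_spaceTime F
        ((measurePreserving_spaceTimeEquiv.integrable_comp_emb
          spaceTimeEquiv.measurableEmbedding (g := Function.uncurry F)).2 hFi)
    _ = ∫ ξ, ∫ τ, F τ ξ := integral_integral_swap hFi
    _ = _ := by
        rw [Real.fourier_eq]
        congr 1; ext ξ
        rw [timeFourier, Real.fourier_eq, Circle.smul_def, smul_eq_mul, ← integral_const_mul]
        congr 1; ext τ
        simp [hF, Circle.smul_def]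
        ring_nf

/-- With $H$ the time transform of $\varphi$, both sides equal $\iint Hg$. On the left the time
transform is flipped onto $\varphi$; on the right the spatial inverse transform is flipped and
cancels the spatial transform of $H$. Slices of $g$ are integrable only almost everywhere, which is
enough under the outer integral. -/
theorem integral_fourier_mul_spaceInv {g : ℝ → ℝ → ℂ}
    (hg : Measurable (Function.uncurry g))
    (hg1 : Integrable (Function.uncurry g) (volume.prod volume))
    (hg2 : MemLp (Function.uncurry g) 2 (volume.prod volume)) (φ : 𝓢(SpaceTime, ℂ)) :
    ∫ q : SpaceTime, φ q * timeFourier g (q 0) (q 1)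
      = ∫ p : SpaceTime, 𝓕 (φ : SpaceTime → ℂ) p * spaceInv g (p 0) (p 1) := by
  set h : ℝ → ℝ → ℂ := fun τ ξ => φ !₂[τ, ξ] with hh
  set H : ℝ → ℝ → ℂ := timeFourier h with hH
  have hhm : Measurable (Function.uncurry h) := by
    have : Continuous fun p : ℝ × ℝ => φ !₂[p.1, p.2] := by fun_prop
    exact this.measurable
  have hHm : Measurable (Function.uncurry H) := measurable_timeFourier hhm
  obtain ⟨C, hC⟩ := schwartz_slice_bound φ
  have hHb : ∀ t ξ, ‖H t ξ‖ ≤ ∫ τ, ‖h τ ξ‖ := fun t ξ => by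
    simp only [hH, timeFourier]
    exact VectorFourier.norm_fourierIntegral_le_integral_norm _ _ _ _ _
  have hHi : ∀ t, Integrable (H t) := fun t => by
    refine ((integrable_schwartz_prod φ).norm.integral_prod_right).mono'
      (hHm.comp measurable_prodMk_left).aestronglyMeasurable
      (Eventually.of_forall fun ξ => hHb t ξ)
  have hHc : ∀ t, Continuous (H t) := fun t => by
    refine continuous_of_dominated (bound := fun τ => C * (1 + τ ^ 2)⁻¹) (fun ξ => ?_)
      (fun ξ => Eventually.of_forall fun τ => ?_) (integrable_inv_one_add_sq.const_mul C)
      (Eventually.of_forall fun τ => ?_)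
    · have h1 : Continuous fun τ : ℝ => (Real.fourierChar (-inner ℝ τ t) : ℂ) :=
        continuous_fourierChar_coe.comp (by fun_prop)
      have h3 : Continuous fun τ : ℝ => φ !₂[τ, ξ] := by fun_prop
      exact (h1.mul h3).aestronglyMeasurable
    · simpa [hh] using (hC τ ξ).1
    · have h3 : Continuous fun ξ : ℝ => φ !₂[τ, ξ] := by fun_prop
      exact continuous_const.mul h3
  have hFH : ∀ t x, 𝓕 (φ : SpaceTime → ℂ) !₂[t, x] = 𝓕 (H t) x := fourier_schwartz_slice φ
  have hFHi : ∀ t, Integrable (𝓕 (H t)) := fun t => by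
    refine (integrable_schwartz_slice_right (𝓕 φ) t).congr (Eventually.of_forall fun x => ?_)
    simp [← hFH, SchwartzMap.fourier_coe]
  have hHbd : ∀ t ξ, ‖H t ξ‖ ≤ ∫ τ, C * (1 + τ ^ 2)⁻¹ := fun t ξ =>
    (hHb t ξ).trans (integral_mono (integrable_schwartz_slice_left φ ξ).norm
      (integrable_inv_one_add_sq.const_mul C) fun τ => (hC τ ξ).1)
  have hHg : Integrable (Function.uncurry fun t ξ => H t ξ * g t ξ) (volume.prod volume) :=
    hg1.bdd_mul hHm.aestronglyMeasurable
      (Eventually.of_forall fun p => hHbd p.1 p.2)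
  have hW := memLp_spaceInv hg hg1 hg2
  have hG := memLp_timeFourier hg hg1 hg2
  have e1 : ∫ p : SpaceTime, 𝓕 (φ : SpaceTime → ℂ) p * spaceInv g (p 0) (p 1)
      = ∫ t, ∫ ξ, H t ξ * g t ξ := by
    have hi : Integrable fun p : SpaceTime =>
        𝓕 (H (p 0)) (p 1) * spaceInv g (p 0) (p 1) := by
      refine (((𝓕 φ).memLp 2).integrable_mul hW).congr (Eventually.of_forall fun p => ?_)
      simp [← hFH, eq_toLp_spaceTime, SchwartzMap.fourier_coe]
    rw [← integral_congr_ae (hg1.prod_right_ae.mono fun t ht => ?_),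
      ← integral_spaceTime (fun t x => 𝓕 (H t) x * spaceInv g t x) hi]
    · congr 1; ext p
      simp [← hFH, eq_toLp_spaceTime]
    · simp only [spaceInv]
      simp_rw [mul_comm (𝓕 (H t) _)]
      rw [integral_fourierInv_mul_eq_flip (f := g t) ht (hFHi t),
        (hHc t).fourierInv_fourier_eq (hHi t) (hFHi t)]
      congr 1; ext ξ; rw [mul_comm]
  have e2 : ∫ q : SpaceTime, φ q * timeFourier g (q 0) (q 1)
      = ∫ ξ, ∫ t, H t ξ * g t ξ := by
    have hi : Integrable fun p : SpaceTime => h (p 0) (p 1) * timeFourier g (p 0) (p 1) := by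
      refine ((φ.memLp 2).integrable_mul hG).congr (Eventually.of_forall fun p => ?_)
      simp [hh, eq_toLp_spaceTime]
    have hi' : Integrable (Function.uncurry fun τ ξ => h τ ξ * timeFourier g τ ξ)
      (volume.prod volume) := (measurePreserving_spaceTimeEquiv.integrable_comp_emb
          spaceTimeEquiv.measurableEmbedding).1 hi
    calc _ = ∫ p : SpaceTime, h (p 0) (p 1) * timeFourier g (p 0) (p 1) := by
          simp [hh, eq_toLp_spaceTime]
      _ = ∫ τ, ∫ ξ, h τ ξ * timeFourier g τ ξ :=
          integral_spaceTime (fun τ ξ => h τ ξ * timeFourier g τ ξ) hi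
      _ = ∫ ξ, ∫ τ, h τ ξ * timeFourier g τ ξ := integral_integral_swap hi'
      _ = _ := by
          refine integral_congr_ae (hg1.prod_left_ae.mono fun ξ hξ => ?_)
          exact (integral_fourier_mul_eq_flip (integrable_schwartz_slice_left φ ξ) hξ).symm
  rw [e1, e2, integral_integral_swap hHg]

/-- The space-time Fourier transform of the inverse spatial Fourier transform of `g` is the
temporal Fourier transform of `g`. -/
theorem fourierL2_spaceInv {g : ℝ → ℝ → ℂ} (hg : Measurable (Function.uncurry g))
    (hg1 : Integrable (Function.uncurry g) (volume.prod volume))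
    (hg2 : MemLp (Function.uncurry g) 2 (volume.prod volume)) :
    fourierL2 (fun p : SpaceTime => spaceInv g (p 0) (p 1))
      =ᵐ[volume] fun q => timeFourier g (q 0) (q 1) :=
  fourierL2_ae_eq_of_forall_schwartz (memLp_spaceInv hg hg1 hg2)
    ((memLp_timeFourier hg hg1 hg2).locallyIntegrable (by norm_num))
    (integral_fourier_mul_spaceInv hg hg1 hg2)

/-! ### Cauchy–Schwarz, dilations and powers of the Japanese bracket. -/

theorem lintegral_mul_sq_le {α : Type*} [MeasurableSpace α] {μ : Measure α} {f g : α → ℝ≥0∞}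
    (hf : AEMeasurable f μ) (hg : AEMeasurable g μ) :
    (∫⁻ x, f x * g x ∂μ) ^ 2 ≤ (∫⁻ x, f x ^ 2 ∂μ) * ∫⁻ x, g x ^ 2 ∂μ := by
  have h := ENNReal.lintegral_mul_le_Lp_mul_Lq μ Real.HolderConjugate.two_two hf hg
  calc (∫⁻ x, f x * g x ∂μ) ^ 2 ≤ ((∫⁻ x, f x ^ (2 : ℝ) ∂μ) ^ (1 / 2 : ℝ) *
        (∫⁻ x, g x ^ (2 : ℝ) ∂μ) ^ (1 / 2 : ℝ)) ^ 2 := by gcongr; exact h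
    _ = _ := by
      rw [mul_pow, ← ENNReal.rpow_natCast, ← ENNReal.rpow_mul, ← ENNReal.rpow_natCast,
        ← ENNReal.rpow_mul]
      simp

theorem lintegral_comp_const_mul (F : ℝ → ℝ≥0∞) {c : ℝ} (hc : c ≠ 0) :
    ∫⁻ x, F (c * x) = ENNReal.ofReal |c⁻¹| * ∫⁻ x, F x := by
  rw [← smul_eq_mul, ← lintegral_smul_measure, ← Real.map_volume_mul_left hc]
  exact ((Homeomorph.mulLeft₀ c hc).measurableEmbedding.lintegral_map F).symm

theorem lintegral_comp_smul {V : Type*} [NormedAddCommGroup V] [InnerProductSpace ℝ V]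
    [FiniteDimensional ℝ V] [MeasurableSpace V] [BorelSpace V] (F : V → ℝ≥0∞) {c : ℝ}
    (hc : c ≠ 0) :
    ∫⁻ x, F (c • x) = ENNReal.ofReal |(c ^ Module.finrank ℝ V)⁻¹| * ∫⁻ x, F x := by
  rw [← smul_eq_mul, ← lintegral_smul_measure, ← Measure.map_addHaar_smul volume hc]
  exact ((Homeomorph.smulOfNeZero c hc).measurableEmbedding.lintegral_map F).symm

theorem one_le_bracket (x : ℝ) : 1 ≤ bracket x := by
  rw [bracket, Real.one_le_sqrt]
  nlinarith [sq_nonneg x]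

theorem bracket_pos (x : ℝ) : 0 < bracket x := one_pos.trans_le (one_le_bracket x)

theorem bracket_sq (x : ℝ) : bracket x ^ 2 = 1 + x ^ 2 := by
  rw [bracket, Real.sq_sqrt (by positivity)]

theorem continuous_bracket : Continuous bracket := by
  unfold bracket
  fun_prop

theorem abs_le_bracket (x : ℝ) : |x| ≤ bracket x :=
  abs_le_of_sq_le_sq (by rw [bracket_sq]; linarith) (bracket_pos x).le

theorem bracket_neg (x : ℝ) : bracket (-x) = bracket x := by simp [bracket]

theorem bracket_le_bracket {x y : ℝ} (h : |x| ≤ |y|) : bracket x ≤ bracket y :=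
  Real.sqrt_le_sqrt (by linarith [sq_le_sq.2 h])

theorem bracket_add_le (x y : ℝ) : bracket (x + y) ≤ bracket x + |y| := by
  refine le_of_sq_le_sq ?_ (by positivity [bracket_pos x])
  have h1 := abs_le_bracket x
  have h2 : x * y ≤ |x| * |y| := by rw [← abs_mul]; exact le_abs_self _
  nlinarith [bracket_sq x, bracket_sq (x + y), sq_abs y, abs_nonneg y, abs_nonneg x]

theorem abs_bracket_sub_le (x y : ℝ) : |bracket x - bracket y| ≤ |x - y| := by
  rw [abs_le]
  have h1 := bracket_add_le x (y - x)
  have h2 := bracket_add_le y (x - y)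
  rw [abs_sub_comm] at h1
  simp only [add_sub_cancel] at h1 h2
  constructor <;> linarith

theorem continuous_bracket_rpow (r : ℝ) : Continuous fun x => bracket x ^ r :=
  continuous_bracket.rpow_const fun x => Or.inl (bracket_pos x).ne'

/-- The power `⟨x⟩^r` of the Japanese bracket, as an extended nonnegative number. -/
noncomputable def jap (r x : ℝ) : ℝ≥0∞ := ENNReal.ofReal (bracket x ^ r)

theorem continuous_jap (r : ℝ) : Continuous (jap r) :=
  ENNReal.continuous_ofReal.comp (continuous_bracket_rpow r)

@[fun_prop]
theorem measurable_jap (r : ℝ) : Measurable (jap r) := (continuous_jap r).measurable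

theorem jap_ne_top (r x : ℝ) : jap r x ≠ ∞ := ENNReal.ofReal_ne_top

theorem jap_ne_zero (r x : ℝ) : jap r x ≠ 0 := by
  simp [jap, Real.rpow_pos_of_pos (bracket_pos x)]

theorem jap_mul (r r' x : ℝ) : jap r x * jap r' x = jap (r + r') x := by
  rw [jap, jap, jap, ← ENNReal.ofReal_mul (Real.rpow_nonneg (bracket_pos x).le _),
    Real.rpow_add (bracket_pos x)]

theorem jap_zero (x : ℝ) : jap 0 x = 1 := by simp [jap]

theorem jap_pow_two (r x : ℝ) : jap r x ^ 2 = jap (2 * r) x := by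
  rw [sq, jap_mul]; ring_nf

theorem jap_neg (r x : ℝ) : jap r (-x) = jap r x := by rw [jap, jap, bracket_neg]

theorem jap_mono {r r' : ℝ} (h : r ≤ r') (x : ℝ) : jap r x ≤ jap r' x :=
  ENNReal.ofReal_le_ofReal (Real.rpow_le_rpow_of_exponent_le (one_le_bracket x) h)

theorem jap_le_one {r : ℝ} (h : r ≤ 0) (x : ℝ) : jap r x ≤ 1 := by
  rw [← jap_zero x]; exact jap_mono h x

theorem one_le_jap {r : ℝ} (h : 0 ≤ r) (x : ℝ) : 1 ≤ jap r x := by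
  rw [← jap_zero x]; exact jap_mono h x

theorem lintegral_jap_lt_top {r : ℝ} (hr : r < -1) : ∫⁻ x, jap r x < ∞ := by
  have h := integrable_rpow_neg_one_add_norm_sq (E := ℝ) (r := -r) (μ := volume)
    (by simp; linarith)
  have h2 := h.lintegral_lt_top
  refine lt_of_eq_of_lt (lintegral_congr fun x => ?_) h2
  rw [jap, bracket, Real.sqrt_eq_rpow, ← Real.rpow_mul (by positivity), Real.norm_eq_abs, sq_abs]
  ring_nf

theorem lintegral_jap_comp_lt_top {r : ℝ} (hr : r < -1) {c : ℝ} (hc : c ≠ 0) :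
    ∫⁻ x, jap r (c * x) < ∞ := by
  rw [lintegral_comp_const_mul _ hc]
  exact ENNReal.mul_lt_top ENNReal.ofReal_lt_top (lintegral_jap_lt_top hr)

/-! ### Regularity of classical solutions on the frequency side. -/

theorem hsNorm_sq {f : ℝ → ℂ} (hf : MemLp f 2) (s : ℝ) :
    hsNorm s f ^ 2 = ENNReal.ofReal (2 * Real.pi) *
      ∫⁻ ξ, ‖fourierL2 f ξ‖ₑ ^ 2 * jap (2 * s) (2 * Real.pi * ξ) := by
  have hpi : (2 * Real.pi)⁻¹ ≠ 0 := by positivity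
  rw [hsNorm, if_pos hf, ← ENNReal.rpow_natCast, ← ENNReal.rpow_mul]
  norm_num
  have h := lintegral_comp_const_mul
    (fun ξ => ‖fourierL2 f ξ‖ₑ ^ 2 * jap (2 * s) (2 * Real.pi * ξ)) hpi
  rw [inv_inv, abs_of_pos (by positivity), ENNReal.ofReal_mul (by norm_num)] at h
  norm_num at h
  rw [← h]
  refine lintegral_congr fun ξ => ?_
  have e1 : (2 * Real.pi)⁻¹ = Real.pi⁻¹ * (1 / 2) := by rw [mul_inv]; ring
  have e2 : 2 * Real.pi * (Real.pi⁻¹ * (1 / 2) * ξ) = ξ := by field_simp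
  rw [hat, jap, smul_eq_mul, e1, e2]

theorem memLp_of_hsNorm_lt_top {f : ℝ → ℂ} {s : ℝ} (h : hsNorm s f < ∞) : MemLp f 2 := by
  by_contra hf
  simp [hsNorm, hf] at h

/-- A weighted `L¹` norm on the frequency side. -/
noncomputable def weightedL1 (G : ℝ → ℂ) : ℝ≥0∞ :=
  ∫⁻ ξ, jap 8 (2 * Real.pi * ξ) * ‖G ξ‖ₑ

/-- Cauchy–Schwarz with $\langle\cdot\rangle^{8}=\langle\cdot\rangle^{-2}\langle\cdot\rangle^{10}$,
since $\langle\cdot\rangle^{-4}$ is integrable. This is how $H^{10}$ enters: it yields sup bounds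
for $u$ and $u_{xx}$, and room to absorb the phase $4\pi^2\xi^2$. -/
theorem exists_weightedL1_le : ∃ K : ℝ≥0, ∀ f : ℝ → ℂ, MemLp f 2 →
    weightedL1 (fourierL2 f) ≤ K * hsNorm 10 f := by
  have hK := lintegral_jap_comp_lt_top (r := -4) (by norm_num) (c := 2 * Real.pi) (by positivity)
  set K := (∫⁻ ξ, jap (-4) (2 * Real.pi * ξ)) with hKdef
  refine ⟨(K ^ (1 / 2 : ℝ)).toNNReal, fun f hf => ?_⟩
  have hKt : K ^ (1 / 2 : ℝ) ≠ ∞ := ENNReal.rpow_ne_top_of_nonneg (by norm_num) hK.ne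
  rw [ENNReal.coe_toNNReal hKt]
  refine (ENNReal.pow_le_pow_left_iff two_ne_zero).1 ?_
  have hm : AEMeasurable (fun ξ => ‖fourierL2 f ξ‖ₑ) := (memLp_fourierL2 f).1.enorm
  have h := lintegral_mul_sq_le (μ := volume) (f := fun ξ => jap (-2) (2 * Real.pi * ξ))
    (g := fun ξ => jap 10 (2 * Real.pi * ξ) * ‖fourierL2 f ξ‖ₑ) (by fun_prop)
    (AEMeasurable.mul (by fun_prop) hm)
  have e1 : ∀ ξ, jap (-2) (2 * Real.pi * ξ) * (jap 10 (2 * Real.pi * ξ) * ‖fourierL2 f ξ‖ₑ)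
      = jap 8 (2 * Real.pi * ξ) * ‖fourierL2 f ξ‖ₑ := fun ξ => by
    rw [← mul_assoc, jap_mul]; norm_num
  simp only [e1, mul_pow, jap_pow_two] at h
  rw [mul_pow, hsNorm_sq hf, ← ENNReal.rpow_natCast (K ^ _), ← ENNReal.rpow_mul]
  norm_num at h ⊢
  refine h.trans ?_
  gcongr
  calc _ = 1 * ∫⁻ ξ, ‖fourierL2 f ξ‖ₑ ^ 2 * jap 20 (2 * Real.pi * ξ) := by
        rw [one_mul]; congr 1; ext ξ; rw [mul_comm]
    _ ≤ _ := by
        gcongr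
        rw [← ENNReal.ofReal_one, ← ENNReal.ofReal_ofNat, ← ENNReal.ofReal_mul (by norm_num)]
        exact ENNReal.ofReal_le_ofReal (by linarith [Real.pi_gt_three])

theorem eLpNorm_le_hsNorm {f : ℝ → ℂ} (hf : MemLp f 2) : eLpNorm f 2 volume ≤ hsNorm 10 f := by
  refine (ENNReal.pow_le_pow_left_iff two_ne_zero).1 ?_
  rw [hsNorm_sq hf, ← eLpNorm_fourierL2 hf, eLpNorm_two_sq]
  calc _ = 1 * ∫⁻ ξ, ‖fourierL2 f ξ‖ₑ ^ 2 := by rw [one_mul]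
    _ ≤ _ := by
        gcongr with ξ
        · rw [← ENNReal.ofReal_one]
          exact ENNReal.ofReal_le_ofReal (by linarith [Real.pi_gt_three])
        · exact le_mul_of_one_le_right' (one_le_jap (by norm_num) _)

theorem weightedL1_sub_comm (f g : ℝ → ℂ) : weightedL1 (f - g) = weightedL1 (g - f) := by
  refine lintegral_congr fun ξ => ?_
  rw [Pi.sub_apply, Pi.sub_apply, enorm_sub_rev]

theorem weightedL1_le_add {f g : ℝ → ℂ} (hf : AEStronglyMeasurable f) :
    weightedL1 g ≤ weightedL1 f + weightedL1 (g - f) := by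
  have hm : AEMeasurable fun ξ => jap 8 (2 * Real.pi * ξ) * ‖f ξ‖ₑ :=
    AEMeasurable.mul (by fun_prop) hf.enorm
  unfold weightedL1
  rw [← lintegral_add_left' hm]
  gcongr with ξ
  rw [← mul_add]
  gcongr
  calc ‖g ξ‖ₑ = ‖f ξ + (g - f) ξ‖ₑ := by simp
    _ ≤ _ := enorm_add_le _ _

theorem integrable_of_weightedL1 {G : ℝ → ℂ} (hG : AEStronglyMeasurable G)
    (h : weightedL1 G < ∞) {p : ℝ → ℂ} (hp : Continuous p)
    (hpb : ∀ ξ, ‖p ξ‖ₑ ≤ jap 8 (2 * Real.pi * ξ)) : Integrable fun ξ => p ξ * G ξ := by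
  refine ⟨hp.aestronglyMeasurable.mul hG, lt_of_le_of_lt (lintegral_mono fun ξ => ?_) h⟩
  rw [enorm_mul]
  gcongr
  exact hpb ξ

theorem enorm_fourierInv_le (G : ℝ → ℂ) (x : ℝ) : ‖𝓕⁻ G x‖ₑ ≤ ∫⁻ ξ, ‖G ξ‖ₑ := by
  rw [Real.fourierInv_eq]
  refine (enorm_integral_le_lintegral_enorm _).trans (le_of_eq (lintegral_congr fun ξ => ?_))
  rw [Circle.smul_def, enorm_smul, ← ofReal_norm, Circle.norm_coe, ENNReal.ofReal_one, one_mul]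

theorem lintegral_enorm_le_weightedL1 (G : ℝ → ℂ) : ∫⁻ ξ, ‖G ξ‖ₑ ≤ weightedL1 G :=
  lintegral_mono fun _ => le_mul_of_one_le_left' (one_le_jap (by norm_num) _)

/-- The cubic nonlinearity `|u|²u` at time `t`. -/
noncomputable def cubic (u : ℝ → ℝ → ℂ) (t x : ℝ) : ℂ := (‖u t x‖ : ℂ) ^ 2 * u t x

section SmoothSolution

variable {ω : ℝ} {ζ₀ : ℝ → ℝ} {u₀ : ℝ → ℂ} {u : ℝ → ℝ → ℂ}

theorem IsSmoothSolution.memLp (h : IsSmoothSolution ω ζ₀ u₀ u) (t : ℝ) : MemLp (u t) 2 :=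
  memLp_of_hsNorm_lt_top (h.mem t)

theorem IsSmoothSolution.aestronglyMeasurable (_ : IsSmoothSolution ω ζ₀ u₀ u) (t : ℝ) :
    AEStronglyMeasurable (fourierL2 (u t)) := (memLp_fourierL2 _).1

theorem IsSmoothSolution.weightedL1_lt_top (h : IsSmoothSolution ω ζ₀ u₀ u) (t : ℝ) :
    weightedL1 (fourierL2 (u t)) < ∞ := by
  obtain ⟨K, hK⟩ := exists_weightedL1_le
  exact (hK _ (h.memLp t)).trans_lt (ENNReal.mul_lt_top (by simp) (h.mem t))

theorem IsSmoothSolution.tendsto_weightedL1_sub (h : IsSmoothSolution ω ζ₀ u₀ u) (t : ℝ) :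
    Tendsto (fun t' => weightedL1 (fourierL2 (u t') - fourierL2 (u t))) (𝓝 t) (𝓝 0) := by
  obtain ⟨K, hK⟩ := exists_weightedL1_le
  have h1 : Tendsto (fun t' => K * hsNorm 10 (u t' - u t)) (𝓝 t) (𝓝 0) := by
    simpa using ENNReal.Tendsto.const_mul (h.continuous t) (Or.inr (by simp : (K : ℝ≥0∞) ≠ ∞))
  refine tendsto_of_tendsto_of_tendsto_of_le_of_le tendsto_const_nhds h1 (fun _ => zero_le) ?_
  intro t'
  refine le_trans (le_of_eq (lintegral_congr_ae ?_)) (hK _ ((h.memLp t').sub (h.memLp t)))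
  filter_upwards [fourierL2_sub (h.memLp t') (h.memLp t)] with ξ hξ
  rw [hξ]

theorem IsSmoothSolution.tendsto_eLpNorm_sub (h : IsSmoothSolution ω ζ₀ u₀ u) (t : ℝ) :
    Tendsto (fun t' => eLpNorm (u t' - u t) 2 volume) (𝓝 t) (𝓝 0) :=
  tendsto_of_tendsto_of_tendsto_of_le_of_le tendsto_const_nhds (h.continuous t)
    (fun _ => zero_le) fun t' => eLpNorm_le_hsNorm ((h.memLp t').sub (h.memLp t))

/-- The symmetry of $D$ turns the one-sided triangle inequality into a two-sided squeeze. -/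
theorem continuous_toReal_of_le_add {N : ℝ → ℝ≥0∞} {D : ℝ → ℝ → ℝ≥0∞} (hN : ∀ t, N t ≠ ∞)
    (hD : ∀ t, Tendsto (fun t' => D t' t) (𝓝 t) (𝓝 0)) (h1 : ∀ t t', N t' ≤ N t + D t' t)
    (h2 : ∀ t t', D t t' = D t' t) : Continuous fun t => (N t).toReal := by
  rw [continuous_iff_continuousAt]
  intro t
  have hc : Tendsto N (𝓝 t) (𝓝 (N t)) := by
    refine tendsto_of_tendsto_of_tendsto_of_le_of_le (g := fun t' => N t - D t' t)
      (h := fun t' => N t + D t' t) ?_ ?_ ?_ (h1 t)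
    · simpa using ENNReal.Tendsto.sub tendsto_const_nhds (hD t) (Or.inl (hN t))
    · simpa using (tendsto_const_nhds (x := N t)).add (hD t)
    · intro t'
      rw [tsub_le_iff_right, ← h2]
      exact h1 t' t
  exact (ENNReal.tendsto_toReal (hN t)).comp hc

theorem IsSmoothSolution.continuous_weightedL1 (h : IsSmoothSolution ω ζ₀ u₀ u) :
    Continuous fun t => (weightedL1 (fourierL2 (u t))).toReal :=
  continuous_toReal_of_le_add (fun t => (h.weightedL1_lt_top t).ne)
    h.tendsto_weightedL1_sub (fun t _ => weightedL1_le_add (h.aestronglyMeasurable t))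
    fun _ _ => weightedL1_sub_comm _ _

theorem IsSmoothSolution.continuous_eLpNorm (h : IsSmoothSolution ω ζ₀ u₀ u) :
    Continuous fun t => (eLpNorm (u t) 2 volume).toReal := by
  refine continuous_toReal_of_le_add (fun t => (h.memLp t).2.ne)
    h.tendsto_eLpNorm_sub (fun t t' => ?_) fun _ _ => eLpNorm_sub_comm _ _ _ _
  calc eLpNorm (u t') 2 volume = eLpNorm (u t + (u t' - u t)) 2 volume := by simp
    _ ≤ _ := eLpNorm_add_le (h.memLp t).1 ((h.memLp t').sub (h.memLp t)).1 (by norm_num)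

theorem norm_sq_le_jap (ξ : ℝ) : ENNReal.ofReal (4 * Real.pi ^ 2 * ξ ^ 2) ≤
    jap 8 (2 * Real.pi * ξ) := by
  refine le_trans (ENNReal.ofReal_le_ofReal ?_) (jap_mono (by norm_num : (2 : ℝ) ≤ 8) _)
  rw [Real.rpow_two, bracket_sq]
  nlinarith

theorem IsSmoothSolution.integrable_mul (h : IsSmoothSolution ω ζ₀ u₀ u) (t : ℝ)
    {p : ℝ → ℂ} (hp : Continuous p) (hpb : ∀ ξ, ‖p ξ‖ₑ ≤ jap 8 (2 * Real.pi * ξ)) :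
    Integrable fun ξ => p ξ * fourierL2 (u t) ξ :=
  integrable_of_weightedL1 (h.aestronglyMeasurable t) (h.weightedL1_lt_top t) hp hpb

theorem IsSmoothSolution.integrable_fourierL2 (h : IsSmoothSolution ω ζ₀ u₀ u) (t : ℝ) :
    Integrable (fourierL2 (u t)) := by
  simpa using h.integrable_mul t (p := fun _ => 1) continuous_const
    (fun ξ => by simpa using one_le_jap (by norm_num) _)

theorem enorm_laplaceSymbol (ξ : ℝ) : ‖(-(4 * Real.pi ^ 2 * ξ ^ 2) : ℂ)‖ₑ ≤
    jap 8 (2 * Real.pi * ξ) := by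
  refine le_trans (le_of_eq ?_) (norm_sq_le_jap ξ)
  rw [← ofReal_norm, norm_neg]
  congr 1
  have : ((4 * Real.pi ^ 2 * ξ ^ 2 : ℝ) : ℂ) = 4 * Real.pi ^ 2 * ξ ^ 2 := by push_cast; ring
  rw [← this, Complex.norm_real, Real.norm_eq_abs, abs_of_nonneg (by positivity)]

theorem IsSmoothSolution.integrable_laplace (h : IsSmoothSolution ω ζ₀ u₀ u) (t : ℝ) :
    Integrable fun ξ : ℝ => -(4 * Real.pi ^ 2 * ξ ^ 2) * fourierL2 (u t) ξ :=
  h.integrable_mul t (p := fun ξ : ℝ => (-(4 * Real.pi ^ 2 * ξ ^ 2) : ℂ)) (by fun_prop)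
    enorm_laplaceSymbol

/-- Both sides are continuous, so almost everywhere equality holds at every point. The sup bounds
for $u$ and $u_{xx}$ rest on this. -/
theorem IsSmoothSolution.eq_fourierInv (h : IsSmoothSolution ω ζ₀ u₀ u) (t : ℝ) :
    u t = 𝓕⁻ (fourierL2 (u t)) := by
  refine ((h.contDiff_space t).continuous.ae_eq_iff_eq volume
    (continuous_fourierInv (h.integrable_fourierL2 t))).1 ?_
  exact ae_eq_fourierInv_fourierL2 (h.memLp t) (h.integrable_fourierL2 t)

theorem IsSmoothSolution.enorm_le (h : IsSmoothSolution ω ζ₀ u₀ u) (t x : ℝ) :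
    ‖u t x‖ₑ ≤ weightedL1 (fourierL2 (u t)) := by
  rw [congrFun (h.eq_fourierInv t) x]
  exact (enorm_fourierInv_le _ _).trans (lintegral_enorm_le_weightedL1 _)

theorem fourierInv_sub {f g : ℝ → ℂ} (hf : Integrable f) (hg : Integrable g) (x : ℝ) :
    𝓕⁻ f x - 𝓕⁻ g x = 𝓕⁻ (f - g) x := by
  rw [Real.fourierInv_eq, Real.fourierInv_eq, Real.fourierInv_eq, ← integral_sub]
  · simp [smul_sub]
  · simpa using (Real.fourierIntegral_convergent_iff (-x)).2 hf
  · simpa using (Real.fourierIntegral_convergent_iff (-x)).2 hg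

theorem IsSmoothSolution.enorm_sub_le (h : IsSmoothSolution ω ζ₀ u₀ u) (t t' x : ℝ) :
    ‖u t' x - u t x‖ₑ ≤ weightedL1 (fourierL2 (u t') - fourierL2 (u t)) := by
  have e : u t' x - u t x = 𝓕⁻ (fourierL2 (u t') - fourierL2 (u t)) x := by
    rw [← fourierInv_sub (h.integrable_fourierL2 t') (h.integrable_fourierL2 t),
      ← h.eq_fourierInv, ← h.eq_fourierInv]
  rw [e]
  exact (enorm_fourierInv_le _ _).trans (lintegral_enorm_le_weightedL1 _)

theorem iteratedDeriv_two_fourierInv {G : ℝ → ℂ}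
    (hG : ∀ n : ℕ, n ≤ 2 → Integrable fun ξ : ℝ => ξ ^ n • G ξ) :
    iteratedDeriv 2 (𝓕⁻ G) = 𝓕⁻ (fun ξ : ℝ => (-(4 * Real.pi ^ 2 * ξ ^ 2) * G ξ : ℂ)) := by
  rw [Real.fourierInv_eq_fourier_comp_neg, Real.fourierInv_eq_fourier_comp_neg,
    Real.iteratedDeriv_fourier (N := 2) (n := 2) ?_ (by norm_num)]
  · congr 1; ext ξ
    simp only [smul_eq_mul, Complex.ofReal_neg]
    linear_combination (4 * Real.pi ^ 2 * ξ ^ 2 * G (-ξ)) * Complex.I_sq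
  · intro n hn
    have hn' : n ≤ 2 := by exact_mod_cast hn
    have := (hG n hn').comp_neg.const_mul ((-1 : ℂ) ^ n)
    refine this.congr (Eventually.of_forall fun x => ?_)
    simp only [Complex.real_smul, neg_pow x, ← mul_assoc]
    push_cast
    rw [← mul_assoc, ← mul_pow]
    simp

theorem IsSmoothSolution.iteratedDeriv_two (h : IsSmoothSolution ω ζ₀ u₀ u) (t : ℝ) :
    iteratedDeriv 2 (u t) =
      𝓕⁻ (fun ξ : ℝ => (-(4 * Real.pi ^ 2 * ξ ^ 2) * fourierL2 (u t) ξ : ℂ)) := by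
  rw [← iteratedDeriv_two_fourierInv, ← h.eq_fourierInv t]
  intro n hn
  have := h.integrable_mul t (p := fun ξ : ℝ => (ξ : ℂ) ^ n) (by fun_prop) fun ξ => ?_
  · refine this.congr (Eventually.of_forall fun ξ => ?_)
    simp
  · rw [← ofReal_norm, norm_pow, Complex.norm_real]
    refine ENNReal.ofReal_le_ofReal ?_
    have h1 : |ξ| ≤ bracket (2 * Real.pi * ξ) := by
      refine le_trans ?_ (abs_le_bracket _)
      rw [abs_mul, abs_of_pos (by positivity : 0 < 2 * Real.pi)]
      nlinarith [abs_nonneg ξ, Real.pi_gt_three]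
    calc |ξ| ^ n ≤ bracket (2 * Real.pi * ξ) ^ n := by gcongr
      _ = bracket (2 * Real.pi * ξ) ^ (n : ℝ) := (Real.rpow_natCast _ _).symm
      _ ≤ _ := Real.rpow_le_rpow_of_exponent_le (one_le_bracket _) (by
        have : (n : ℝ) ≤ 2 := by exact_mod_cast hn
        linarith)

theorem IsSmoothSolution.enorm_iteratedDeriv_le (h : IsSmoothSolution ω ζ₀ u₀ u) (t x : ℝ) :
    ‖iteratedDeriv 2 (u t) x‖ₑ ≤ weightedL1 (fourierL2 (u t)) := by
  rw [h.iteratedDeriv_two]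
  refine (enorm_fourierInv_le _ _).trans (lintegral_mono fun ξ => ?_)
  rw [enorm_mul]
  gcongr
  exact enorm_laplaceSymbol ξ

theorem norm_cubic (t x : ℝ) : ‖cubic u t x‖ = ‖u t x‖ ^ 3 := by
  simp [cubic]; ring

theorem IsSmoothSolution.continuous_cubic (h : IsSmoothSolution ω ζ₀ u₀ u) (t : ℝ) :
    Continuous (cubic u t) := by
  have := (h.contDiff_space t).continuous
  unfold cubic
  fun_prop

theorem IsSmoothSolution.norm_le (h : IsSmoothSolution ω ζ₀ u₀ u) (t x : ℝ) :
    ‖u t x‖ ≤ (weightedL1 (fourierL2 (u t))).toReal := by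
  rw [← toReal_enorm]
  exact ENNReal.toReal_mono (h.weightedL1_lt_top t).ne (h.enorm_le t x)

theorem IsSmoothSolution.integrable_sq (h : IsSmoothSolution ω ζ₀ u₀ u) (t : ℝ) :
    Integrable fun x => ‖u t x‖ ^ 2 :=
  (memLp_two_iff_integrable_sq_norm (h.memLp t).1).1 (h.memLp t)

theorem IsSmoothSolution.integrable_cubic (h : IsSmoothSolution ω ζ₀ u₀ u) (t : ℝ) :
    Integrable (cubic u t) := by
  refine ((h.integrable_sq t).const_mul (weightedL1 (fourierL2 (u t))).toReal).mono'
    (h.continuous_cubic t).aestronglyMeasurable (Eventually.of_forall fun x => ?_)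
  rw [norm_cubic, pow_succ, mul_comm]
  gcongr
  exact h.norm_le t x

theorem IsSmoothSolution.hasDerivAt_time (h : IsSmoothSolution ω ζ₀ u₀ u) (t x : ℝ) :
    HasDerivAt (fun t' => u t' x)
      (Complex.I * (iteratedDeriv 2 (u t) x + ζ₀ t * ω * cubic u t x)) t := by
  have h1 := (h.differentiable_time x t).hasDerivAt
  have h2 := h.equation t x
  have e : Complex.I * (iteratedDeriv 2 (u t) x + ζ₀ t * ω * cubic u t x)
      = deriv (fun t' => u t' x) t := by
    unfold cubic
    linear_combination Complex.I * h2 - deriv (fun t' => u t' x) t * Complex.I_sq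
  rw [e]
  exact h1

theorem norm_cubic_sub_le (a b : ℂ) :
    ‖(‖a‖ : ℂ) ^ 2 * a - (‖b‖ : ℂ) ^ 2 * b‖ ≤ 2 * ‖a - b‖ * (‖a‖ ^ 2 + ‖b‖ ^ 2) := by
  have e : (‖a‖ : ℂ) ^ 2 * a - (‖b‖ : ℂ) ^ 2 * b
      = (‖a‖ : ℂ) ^ 2 * (a - b) + (((‖a‖ - ‖b‖) * (‖a‖ + ‖b‖) : ℝ) : ℂ) * b := by
    push_cast; ring
  have h1 := abs_norm_sub_norm_le a b
  rw [e]
  refine (norm_add_le _ _).trans ?_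
  rw [norm_mul, norm_mul, Complex.norm_real, Real.norm_eq_abs, abs_mul,
    abs_of_nonneg (by positivity : 0 ≤ ‖a‖ + ‖b‖), norm_pow, Complex.norm_real, norm_norm]
  have h3 : |‖a‖ - ‖b‖| * (‖a‖ + ‖b‖) * ‖b‖ ≤ ‖a - b‖ * (‖a‖ + ‖b‖) * ‖b‖ := by gcongr
  nlinarith [mul_nonneg (norm_nonneg (a - b)) (sq_nonneg (‖a‖ - ‖b‖)), norm_nonneg a,
    norm_nonneg b, norm_nonneg (a - b), mul_nonneg (norm_nonneg (a - b)) (sq_nonneg (‖a‖)),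
    mul_nonneg (norm_nonneg (a - b)) (sq_nonneg (‖b‖))]

theorem IsSmoothSolution.norm_sub_le (h : IsSmoothSolution ω ζ₀ u₀ u) (t t' x : ℝ)
    (hf : weightedL1 (fourierL2 (u t') - fourierL2 (u t)) ≠ ∞) :
    ‖u t' x - u t x‖ ≤ (weightedL1 (fourierL2 (u t') - fourierL2 (u t))).toReal := by
  rw [← toReal_enorm]
  exact ENNReal.toReal_mono hf (h.enorm_sub_le t t' x)

theorem IsSmoothSolution.integral_sq (h : IsSmoothSolution ω ζ₀ u₀ u) (t : ℝ) :
    ∫ x, ‖u t x‖ ^ 2 = (eLpNorm (u t) 2 volume).toReal ^ 2 := by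
  rw [← ENNReal.toReal_pow, eLpNorm_two_sq, integral_eq_lintegral_of_nonneg_ae
    (Eventually.of_forall fun x => by positivity) (h.integrable_sq t).1]
  congr 2; ext x
  rw [ENNReal.ofReal_pow (norm_nonneg _), ofReal_norm]

/-- The cubic term is continuous in time with values in $L^1$: the difference is measured in
$L^\infty$ by `weightedL1`, the other two factors in $L^2$. Continuity at each fixed $\xi$ is what
makes the Duhamel integral differentiable there. -/
theorem IsSmoothSolution.continuous_fourier_cubic (h : IsSmoothSolution ω ζ₀ u₀ u) (ξ : ℝ) :
    Continuous fun t => 𝓕 (cubic u t) ξ := by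
  rw [continuous_iff_continuousAt]
  intro t
  rw [ContinuousAt, tendsto_iff_norm_sub_tendsto_zero]
  set D : ℝ → ℝ := fun t' => (weightedL1 (fourierL2 (u t') - fourierL2 (u t))).toReal
  set E : ℝ → ℝ := fun t => (eLpNorm (u t) 2 volume).toReal ^ 2
  have hE : Continuous E := h.continuous_eLpNorm.pow 2
  have hD : Tendsto D (𝓝 t) (𝓝 0) := by
    exact (ENNReal.tendsto_toReal ENNReal.zero_ne_top).comp (h.tendsto_weightedL1_sub t)
  have hlim : Tendsto (fun t' => 2 * D t' * (E t' + E t)) (𝓝 t) (𝓝 0) := by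
    have := (hD.const_mul 2).mul ((hE.tendsto t).add (tendsto_const_nhds (x := E t)))
    simpa using this
  have hfin : ∀ᶠ t' in 𝓝 t, weightedL1 (fourierL2 (u t') - fourierL2 (u t)) < 1 :=
    (h.tendsto_weightedL1_sub t).eventually_lt_const one_pos
  refine squeeze_zero' (Eventually.of_forall fun _ => norm_nonneg _) ?_ hlim
  filter_upwards [hfin] with t' ht'
  have hne : weightedL1 (fourierL2 (u t') - fourierL2 (u t)) ≠ ∞ := (ht'.trans (by simp)).ne
  have hI := ((h.integrable_sq t').add (h.integrable_sq t)).const_mul (2 * D t')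
  have e1 : 𝓕 (cubic u t') ξ - 𝓕 (cubic u t) ξ = 𝓕 (cubic u t' - cubic u t) ξ := by
    rw [Real.fourier_eq, Real.fourier_eq, Real.fourier_eq, ← integral_sub]
    · simp [smul_sub]
    · exact (Real.fourierIntegral_convergent_iff ξ).2 (h.integrable_cubic t')
    · exact (Real.fourierIntegral_convergent_iff ξ).2 (h.integrable_cubic t)
  calc ‖𝓕 (cubic u t') ξ - 𝓕 (cubic u t) ξ‖ ≤ ∫ x, ‖(cubic u t' - cubic u t) x‖ := by
        rw [e1]
        exact VectorFourier.norm_fourierIntegral_le_integral_norm _ _ _ _ _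
    _ ≤ ∫ x, 2 * D t' * (‖u t' x‖ ^ 2 + ‖u t x‖ ^ 2) := by
        refine integral_mono ((h.integrable_cubic t').sub (h.integrable_cubic t)).norm hI ?_
        intro x
        refine (norm_cubic_sub_le _ _).trans (mul_le_mul_of_nonneg_right
          (mul_le_mul_of_nonneg_left (h.norm_sub_le t t' x hne) (by norm_num)) (by positivity))
    _ = _ := by
        rw [integral_const_mul, integral_add (h.integrable_sq t') (h.integrable_sq t),
          h.integral_sq, h.integral_sq]

end SmoothSolution

/-! ### The interaction representation and the Duhamel formula. -/

theorem stronglyMeasurable_fourierL2 (f : ℝ → ℂ) : StronglyMeasurable (fourierL2 f) := by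
  unfold fourierL2
  split_ifs with h
  · exact Lp.stronglyMeasurable _
  · exact stronglyMeasurable_zero

/-- The phase `4π²ξ²` of the Schrödinger evolution. -/
noncomputable def phase (ξ : ℝ) : ℝ := 4 * Real.pi ^ 2 * ξ ^ 2

theorem continuous_phase : Continuous phase := by unfold phase; fun_prop

/-- The modulation factor `e^{iθt}` with `θ = 4π²ξ²`. -/
noncomputable def modulation (t ξ : ℝ) : ℂ := Complex.exp (Complex.I * (phase ξ * t : ℝ))

theorem norm_modulation (t ξ : ℝ) : ‖modulation t ξ‖ = 1 := by
  rw [modulation, mul_comm, Complex.norm_exp_ofReal_mul_I]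

theorem continuous_modulation : Continuous (Function.uncurry modulation) := by
  have := continuous_phase
  unfold modulation Function.uncurry
  fun_prop

theorem continuous_modulation_left (ξ : ℝ) : Continuous fun t => modulation t ξ := by
  unfold modulation
  fun_prop

theorem continuous_modulation_right (t : ℝ) : Continuous (modulation t) := by
  have := continuous_phase
  unfold modulation
  fun_prop

theorem hasDerivAt_modulation (t ξ : ℝ) :
    HasDerivAt (fun t => modulation t ξ) (Complex.I * phase ξ * modulation t ξ) t := by
  have h1 : HasDerivAt (fun t : ℝ => Complex.I * ((phase ξ * t : ℝ) : ℂ))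
      (Complex.I * phase ξ) t := by
    have := ((hasDerivAt_id t).const_mul (phase ξ)).ofReal_comp.const_mul Complex.I
    simpa using this
  have := h1.cexp
  rw [mul_comm] at this
  exact this

theorem norm_modulation_sub_le (t t' ξ : ℝ) :
    ‖modulation t' ξ - modulation t ξ‖ ≤ phase ξ * |t' - t| := by
  have e : modulation t' ξ - modulation t ξ = modulation t ξ *
      (Complex.exp (Complex.I * (phase ξ * (t' - t) : ℝ)) - 1) := by
    simp only [modulation]
    rw [mul_sub, mul_one, ← Complex.exp_add]
    congr 2
    push_cast
    ring
  rw [e, norm_mul, norm_modulation, one_mul]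
  refine Real.norm_exp_I_mul_ofReal_sub_one_le.trans (le_of_eq ?_)
  rw [Real.norm_eq_abs, abs_mul, abs_of_nonneg (by unfold phase; positivity)]

section SmoothSolution

variable {ω : ℝ} {ζ₀ : ℝ → ℝ} {u₀ : ℝ → ℂ} {u : ℝ → ℝ → ℂ}

theorem eventually_le_of_continuous {m : ℝ → ℝ} (hm : Continuous m) (t : ℝ) :
    {t' | m t' ≤ m t + 1} ∈ 𝓝 t :=
  (hm.tendsto t).eventually_le_const (by linarith)

/-- The equation holds pointwise in $x$, so the transform is moved onto $\varphi$, the integral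
differentiated, and the transform moved back. Only this weak form is available directly, because the
representatives `fourierL2 (u t)` at different times are unrelated at a given $\xi$. -/
theorem IsSmoothSolution.hasDerivAt_pairing (h : IsSmoothSolution ω ζ₀ u₀ u) (hζ : Continuous ζ₀)
    (φ : 𝓢(ℝ, ℂ)) (t : ℝ) :
    HasDerivAt (fun t' => ∫ ξ, fourierL2 (u t') ξ * φ ξ)
      (Complex.I * ∫ ξ, (-phase ξ * fourierL2 (u t) ξ
        + ζ₀ t * ω * 𝓕 (cubic u t) ξ) * φ ξ) t := by
  have e1 : ∀ t', ∫ ξ, fourierL2 (u t') ξ * φ ξ = ∫ x, u t' x * 𝓕 (φ : ℝ → ℂ) x := fun t' => by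
    simp_rw [mul_comm _ (φ _), mul_comm _ (𝓕 (φ : ℝ → ℂ) _)]
    exact integral_fourierL2_mul_schwartz (h.memLp t') φ
  simp_rw [e1]
  have hφ : Integrable (𝓕 (φ : ℝ → ℂ)) := (𝓕 φ).integrable
  set A : ℝ → ℝ := fun t => (weightedL1 (fourierL2 (u t))).toReal with hA
  set m : ℝ → ℝ := fun t => A t + |ζ₀ t| * |ω| * A t ^ 3 with hm
  have hmc : Continuous m := by
    have := h.continuous_weightedL1
    fun_prop
  set D : ℝ → ℝ → ℂ := fun t x =>
    Complex.I * (iteratedDeriv 2 (u t) x + ζ₀ t * ω * cubic u t x) with hD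
  have hDb : ∀ t x, ‖D t x‖ ≤ m t := fun t x => by
    simp only [hD, hm, norm_mul, Complex.norm_I, one_mul]
    refine (norm_add_le _ _).trans ?_
    rw [norm_mul, norm_mul, norm_cubic, Complex.norm_real, Complex.norm_real, Real.norm_eq_abs,
      Real.norm_eq_abs]
    gcongr
    · rw [← toReal_enorm]
      exact ENNReal.toReal_mono (h.weightedL1_lt_top t).ne (h.enorm_iteratedDeriv_le t x)
    · exact h.norm_le t x
  have hd2 : Continuous (iteratedDeriv 2 (u t)) :=
    (h.contDiff_space t).continuous_iteratedDeriv 2 (by norm_num)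
  have hcc := h.continuous_cubic t
  have hFc : ∀ t, AEStronglyMeasurable fun x => u t x * 𝓕 (φ : ℝ → ℂ) x := fun t =>
    ((h.contDiff_space t).continuous.mul (continuous_fourier φ.integrable)).aestronglyMeasurable
  -- The continuous majorant `m` stays below `m t + 1` on a neighbourhood of `t`, which gives a
  -- bound for the time derivative uniform in that neighbourhood.
  have key := hasDerivAt_integral_of_dominated_loc_of_deriv_le (μ := volume)
    (F := fun t' x => u t' x * 𝓕 (φ : ℝ → ℂ) x) (x₀ := t)
    (F' := fun t' x => D t' x * 𝓕 (φ : ℝ → ℂ) x)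
    (bound := fun x => (m t + 1) * ‖𝓕 (φ : ℝ → ℂ) x‖)
    (eventually_le_of_continuous hmc t) (Eventually.of_forall hFc)
    (hφ.bdd_mul (h.contDiff_space t).continuous.aestronglyMeasurable
      (Eventually.of_forall (h.norm_le t)))
    (Continuous.aestronglyMeasurable (by
      have := continuous_fourier (f := (φ : ℝ → ℂ)) φ.integrable
      fun_prop))
    (Eventually.of_forall fun x t' ht' => by
      rw [norm_mul]
      gcongr
      exact (hDb t' x).trans ht')
    (hφ.norm.const_mul _)
    (Eventually.of_forall fun x t' _ => (h.hasDerivAt_time t' x).mul_const _)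
  refine key.2.congr_deriv ?_
  symm
  have i1 : Integrable fun x => 𝓕 (φ : ℝ → ℂ) x * iteratedDeriv 2 (u t) x :=
    hφ.mul_bdd hd2.aestronglyMeasurable (c := A t)
      (Eventually.of_forall fun x => by
        rw [← toReal_enorm]
        exact ENNReal.toReal_mono (h.weightedL1_lt_top t).ne (h.enorm_iteratedDeriv_le t x))
  have i2 : Integrable fun x => 𝓕 (φ : ℝ → ℂ) x * cubic u t x :=
    hφ.mul_bdd hcc.aestronglyMeasurable (c := A t ^ 3)
      (Eventually.of_forall fun x => by
        rw [norm_cubic]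
        gcongr
        exact h.norm_le t x)
  have hφb : ∀ ξ, ‖φ ξ‖ ≤ SchwartzMap.seminorm ℝ 0 0 φ := φ.norm_le_seminorm ℝ
  have j1 : Integrable fun ξ : ℝ => φ ξ * (-(4 * Real.pi ^ 2 * ξ ^ 2) * fourierL2 (u t) ξ) :=
    (h.integrable_laplace t).bdd_mul φ.continuous.aestronglyMeasurable
      (Eventually.of_forall hφb)
  have j2 : Integrable fun ξ => φ ξ * 𝓕 (cubic u t) ξ :=
    φ.integrable.mul_bdd (continuous_fourier (h.integrable_cubic t)).aestronglyMeasurable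
      (c := ∫ x, ‖cubic u t x‖)
      (Eventually.of_forall fun x =>
        VectorFourier.norm_fourierIntegral_le_integral_norm _ _ _ _ _)
  have k1 : ∫ x, 𝓕 (φ : ℝ → ℂ) x * iteratedDeriv 2 (u t) x
      = ∫ ξ : ℝ, φ ξ * (-(4 * Real.pi ^ 2 * ξ ^ 2) * fourierL2 (u t) ξ) := by
    rw [h.iteratedDeriv_two t]
    exact integral_fourier_schwartz_mul_fourierInv φ (h.integrable_laplace t)
  have k2 : ∫ x, 𝓕 (φ : ℝ → ℂ) x * cubic u t x = ∫ ξ, φ ξ * 𝓕 (cubic u t) ξ :=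
    integral_fourier_mul_eq_flip φ.integrable (h.integrable_cubic t)
  calc _ = Complex.I * ((∫ ξ : ℝ, φ ξ * (-(4 * Real.pi ^ 2 * ξ ^ 2) * fourierL2 (u t) ξ))
        + ζ₀ t * ω * ∫ ξ, φ ξ * 𝓕 (cubic u t) ξ) := by
        rw [← integral_const_mul ((ζ₀ t : ℂ) * ω), ← integral_add j1 (j2.const_mul _)]
        congr 2; ext ξ
        simp only [phase]
        push_cast
        ring
    _ = Complex.I * ((∫ x, 𝓕 (φ : ℝ → ℂ) x * iteratedDeriv 2 (u t) x)
        + ζ₀ t * ω * ∫ x, 𝓕 (φ : ℝ → ℂ) x * cubic u t x) := by rw [k1, k2]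
    _ = _ := by
        rw [← integral_const_mul ((ζ₀ t : ℂ) * ω), ← integral_add i1 (i2.const_mul _),
          ← integral_const_mul]
        congr 1; ext x
        simp only [hD]
        ring

/-- The interaction representation of the nonlinearity. -/
noncomputable def forcing (ω : ℝ) (ζ₀ : ℝ → ℝ) (u : ℝ → ℝ → ℂ) (t ξ : ℝ) : ℂ :=
  Complex.I * (ζ₀ t * ω * 𝓕 (cubic u t) ξ)

/-- The spatial Fourier transform of the solution, given by the Duhamel formula. -/
noncomputable def duhamel (ω : ℝ) (ζ₀ : ℝ → ℝ) (u₀ : ℝ → ℂ) (u : ℝ → ℝ → ℂ) (t ξ : ℝ) : ℂ :=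
  modulation (-t) ξ *
    (fourierL2 u₀ ξ + ∫ s in (0 : ℝ)..t, modulation s ξ * forcing ω ζ₀ u s ξ)

theorem IsSmoothSolution.continuous_forcing (h : IsSmoothSolution ω ζ₀ u₀ u)
    (hζ : Continuous ζ₀) (ξ : ℝ) : Continuous fun t => forcing ω ζ₀ u t ξ := by
  have h1 := h.continuous_fourier_cubic ξ
  have h2 : Continuous fun t => (ζ₀ t : ℂ) := Complex.continuous_ofReal.comp hζ
  exact continuous_const.mul ((h2.mul continuous_const).mul h1)

theorem IsSmoothSolution.continuous_integrand (h : IsSmoothSolution ω ζ₀ u₀ u)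
    (hζ : Continuous ζ₀) (ξ : ℝ) : Continuous fun t => modulation t ξ * forcing ω ζ₀ u t ξ :=
  (continuous_modulation_left ξ).mul (h.continuous_forcing hζ ξ)

theorem modulation_neg_mul (t ξ : ℝ) : modulation (-t) ξ * modulation t ξ = 1 := by
  rw [modulation, modulation, ← Complex.exp_add, ← Complex.exp_zero]
  congr 1
  push_cast
  ring

theorem IsSmoothSolution.hasDerivAt_integral (h : IsSmoothSolution ω ζ₀ u₀ u)
    (hζ : Continuous ζ₀) (t ξ : ℝ) :
    HasDerivAt (fun t => ∫ s in (0 : ℝ)..t, modulation s ξ * forcing ω ζ₀ u s ξ)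
      (modulation t ξ * forcing ω ζ₀ u t ξ) t :=
  intervalIntegral.integral_hasDerivAt_right
    ((h.continuous_integrand hζ ξ).intervalIntegrable _ _)
    ((h.continuous_integrand hζ ξ).stronglyMeasurableAtFilter _ _)
    (h.continuous_integrand hζ ξ).continuousAt

/-- This holds at every $\xi$, not just almost every one, so it can be used pointwise under
frequency integrals. -/
theorem IsSmoothSolution.hasDerivAt_duhamel (h : IsSmoothSolution ω ζ₀ u₀ u)
    (hζ : Continuous ζ₀) (t ξ : ℝ) :
    HasDerivAt (fun t => duhamel ω ζ₀ u₀ u t ξ)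
      (-Complex.I * phase ξ * duhamel ω ζ₀ u₀ u t ξ + forcing ω ζ₀ u t ξ) t := by
  have h1 := (hasDerivAt_modulation (-t) ξ).scomp t (hasDerivAt_neg t)
  have h2 := (h.hasDerivAt_integral hζ t ξ).const_add (fourierL2 u₀ ξ)
  have h3 := h1.mul h2
  refine h3.congr_deriv ?_
  unfold duhamel
  simp only [Function.comp, Complex.real_smul]
  push_cast
  linear_combination forcing ω ζ₀ u t ξ * modulation_neg_mul t ξ

theorem IsSmoothSolution.norm_forcing_le (h : IsSmoothSolution ω ζ₀ u₀ u) (t ξ : ℝ) :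
    ‖forcing ω ζ₀ u t ξ‖ ≤ |ζ₀ t| * |ω| * ((weightedL1 (fourierL2 (u t))).toReal *
      (eLpNorm (u t) 2 volume).toReal ^ 2) := by
  rw [forcing, norm_mul, Complex.norm_I, one_mul, norm_mul, norm_mul, Complex.norm_real,
    Complex.norm_real, Real.norm_eq_abs, Real.norm_eq_abs]
  gcongr
  refine (VectorFourier.norm_fourierIntegral_le_integral_norm _ _ _ _ _).trans ?_
  rw [← h.integral_sq, ← integral_const_mul]
  refine integral_mono (h.integrable_cubic t).norm ((h.integrable_sq t).const_mul _) fun x => ?_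
  simp only [norm_cubic]
  rw [pow_succ, mul_comm]
  gcongr
  exact h.norm_le t x

/-- A Carathéodory argument: continuity in $t$ at fixed $\xi$ and measurability in $\xi$ at fixed
$t$. -/
theorem IsSmoothSolution.measurable_forcing (h : IsSmoothSolution ω ζ₀ u₀ u)
    (hζ : Continuous ζ₀) : Measurable (Function.uncurry (forcing ω ζ₀ u)) := by
  refine measurable_uncurry_of_continuous_of_measurable (h.continuous_forcing hζ) fun t => ?_
  have := (continuous_fourier (h.integrable_cubic t)).measurable
  unfold forcing
  fun_prop

theorem IsSmoothSolution.measurable_integral (h : IsSmoothSolution ω ζ₀ u₀ u)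
    (hζ : Continuous ζ₀) (t : ℝ) :
    Measurable fun ξ => ∫ s in (0 : ℝ)..t, modulation s ξ * forcing ω ζ₀ u s ξ := by
  have hm : StronglyMeasurable (fun p : ℝ × ℝ => modulation p.2 p.1 * forcing ω ζ₀ u p.2 p.1) :=
    ((continuous_modulation.measurable.comp measurable_swap).mul
      ((h.measurable_forcing hζ).comp measurable_swap)).stronglyMeasurable
  simp only [intervalIntegral]
  exact (hm.integral_prod_right'.measurable).sub (hm.integral_prod_right'.measurable)

theorem IsSmoothSolution.measurable_duhamel (h : IsSmoothSolution ω ζ₀ u₀ u)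
    (hζ : Continuous ζ₀) : Measurable (Function.uncurry (duhamel ω ζ₀ u₀ u)) := by
  refine measurable_uncurry_of_continuous_of_measurable (fun ξ =>
    continuous_iff_continuousAt.2 fun t => (h.hasDerivAt_duhamel hζ t ξ).continuousAt) fun t => ?_
  have h1 := (stronglyMeasurable_fourierL2 u₀).measurable
  have h2 := h.measurable_integral hζ t
  have h3 : Measurable (modulation (-t)) := (continuous_modulation_right _).measurable
  unfold duhamel
  fun_prop

end SmoothSolution

section SmoothSolution

variable {ω : ℝ} {ζ₀ : ℝ → ℝ} {u₀ : ℝ → ℂ} {u : ℝ → ℝ → ℂ}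

theorem contDiff_modulation (t : ℝ) : ContDiff ℝ (⊤ : ℕ∞) (modulation t) := by
  have h0 : ContDiff ℝ (⊤ : ℕ∞) phase := by unfold phase; fun_prop
  have h1 : ContDiff ℝ (⊤ : ℕ∞) fun ξ => ((phase ξ * t : ℝ) : ℂ) :=
    Complex.ofRealCLM.contDiff.comp (h0.mul contDiff_const)
  unfold modulation
  fun_prop

theorem IsSmoothSolution.integrable_phase_mul (h : IsSmoothSolution ω ζ₀ u₀ u) (t : ℝ) :
    Integrable fun ξ => (phase ξ : ℂ) * fourierL2 (u t) ξ := by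
  refine (h.integrable_laplace t).neg.congr (Eventually.of_forall fun ξ => ?_)
  simp [phase]

/-- The error term in the product rule for a time dependent test function. -/
theorem IsSmoothSolution.hasDerivAt_remainder (h : IsSmoothSolution ω ζ₀ u₀ u) {g : ℝ → ℂ}
    {M : ℝ} (hM : ∀ ξ, ‖g ξ‖ ≤ M) (t : ℝ) :
    HasDerivAt (fun t' => ∫ ξ, (fourierL2 (u t') ξ - fourierL2 (u t) ξ) *
      (g ξ * (modulation t' ξ - modulation t ξ))) 0 t := by
  have hM0 : 0 ≤ M := (norm_nonneg _).trans (hM 0)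
  set W : ℝ → ℝ≥0∞ := fun t' => weightedL1 (fourierL2 (u t') - fourierL2 (u t)) with hW
  have hWt : Tendsto (fun t' => (W t').toReal) (𝓝 t) (𝓝 0) :=
    (ENNReal.tendsto_toReal ENNReal.zero_ne_top).comp (h.tendsto_weightedL1_sub t)
  rw [hasDerivAt_iff_isLittleO]
  simp only [sub_self, mul_zero, integral_zero, sub_zero, smul_zero]
  rw [Asymptotics.isLittleO_iff]
  intro c hc
  have h1 : ∀ᶠ t' in 𝓝 t, W t' < 1 := (h.tendsto_weightedL1_sub t).eventually_lt_const one_pos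
  -- The difference of transforms is $o(1)$ in the weighted $L^1$ norm and the difference of
  -- modulations is at most `phase ξ * |t' - t|`. The weight absorbs the phase, so the product is
  -- $o(|t'-t|)$.
  have h2 : ∀ᶠ t' in 𝓝 t, M * (W t').toReal < c := by
    have := hWt.const_mul M
    rw [mul_zero] at this
    exact this.eventually_lt_const hc
  filter_upwards [h1, h2] with t' ht1 ht2
  have hfin : W t' ≠ ∞ := (ht1.trans (by simp)).ne
  rw [Real.norm_eq_abs]
  refine le_trans ?_ (mul_le_mul_of_nonneg_right ht2.le (abs_nonneg _))
  rw [← toReal_enorm]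
  refine ENNReal.toReal_le_of_le_ofReal (by positivity) ?_
  refine (enorm_integral_le_lintegral_enorm _).trans ?_
  calc ∫⁻ ξ, ‖(fourierL2 (u t') ξ - fourierL2 (u t) ξ) *
        (g ξ * (modulation t' ξ - modulation t ξ))‖ₑ
      ≤ ∫⁻ ξ, ENNReal.ofReal (M * |t' - t|) *
          (jap 8 (2 * Real.pi * ξ) * ‖(fourierL2 (u t') - fourierL2 (u t)) ξ‖ₑ) := by
        refine lintegral_mono fun ξ => ?_
        rw [enorm_mul, mul_comm, ← mul_assoc, Pi.sub_apply]
        gcongr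
        calc ‖g ξ * (modulation t' ξ - modulation t ξ)‖ₑ
            ≤ ENNReal.ofReal (M * |t' - t| * phase ξ) := by
              rw [← ofReal_norm, norm_mul]
              refine ENNReal.ofReal_le_ofReal ?_
              calc _ ≤ M * (phase ξ * |t' - t|) := by
                    gcongr
                    · exact hM ξ
                    · exact norm_modulation_sub_le t t' ξ
                _ = _ := by ring
          _ ≤ _ := by
              rw [ENNReal.ofReal_mul (by positivity)]
              gcongr
              exact norm_sq_le_jap ξ
    _ = ENNReal.ofReal (M * |t' - t|) * W t' := by
        rw [lintegral_const_mul' _ _ ENNReal.ofReal_ne_top]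
        rfl
    _ = _ := by
        rw [mul_right_comm, ENNReal.ofReal_mul (by positivity : 0 ≤ M * |t' - t|),
          ENNReal.ofReal_toReal hfin]

/-- The phase term of the equation cancels the derivative of the modulation, so only the
nonlinearity survives. -/
theorem IsSmoothSolution.hasDerivAt_modulated_pairing (h : IsSmoothSolution ω ζ₀ u₀ u)
    (hζ : Continuous ζ₀) {g : ℝ → ℝ} (hg : ContDiff ℝ (⊤ : ℕ∞) g) (hgc : HasCompactSupport g)
    (t : ℝ) :
    HasDerivAt (fun t' => ∫ ξ, fourierL2 (u t') ξ * (g ξ * modulation t' ξ))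
      (∫ ξ, forcing ω ζ₀ u t ξ * (g ξ * modulation t ξ)) t := by
  obtain ⟨M, hM⟩ : ∃ M, ∀ ξ, ‖(g ξ : ℂ)‖ ≤ M := by
    obtain ⟨M, hM⟩ := hg.continuous.bounded_above_of_compact_support hgc
    exact ⟨M, fun ξ => by simpa using hM ξ⟩
  have hgC : Continuous fun ξ => (g ξ : ℂ) := Complex.continuous_ofReal.comp hg.continuous
  have hsup : HasCompactSupport fun ξ => (g ξ : ℂ) * modulation t ξ :=
    (hgc.comp_left (g := fun x : ℝ => (x : ℂ)) (by simp)).mul_right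
  have hsm : ContDiff ℝ (⊤ : ℕ∞) fun ξ => (g ξ : ℂ) * modulation t ξ :=
    (Complex.ofRealCLM.contDiff.comp hg).mul (contDiff_modulation t)
  have hmul : ∀ t t', Integrable fun ξ => fourierL2 (u t) ξ * (g ξ * modulation t' ξ) :=
    fun t t' => (h.integrable_fourierL2 t).mul_bdd
      (hgC.mul (continuous_modulation_right t')).aestronglyMeasurable (c := M)
      (Eventually.of_forall fun ξ => by rw [norm_mul, norm_modulation, mul_one]; exact hM ξ)
  have d1 := h.hasDerivAt_pairing hζ (hsup.toSchwartzMap hsm) t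
  simp only [HasCompactSupport.toSchwartzMap_toFun] at d1
  have d3 := h.hasDerivAt_remainder hM t
  have d2 : HasDerivAt (fun t' => ∫ ξ, fourierL2 (u t) ξ * (g ξ * modulation t' ξ))
      (∫ ξ, fourierL2 (u t) ξ * (g ξ * (Complex.I * phase ξ * modulation t ξ))) t := by
    refine (hasDerivAt_integral_of_dominated_loc_of_deriv_le (μ := volume) (s := univ)
      (F' := fun t' ξ => fourierL2 (u t) ξ * (g ξ * (Complex.I * phase ξ * modulation t' ξ)))
      (bound := fun ξ => M * ‖(phase ξ : ℂ) * fourierL2 (u t) ξ‖) univ_mem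
      (Eventually.of_forall fun t' => (hmul t t').1) (hmul t t) ?_ ?_
      ((h.integrable_phase_mul t).norm.const_mul M) ?_).2
    · refine (h.aestronglyMeasurable t).mul (Continuous.aestronglyMeasurable ?_)
      have := continuous_modulation_right t
      have := continuous_phase
      fun_prop
    · refine Eventually.of_forall fun ξ t' _ => ?_
      rw [norm_mul, norm_mul, norm_mul, norm_modulation, norm_mul, norm_mul, Complex.norm_I]
      calc _ = ‖(g ξ : ℂ)‖ * (‖(phase ξ : ℂ)‖ * ‖fourierL2 (u t) ξ‖) := by ring
        _ ≤ _ := by gcongr; exact hM ξ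
    · exact Eventually.of_forall fun ξ t' _ =>
        ((hasDerivAt_modulation t' ξ).const_mul _).const_mul _
  -- Bilinear expansion around `t`: modulation frozen, transform frozen, product of the two
  -- increments, and a constant.
  have e : (fun t' => ∫ ξ, fourierL2 (u t') ξ * (g ξ * modulation t' ξ)) = fun t' =>
      ((∫ ξ, fourierL2 (u t') ξ * (g ξ * modulation t ξ))
        + ∫ ξ, fourierL2 (u t) ξ * (g ξ * modulation t' ξ))
        + (∫ ξ, (fourierL2 (u t') ξ - fourierL2 (u t) ξ) *
            (g ξ * (modulation t' ξ - modulation t ξ)))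
        - ∫ ξ, fourierL2 (u t) ξ * (g ξ * modulation t ξ) := by
    ext t'
    have e3 : ∀ ξ, (fourierL2 (u t') ξ - fourierL2 (u t) ξ) *
        (g ξ * (modulation t' ξ - modulation t ξ))
        = (fourierL2 (u t') ξ * (g ξ * modulation t' ξ)
          - fourierL2 (u t') ξ * (g ξ * modulation t ξ))
          - (fourierL2 (u t) ξ * (g ξ * modulation t' ξ)
          - fourierL2 (u t) ξ * (g ξ * modulation t ξ)) := fun ξ => by ring
    simp_rw [e3]
    have e4 := integral_sub ((hmul t' t').sub (hmul t' t)) ((hmul t t').sub (hmul t t))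
    simp only [Pi.sub_apply] at e4
    rw [e4, integral_sub (hmul t' t') (hmul t' t), integral_sub (hmul t t') (hmul t t)]
    ring
  rw [e]
  refine (((d1.add d2).add d3).sub_const _).congr_deriv ?_
  have i1 : Integrable fun ξ => fourierL2 (u t) ξ *
      (g ξ * (Complex.I * phase ξ * modulation t ξ)) := by
    refine ((h.integrable_phase_mul t).mul_bdd (g := fun ξ => g ξ * (Complex.I * modulation t ξ))
      (Continuous.aestronglyMeasurable ?_) (c := M) (Eventually.of_forall fun ξ => ?_)).congr
      (Eventually.of_forall fun ξ => ?_)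
    · have := continuous_modulation_right t
      fun_prop
    · rw [norm_mul, norm_mul, norm_modulation, Complex.norm_I, mul_one, mul_one]; exact hM ξ
    · simp only; ring
  have hF : Continuous fun ξ => 𝓕 (cubic u t) ξ := continuous_fourier (h.integrable_cubic t)
  have hfor : Continuous (forcing ω ζ₀ u t) := by
    unfold forcing
    exact continuous_const.mul (continuous_const.mul hF)
  have i2 : Integrable fun ξ => forcing ω ζ₀ u t ξ * (g ξ * modulation t ξ) :=
    (hfor.mul hsm.continuous).integrable_of_hasCompactSupport hsup.mul_left
  have e4 : ∀ ξ, Complex.I * ((-phase ξ * fourierL2 (u t) ξ + ζ₀ t * ω * 𝓕 (cubic u t) ξ) *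
      (g ξ * modulation t ξ)) = forcing ω ζ₀ u t ξ * (g ξ * modulation t ξ)
        - fourierL2 (u t) ξ * (g ξ * (Complex.I * phase ξ * modulation t ξ)) := fun ξ => by
    unfold forcing; ring
  rw [← integral_const_mul]
  simp_rw [e4]
  rw [integral_sub i2 i1]
  ring

theorem IsSmoothSolution.hasDerivAt_duhamel_pairing (h : IsSmoothSolution ω ζ₀ u₀ u)
    (hζ : Continuous ζ₀) {g : ℝ → ℝ} (hg : Continuous g) (hgc : HasCompactSupport g)
    (t : ℝ) :
    HasDerivAt (fun t' => ∫ ξ, g ξ * (fourierL2 u₀ ξ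
        + ∫ s in (0 : ℝ)..t', modulation s ξ * forcing ω ζ₀ u s ξ))
      (∫ ξ, g ξ * (modulation t ξ * forcing ω ζ₀ u t ξ)) t := by
  have hgC : Continuous fun ξ => (g ξ : ℂ) := Complex.continuous_ofReal.comp hg
  have hgI : Integrable fun ξ => (g ξ : ℂ) := hgC.integrable_of_hasCompactSupport
    (hgc.comp_left (g := fun x : ℝ => (x : ℂ)) (by simp))
  obtain ⟨M, hM⟩ : ∃ M, ∀ ξ, ‖(g ξ : ℂ)‖ ≤ M := by
    obtain ⟨M, hM⟩ := hg.bounded_above_of_compact_support hgc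
    exact ⟨M, fun ξ => by simpa using hM ξ⟩
  set m : ℝ → ℝ := fun t => |ζ₀ t| * |ω| * ((weightedL1 (fourierL2 (u t))).toReal *
      (eLpNorm (u t) 2 volume).toReal ^ 2) with hm
  have hmc : Continuous m := by
    have h1 := h.continuous_weightedL1
    have h2 := h.continuous_eLpNorm
    fun_prop
  have hmeas : ∀ t, Measurable fun ξ => fourierL2 u₀ ξ
      + ∫ s in (0 : ℝ)..t, modulation s ξ * forcing ω ζ₀ u s ξ := fun t =>
    (stronglyMeasurable_fourierL2 u₀).measurable.add (h.measurable_integral hζ t)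
  have hmeas' : Measurable fun ξ => modulation t ξ * forcing ω ζ₀ u t ξ := by
    have h1 : Measurable (forcing ω ζ₀ u t) := (h.measurable_forcing hζ).of_uncurry_left
    exact (continuous_modulation_right t).measurable.mul h1
  refine (hasDerivAt_integral_of_dominated_loc_of_deriv_le (μ := volume)
      (F := fun t' ξ => (g ξ : ℂ) * (fourierL2 u₀ ξ
        + ∫ s in (0 : ℝ)..t', modulation s ξ * forcing ω ζ₀ u s ξ))
      (F' := fun t' ξ => g ξ * (modulation t' ξ * forcing ω ζ₀ u t' ξ))
      (bound := fun ξ => ‖(g ξ : ℂ)‖ * (m t + 1))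
      (eventually_le_of_continuous hmc t)
      (Eventually.of_forall fun t' =>
        (hgC.measurable.mul (hmeas t')).aestronglyMeasurable) ?_ ?_ ?_
      (hgI.norm.mul_const _) ?_).2
  · have i1 : Integrable fun ξ => g ξ * fourierL2 u₀ ξ := by
      have := h.integrable_fourierL2 0
      rw [h.initial] at this
      exact this.bdd_mul hgC.aestronglyMeasurable (Eventually.of_forall hM)
    have i2 : Integrable fun ξ => g ξ *
        ∫ s in (0 : ℝ)..t, modulation s ξ * forcing ω ζ₀ u s ξ := by
      refine hgI.mul_bdd (c := |∫ s in (0 : ℝ)..t, m s|)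
        (h.measurable_integral hζ t).aestronglyMeasurable (Eventually.of_forall fun ξ => ?_)
      refine intervalIntegral.norm_integral_le_abs_of_norm_le (Eventually.of_forall fun s => ?_)
        (hmc.intervalIntegrable _ _)
      rw [norm_mul, norm_modulation, one_mul]
      exact h.norm_forcing_le s ξ
    refine (i1.add i2).congr (Eventually.of_forall fun ξ => ?_)
    simp only [Pi.add_apply]
    ring
  · exact (hgC.measurable.mul hmeas').aestronglyMeasurable
  · refine Eventually.of_forall fun ξ t' ht' => ?_
    rw [norm_mul, norm_mul, norm_modulation, one_mul]
    gcongr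
    exact (h.norm_forcing_le t' ξ).trans ht'
  · exact Eventually.of_forall fun ξ t' _ =>
      ((h.hasDerivAt_integral hζ t' ξ).const_add _).const_mul _

/-- Tested against a smooth compactly supported function of $\xi$, the modulated transform of $u$
and the Duhamel integral have the same time derivative and agree at $t=0$. Everything after this
works with `duhamel` in place of `fourierL2 (u t)`. -/
theorem IsSmoothSolution.duhamel_ae_eq (h : IsSmoothSolution ω ζ₀ u₀ u) (hζ : Continuous ζ₀)
    (t : ℝ) : duhamel ω ζ₀ u₀ u t =ᵐ[volume] fourierL2 (u t) := by
  have hmod : Continuous (modulation t) := continuous_modulation_right t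
  have key : (fun ξ => modulation t ξ * fourierL2 (u t) ξ) =ᵐ[volume] fun ξ => fourierL2 u₀ ξ
      + ∫ s in (0 : ℝ)..t, modulation s ξ * forcing ω ζ₀ u s ξ := by
    refine ae_eq_of_integral_contDiff_smul_eq ?_ ?_ fun g hg hgc => ?_
    · exact ((h.integrable_fourierL2 t).bdd_mul hmod.aestronglyMeasurable (c := 1)
        (Eventually.of_forall fun ξ => (norm_modulation t ξ).le)).locallyIntegrable
    · refine LocallyIntegrable.add ?_ ?_
      · have := h.integrable_fourierL2 0
        rw [h.initial] at this
        exact this.locallyIntegrable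
      · set m : ℝ → ℝ := fun t => |ζ₀ t| * |ω| * ((weightedL1 (fourierL2 (u t))).toReal *
          (eLpNorm (u t) 2 volume).toReal ^ 2) with hm
        have hmc : Continuous m := by
          have h1 := h.continuous_weightedL1
          have h2 := h.continuous_eLpNorm
          fun_prop
        refine (locallyIntegrable_const (|∫ s in (0 : ℝ)..t, m s|)).mono
          (h.measurable_integral hζ t).aestronglyMeasurable (Eventually.of_forall fun ξ => ?_)
        rw [Real.norm_eq_abs, abs_abs]
        refine intervalIntegral.norm_integral_le_abs_of_norm_le (Eventually.of_forall fun s => ?_)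
          (hmc.intervalIntegrable _ _)
        rw [norm_mul, norm_modulation, one_mul]
        exact h.norm_forcing_le s ξ
    · have hd : ∀ t, HasDerivAt (fun t' => (∫ ξ, fourierL2 (u t') ξ * (g ξ * modulation t' ξ))
          - ∫ ξ, g ξ * (fourierL2 u₀ ξ
            + ∫ s in (0 : ℝ)..t', modulation s ξ * forcing ω ζ₀ u s ξ)) 0 t := fun t => by
        refine ((h.hasDerivAt_modulated_pairing hζ hg hgc t).sub
          (h.hasDerivAt_duhamel_pairing hζ hg.continuous hgc t)).congr_deriv ?_
        rw [sub_eq_zero]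
        congr 1; ext ξ
        ring
      have := is_const_of_deriv_eq_zero (fun t => (hd t).differentiableAt)
        (fun t => (hd t).deriv) t 0
      simp only [intervalIntegral.integral_same, add_zero, h.initial] at this
      have e0 : ∀ ξ, modulation 0 ξ = 1 := fun ξ => by simp [modulation]
      simp only [e0, mul_one, mul_comm (fourierL2 u₀ _), sub_self] at this
      simp only [Complex.real_smul]
      rw [sub_eq_zero] at this
      rw [← this]
      congr 1; ext ξ
      ring
  filter_upwards [key] with ξ hξ
  rw [duhamel, ← hξ, ← mul_assoc, modulation_neg_mul, one_mul]

end SmoothSolution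

/-! ### The quadrilinear form and its symmetries. -/

theorem norm_fourierChar_coe (x : ℝ) : ‖(Real.fourierChar x : ℂ)‖ = 1 := Circle.norm_coe _

theorem fourier_mul_fourierInv {g ρ : ℝ → ℂ} (hg : Integrable g) (hρ : Integrable ρ) (x : ℝ) :
    𝓕 (fun y => 𝓕⁻ g y * ρ y) x = ∫ α, g (x - α) * 𝓕 ρ α := by
  have hρx : Integrable fun y => (Real.fourierChar (-(y * x)) : ℂ) * ρ y :=
    hρ.bdd_mul (continuous_fourierChar_coe.comp (by fun_prop)).aestronglyMeasurable
      (Eventually.of_forall fun y => (norm_fourierChar_coe _).le)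
  have h1 := integral_fourierInv_mul_eq_flip hg hρx
  have e1 : 𝓕 (fun y => 𝓕⁻ g y * ρ y) x
      = ∫ y, 𝓕⁻ g y * ((Real.fourierChar (-(y * x)) : ℂ) * ρ y) := by
    rw [Real.fourier_real_eq]
    congr 1; ext y
    rw [Circle.smul_def, smul_eq_mul]
    ring
  have e2 : ∀ ξ, 𝓕⁻ (fun y => (Real.fourierChar (-(y * x)) : ℂ) * ρ y) ξ = 𝓕 ρ (x - ξ) := by
    intro ξ
    rw [Real.fourierInv_eq, Real.fourier_real_eq]
    congr 1; ext y
    rw [Circle.smul_def, smul_eq_mul, Circle.smul_def, smul_eq_mul, ← mul_assoc,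
      ← fourierChar_add_coe]
    congr 3
    simp
    ring
  rw [e1, h1, ← integral_sub_left_eq_self _ volume x]
  simp only [e2, sub_sub_cancel]

theorem fourier_normSq_fourierInv {g : ℝ → ℂ} (hg : MemLp g 2) (hg1 : Integrable g) (α : ℝ) :
    𝓕 (fun y => conj (𝓕⁻ g y) * 𝓕⁻ g y) α = ∫ ξ, conj (g (ξ - α)) * g ξ := by
  have h2 : MemLp (fun ξ => g (ξ - α)) 2 :=
    hg.comp_measurePreserving (measurePreserving_sub_right volume α)
  rw [← integral_conj_fourierInv_mul h2 (hg1.comp_sub_right α) hg hg1, Real.fourier_real_eq]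
  congr 1; ext y
  have e : 𝓕⁻ (fun ξ => g (ξ - α)) y = (Real.fourierChar (α * y) : ℂ) * 𝓕⁻ g y := by
    rw [Real.fourierInv_eq, Real.fourierInv_eq, ← integral_const_mul]
    refine Eq.trans ?_ (integral_sub_right_eq_self _ α)
    congr 1; ext ξ
    simp only [Circle.smul_def, smul_eq_mul, ← mul_assoc, ← fourierChar_add_coe]
    congr 3
    simp
    ring
  rw [e, map_mul, Circle.smul_def, smul_eq_mul, ← Circle.coe_inv_eq_conj, ← AddChar.map_neg_eq_inv,
    mul_comm α y]
  ring

/-- The parameters are frequency differences rather than frequencies, because both the symmetrized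
symbol and the resonance function are governed by the product $\alpha\beta$. -/
theorem fourier_cubic_fourierInv {g : ℝ → ℂ} (hg : MemLp g 2) (hg1 : Integrable g) (x : ℝ) :
    𝓕 (fun y => (‖𝓕⁻ g y‖ : ℂ) ^ 2 * 𝓕⁻ g y) x
      = ∫ α, ∫ β, g (x - α) * (g (x - β) * conj (g (x - α - β))) := by
  have hv := memLp_fourierInv hg hg1
  have hρ : Integrable fun y => conj (𝓕⁻ g y) * 𝓕⁻ g y := hv.star.integrable_mul hv
  have e : (fun y => (‖𝓕⁻ g y‖ : ℂ) ^ 2 * 𝓕⁻ g y)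
      = fun y => 𝓕⁻ g y * (conj (𝓕⁻ g y) * 𝓕⁻ g y) := by
    ext y
    rw [← Complex.conj_mul']
    ring
  rw [e, fourier_mul_fourierInv hg1 hρ]
  congr 1; ext α
  rw [fourier_normSq_fourierInv hg hg1, ← integral_sub_left_eq_self _ volume x,
    ← integral_const_mul]
  congr 1; ext β
  rw [sub_right_comm]
  ring

/-- The quadrilinear expression in the energy identity, as a function of `((α, β), x)`. -/
noncomputable def quad (g : ℝ → ℂ) (p : (ℝ × ℝ) × ℝ) : ℂ :=
  conj (g p.2) * (g (p.2 - p.1.1) * (g (p.2 - p.1.2) * conj (g (p.2 - p.1.1 - p.1.2))))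

/-- The product Lebesgue measure on the parameter space. -/
noncomputable abbrev vol3 : Measure ((ℝ × ℝ) × ℝ) := (volume.prod volume).prod volume

theorem measurePreserving_shift {f : ℝ × ℝ → ℝ × ℝ} (hf : MeasurePreserving f)
    {a : ℝ × ℝ → ℝ} (ha : Measurable a) :
    MeasurePreserving (fun p : (ℝ × ℝ) × ℝ => (f p.1, p.2 - a p.1)) vol3 vol3 :=
  MeasurePreserving.skew_product hf (g := fun q x => x - a q) (by fun_prop)
    (Eventually.of_forall fun q => (measurePreserving_sub_right volume (a q)).map_eq)

theorem measurePreserving_neg_fst : MeasurePreserving fun q : ℝ × ℝ => (-q.1, q.2) :=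
  (Measure.measurePreserving_neg (volume : Measure ℝ)).prod (MeasurePreserving.id volume)

theorem measurePreserving_neg_snd : MeasurePreserving fun q : ℝ × ℝ => (q.1, -q.2) :=
  (MeasurePreserving.id (volume : Measure ℝ)).prod (Measure.measurePreserving_neg volume)

theorem measurePreserving_neg_both : MeasurePreserving fun q : ℝ × ℝ => (-q.1, -q.2) :=
  (Measure.measurePreserving_neg (volume : Measure ℝ)).prod (Measure.measurePreserving_neg volume)

/-- The relabelling of frequencies exchanging the roles of `x` and `x - α`. -/
def relabel₁ (p : (ℝ × ℝ) × ℝ) : (ℝ × ℝ) × ℝ := ((-p.1.1, p.1.2), p.2 - p.1.1)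

/-- The relabelling of frequencies exchanging the roles of `x` and `x - α - β`. -/
def relabel₂ (p : (ℝ × ℝ) × ℝ) : (ℝ × ℝ) × ℝ := ((-p.1.1, -p.1.2), p.2 - (p.1.1 + p.1.2))

/-- The relabelling of frequencies exchanging the roles of `x` and `x - β`. -/
def relabel₃ (p : (ℝ × ℝ) × ℝ) : (ℝ × ℝ) × ℝ := ((p.1.1, -p.1.2), p.2 - p.1.2)

theorem measurePreserving_relabel₁ : MeasurePreserving relabel₁ vol3 vol3 :=
  measurePreserving_shift measurePreserving_neg_fst measurable_fst

theorem measurePreserving_relabel₂ : MeasurePreserving relabel₂ vol3 vol3 :=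
  measurePreserving_shift measurePreserving_neg_both (measurable_fst.add measurable_snd)

theorem measurePreserving_relabel₃ : MeasurePreserving relabel₃ vol3 vol3 :=
  measurePreserving_shift measurePreserving_neg_snd measurable_snd

theorem relabel₁_relabel₁ (p) : relabel₁ (relabel₁ p) = p := by
  simp [relabel₁]

theorem relabel₂_relabel₂ (p) : relabel₂ (relabel₂ p) = p := by
  ext <;> simp [relabel₂]; ring

theorem relabel₃_relabel₃ (p) : relabel₃ (relabel₃ p) = p := by
  simp [relabel₃]

/-- The relabellings are measurable equivalences. -/
def relabelEquiv (r : (ℝ × ℝ) × ℝ → (ℝ × ℝ) × ℝ) (hr : Measurable r) (h : ∀ p, r (r p) = p) :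
    ((ℝ × ℝ) × ℝ) ≃ᵐ ((ℝ × ℝ) × ℝ) where
  toFun := r
  invFun := r
  left_inv := h
  right_inv := h
  measurable_toFun := hr
  measurable_invFun := hr

theorem integral_relabel {r : (ℝ × ℝ) × ℝ → (ℝ × ℝ) × ℝ} (hr : MeasurePreserving r vol3 vol3)
    (h : ∀ p, r (r p) = p) (F : (ℝ × ℝ) × ℝ → ℂ) :
    ∫ p, F (r p) ∂vol3 = ∫ p, F p ∂vol3 :=
  MeasurePreserving.integral_comp' (f := relabelEquiv r hr.measurable h) hr F

theorem lintegral_relabel {r : (ℝ × ℝ) × ℝ → (ℝ × ℝ) × ℝ} (hr : MeasurePreserving r vol3 vol3)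
    (h : ∀ p, r (r p) = p) (F : (ℝ × ℝ) × ℝ → ℝ≥0∞) :
    ∫⁻ p, F (r p) ∂vol3 = ∫⁻ p, F p ∂vol3 :=
  MeasurePreserving.lintegral_comp_emb (g := r) hr
    (relabelEquiv r hr.measurable h).measurableEmbedding F

theorem quad_relabel₁ (g : ℝ → ℂ) (p) : quad g (relabel₁ p) = conj (quad g p) := by
  simp only [quad, relabel₁, map_mul, Complex.conj_conj]
  ring_nf

theorem quad_relabel₂ (g : ℝ → ℂ) (p) : quad g (relabel₂ p) = quad g p := by
  simp only [quad, relabel₂]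
  ring_nf

theorem quad_relabel₃ (g : ℝ → ℂ) (p) : quad g (relabel₃ p) = conj (quad g p) := by
  simp only [quad, relabel₃, map_mul, Complex.conj_conj]
  ring_nf

/-- For fixed $\alpha$, the substitution $y=x-\beta$ decouples the $\beta$ integral from $x$ and
turns it into a second copy of the autocorrelation at $\alpha$. -/
theorem lintegral_quad_le {g : ℝ → ℝ≥0∞} (hg : Measurable g) :
    ∫⁻ p, g p.2 * (g (p.2 - p.1.1) * (g (p.2 - p.1.2) * g (p.2 - p.1.1 - p.1.2))) ∂vol3
      = ∫⁻ α, (∫⁻ x, g x * g (x - α)) ^ 2 := by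
  have hm : Measurable fun p : (ℝ × ℝ) × ℝ =>
      g p.2 * (g (p.2 - p.1.1) * (g (p.2 - p.1.2) * g (p.2 - p.1.1 - p.1.2))) := by fun_prop
  rw [lintegral_prod _ hm.aemeasurable, lintegral_prod _ hm.lintegral_prod_right'.aemeasurable]
  refine lintegral_congr fun α => ?_
  rw [lintegral_lintegral_swap (Measurable.aemeasurable (by fun_prop)), sq]
  rw [← lintegral_mul_const _ (by fun_prop)]
  refine lintegral_congr fun x => ?_
  simp_rw [← mul_assoc (g x)]
  rw [lintegral_const_mul _ (by fun_prop)]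
  congr 1
  rw [← lintegral_sub_left_eq_self _ x]
  refine lintegral_congr fun y => ?_
  simp only [sub_sub_cancel]
  rw [sub_right_comm, sub_sub_cancel]

theorem lintegral_mul_shift_le {g : ℝ → ℝ≥0∞} (hg : Measurable g) (α : ℝ) :
    ∫⁻ x, g x * g (x - α) ≤ ∫⁻ x, g x ^ 2 := by
  refine (ENNReal.pow_le_pow_left_iff two_ne_zero).1 ?_
  refine (lintegral_mul_sq_le hg.aemeasurable
    (hg.comp (measurable_sub_const α)).aemeasurable).trans (le_of_eq ?_)
  rw [sq]
  congr 1
  exact lintegral_sub_right_eq_self (fun x => g x ^ 2) α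

theorem lintegral_lintegral_mul_shift {g : ℝ → ℝ≥0∞} (hg : Measurable g) :
    ∫⁻ α, ∫⁻ x, g x * g (x - α) = (∫⁻ x, g x) ^ 2 := by
  rw [lintegral_lintegral_swap (Measurable.aemeasurable (by fun_prop)), sq,
    ← lintegral_mul_const _ hg]
  refine lintegral_congr fun x => ?_
  rw [lintegral_const_mul _ (by fun_prop)]
  congr 1
  exact lintegral_sub_left_eq_self g x

/-- One autocorrelation is at most $\|g\|_2^2$ uniformly in $\alpha$, the other integrates to
$\|g\|_1^2$. -/
theorem lintegral_enorm_quad_le {g : ℝ → ℂ} (hg : Measurable g) :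
    ∫⁻ p, ‖quad g p‖ₑ ∂vol3 ≤ (∫⁻ x, ‖g x‖ₑ ^ 2) * (∫⁻ x, ‖g x‖ₑ) ^ 2 := by
  have hm : Measurable fun x => ‖g x‖ₑ := hg.enorm
  have hc : ∀ z : ℂ, ‖conj z‖ₑ = ‖z‖ₑ := fun z => by
    rw [← ofReal_norm, ← ofReal_norm, RCLike.norm_conj]
  simp only [quad, enorm_mul, hc]
  rw [lintegral_quad_le hm, ← lintegral_lintegral_mul_shift hm, ← lintegral_const_mul _
    (Measurable.lintegral_prod_right' (f := fun p : ℝ × ℝ => ‖g p.2‖ₑ * ‖g (p.2 - p.1)‖ₑ)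
      (by fun_prop))]
  refine lintegral_mono fun α => ?_
  rw [sq]
  exact mul_le_mul' (lintegral_mul_shift_le hm α) le_rfl

theorem measurable_quad {g : ℝ → ℂ} (hg : Measurable g) : Measurable (quad g) := by
  have : Measurable fun z : ℂ => conj z := Complex.continuous_conj.measurable
  unfold quad
  fun_prop

theorem integrable_quad {g : ℝ → ℂ} (hg : Measurable g) (h1 : Integrable g) (h2 : MemLp g 2) :
    Integrable (quad g) vol3 := by
  refine ⟨(measurable_quad hg).aestronglyMeasurable, (lintegral_enorm_quad_le hg).trans_lt ?_⟩
  exact ENNReal.mul_lt_top ((memLp_two_iff_lintegral h2.1).1 h2) (ENNReal.pow_lt_top h1.2)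

/-- Supplies the integrability needed to exchange a time integral with a frequency integral. -/
theorem integrable_restrict_uIoc_prod {X : Type*} [MeasurableSpace X] {μ : Measure X} [SFinite μ]
    {F : ℝ → X → ℂ} (hF : Measurable (Function.uncurry F)) {c : ℝ → ℝ} (hc : Continuous c)
    (h : ∀ r, ∫⁻ x, ‖F r x‖ₑ ∂μ ≤ ENNReal.ofReal (c r)) (a b : ℝ) :
    Integrable (Function.uncurry F) ((volume.restrict (uIoc a b)).prod μ) := by
  refine ⟨hF.aestronglyMeasurable, ?_⟩
  rw [hasFiniteIntegral_iff_enorm, lintegral_prod _ hF.enorm.aemeasurable]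
  have h1 : IntegrableOn c (uIoc a b) :=
    (hc.integrableOn_uIcc (a := a) (b := b)).mono_set uIoc_subset_uIcc
  refine (lintegral_mono h).trans_lt (lt_of_le_of_lt (lintegral_mono fun r => ?_) h1.2)
  rw [← ofReal_norm, Real.norm_eq_abs]
  exact ENNReal.ofReal_le_ofReal (le_abs_self _)

/-- The symbol `⟨2πξ⟩^{2s}`. -/
noncomputable def weight (s ξ : ℝ) : ℝ := bracket (2 * Real.pi * ξ) ^ (2 * s)

theorem continuous_weight (s : ℝ) : Continuous (weight s) :=
  (continuous_bracket_rpow (2 * s)).comp (by fun_prop)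

theorem weight_pos (s ξ : ℝ) : 0 < weight s ξ := Real.rpow_pos_of_pos (bracket_pos _) _

theorem weight_le_one {s : ℝ} (hs : s ≤ 0) (ξ : ℝ) : weight s ξ ≤ 1 :=
  Real.rpow_le_one_of_one_le_of_nonpos (one_le_bracket _) (by linarith)

/-- The symmetrized symbol in the energy identity. -/
noncomputable def symbol (s : ℝ) (p : (ℝ × ℝ) × ℝ) : ℝ :=
  weight s p.2 - weight s (p.2 - p.1.1) - weight s (p.2 - p.1.2)
    + weight s (p.2 - p.1.1 - p.1.2)

theorem measurable_symbol (s : ℝ) : Measurable (symbol s) := by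
  have := (continuous_weight s).measurable
  unfold symbol
  fun_prop

theorem abs_symbol_le {s : ℝ} (hs : s ≤ 0) (p) : |symbol s p| ≤ 2 := by
  unfold symbol
  rw [abs_le]
  have := weight_le_one hs p.2
  have := weight_le_one hs (p.2 - p.1.1)
  have := weight_le_one hs (p.2 - p.1.2)
  have := weight_le_one hs (p.2 - p.1.1 - p.1.2)
  have := weight_pos s p.2
  have := weight_pos s (p.2 - p.1.1)
  have := weight_pos s (p.2 - p.1.2)
  have := weight_pos s (p.2 - p.1.1 - p.1.2)
  constructor <;> linarith

/-- Symmetrization of the weighted quadrilinear form. -/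
theorem two_mul_sub_conj_integral_weight {g : ℝ → ℂ} (hg : Measurable g) (h1 : Integrable g)
    (h2 : MemLp g 2) {s : ℝ} (hs : s ≤ 0) :
    2 * ((∫ p, (weight s p.2 : ℂ) * quad g p ∂vol3)
      - conj (∫ p, (weight s p.2 : ℂ) * quad g p ∂vol3)) = ∫ p, symbol s p * quad g p ∂vol3 := by
  have hq := integrable_quad hg h1 h2
  have hw := (continuous_weight s).measurable
  have hi : ∀ a : (ℝ × ℝ) × ℝ → ℝ, Measurable a →
      Integrable (fun p => (weight s (a p) : ℂ) * quad g p) vol3 := fun a ha =>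
    hq.bdd_mul (c := 1) (Complex.measurable_ofReal.comp (hw.comp ha)).aestronglyMeasurable
      (Eventually.of_forall fun p => by
        rw [Complex.norm_real, Real.norm_of_nonneg (weight_pos _ _).le]
        exact weight_le_one hs _)
  -- Each relabelling moves the weight to another frequency. Moving it from a conjugated to an
  -- unconjugated factor of `quad` conjugates the form; moving it between the two conjugated factors
  -- does not. This produces the signs of `symbol`.
  have e1 : conj (∫ p, (weight s p.2 : ℂ) * quad g p ∂vol3)
      = ∫ p, (weight s (p.2 - p.1.1) : ℂ) * quad g p ∂vol3 := by
    rw [← integral_relabel measurePreserving_relabel₁ relabel₁_relabel₁, ← integral_conj]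
    congr 1; ext p
    rw [map_mul, Complex.conj_ofReal, quad_relabel₁, Complex.conj_conj]
    rfl
  have e3 : conj (∫ p, (weight s p.2 : ℂ) * quad g p ∂vol3)
      = ∫ p, (weight s (p.2 - p.1.2) : ℂ) * quad g p ∂vol3 := by
    rw [← integral_relabel measurePreserving_relabel₃ relabel₃_relabel₃, ← integral_conj]
    congr 1; ext p
    rw [map_mul, Complex.conj_ofReal, quad_relabel₃, Complex.conj_conj]
    rfl
  have e2 : ∫ p, (weight s p.2 : ℂ) * quad g p ∂vol3
      = ∫ p, (weight s (p.2 - p.1.1 - p.1.2) : ℂ) * quad g p ∂vol3 := by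
    rw [← integral_relabel measurePreserving_relabel₂ relabel₂_relabel₂]
    congr 1; ext p
    rw [quad_relabel₂, sub_sub]
    rfl
  have e : (fun p => (symbol s p : ℂ) * quad g p) = fun p =>
      (weight s p.2 : ℂ) * quad g p - (weight s (p.2 - p.1.1) : ℂ) * quad g p
        - (weight s (p.2 - p.1.2) : ℂ) * quad g p
        + (weight s (p.2 - p.1.1 - p.1.2) : ℂ) * quad g p := by
    ext p
    simp only [symbol]
    push_cast
    ring
  have i0 := hi (fun p => p.2) (by fun_prop)
  have i1 := hi (fun p => p.2 - p.1.1) (by fun_prop)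
  have i2 := hi (fun p => p.2 - p.1.2) (by fun_prop)
  have i3 := hi (fun p => p.2 - p.1.1 - p.1.2) (by fun_prop)
  rw [e, integral_add ?_ i3, integral_sub ?_ i2, integral_sub i0 i1, ← e1, ← e2, ← e3]
  · ring
  · exact i0.sub i1
  · exact (i0.sub i1).sub i2

/-! ### The energy identity. -/

section SmoothSolution

variable {ω : ℝ} {ζ₀ : ℝ → ℝ} {u₀ : ℝ → ℂ} {u : ℝ → ℝ → ℂ}

theorem IsSmoothSolution.measurable_duhamel_right (h : IsSmoothSolution ω ζ₀ u₀ u)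
    (hζ : Continuous ζ₀) (t : ℝ) : Measurable (duhamel ω ζ₀ u₀ u t) :=
  (h.measurable_duhamel hζ).of_uncurry_left

theorem IsSmoothSolution.memLp_duhamel (h : IsSmoothSolution ω ζ₀ u₀ u)
    (hζ : Continuous ζ₀) (t : ℝ) : MemLp (duhamel ω ζ₀ u₀ u t) 2 :=
  (memLp_congr_ae (h.duhamel_ae_eq hζ t)).2 (memLp_fourierL2 _)

theorem IsSmoothSolution.integrable_duhamel (h : IsSmoothSolution ω ζ₀ u₀ u)
    (hζ : Continuous ζ₀) (t : ℝ) : Integrable (duhamel ω ζ₀ u₀ u t) :=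
  (integrable_congr (h.duhamel_ae_eq hζ t)).2 (h.integrable_fourierL2 t)

theorem IsSmoothSolution.eq_fourierInv_duhamel (h : IsSmoothSolution ω ζ₀ u₀ u)
    (hζ : Continuous ζ₀) (t : ℝ) : u t = 𝓕⁻ (duhamel ω ζ₀ u₀ u t) := by
  conv_lhs => rw [h.eq_fourierInv t]
  ext x
  rw [Real.fourierInv_eq, Real.fourierInv_eq]
  refine integral_congr_ae ?_
  filter_upwards [h.duhamel_ae_eq hζ t] with ξ hξ
  rw [hξ]

theorem IsSmoothSolution.lintegral_duhamel_le (h : IsSmoothSolution ω ζ₀ u₀ u)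
    (hζ : Continuous ζ₀) (t : ℝ) : ∫⁻ ξ, ‖duhamel ω ζ₀ u₀ u t ξ‖ₑ
      ≤ ENNReal.ofReal (weightedL1 (fourierL2 (u t))).toReal := by
  rw [ENNReal.ofReal_toReal (h.weightedL1_lt_top t).ne]
  refine le_trans (le_of_eq ?_) (lintegral_enorm_le_weightedL1 _)
  refine lintegral_congr_ae ?_
  filter_upwards [h.duhamel_ae_eq hζ t] with ξ hξ
  rw [hξ]

theorem IsSmoothSolution.lintegral_duhamel_sq (h : IsSmoothSolution ω ζ₀ u₀ u)
    (hζ : Continuous ζ₀) (t : ℝ) : ∫⁻ ξ, ‖duhamel ω ζ₀ u₀ u t ξ‖ₑ ^ 2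
      = ENNReal.ofReal ((eLpNorm (u t) 2 volume).toReal ^ 2) := by
  rw [ENNReal.ofReal_pow ENNReal.toReal_nonneg, ENNReal.ofReal_toReal (h.memLp t).eLpNorm_ne_top,
    eLpNorm_two_sq, ← lintegral_fourierL2_sq (h.memLp t)]
  refine lintegral_congr_ae ?_
  filter_upwards [h.duhamel_ae_eq hζ t] with ξ hξ
  rw [hξ]

theorem IsSmoothSolution.fourier_cubic (h : IsSmoothSolution ω ζ₀ u₀ u)
    (hζ : Continuous ζ₀) (t ξ : ℝ) : 𝓕 (cubic u t) ξ = ∫ α, ∫ β, duhamel ω ζ₀ u₀ u t (ξ - α) *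
      (duhamel ω ζ₀ u₀ u t (ξ - β) * conj (duhamel ω ζ₀ u₀ u t (ξ - α - β))) := by
  rw [← fourier_cubic_fourierInv (h.memLp_duhamel hζ t) (h.integrable_duhamel hζ t),
    ← h.eq_fourierInv_duhamel hζ t]
  rfl

theorem IsSmoothSolution.integral_weight_conj_mul_forcing (h : IsSmoothSolution ω ζ₀ u₀ u)
    (hζ : Continuous ζ₀) {s : ℝ} (hs : s ≤ 0) (t : ℝ) :
    ∫ ξ, weight s ξ * (conj (duhamel ω ζ₀ u₀ u t ξ) * forcing ω ζ₀ u t ξ)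
      = Complex.I * ζ₀ t * ω *
        ∫ p, weight s p.2 * quad (duhamel ω ζ₀ u₀ u t) p ∂vol3 := by
  have hi : Integrable (fun p => (weight s p.2 : ℂ) * quad (duhamel ω ζ₀ u₀ u t) p) vol3 :=
    (integrable_quad (h.measurable_duhamel_right hζ t) (h.integrable_duhamel hζ t)
      (h.memLp_duhamel hζ t)).bdd_mul (c := 1) (Complex.measurable_ofReal.comp
        ((continuous_weight s).measurable.comp measurable_snd)).aestronglyMeasurable
      (Eventually.of_forall fun p => by
        rw [Complex.norm_real, Real.norm_of_nonneg (weight_pos _ _).le]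
        exact weight_le_one hs _)
  rw [integral_prod_symm _ hi, ← integral_const_mul]
  refine integral_congr_ae ?_
  filter_upwards [hi.prod_left_ae] with ξ hξ
  rw [integral_prod _ hξ, forcing, h.fourier_cubic hζ]
  simp only [quad, integral_const_mul]
  ring

/-- The linear term is purely imaginary after multiplication by the conjugate and drops out. -/
theorem IsSmoothSolution.hasDerivAt_normSq (h : IsSmoothSolution ω ζ₀ u₀ u)
    (hζ : Continuous ζ₀) (t ξ : ℝ) :
    HasDerivAt (fun t => conj (duhamel ω ζ₀ u₀ u t ξ) * duhamel ω ζ₀ u₀ u t ξ)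
      (conj (duhamel ω ζ₀ u₀ u t ξ) * forcing ω ζ₀ u t ξ
        + conj (conj (duhamel ω ζ₀ u₀ u t ξ) * forcing ω ζ₀ u t ξ)) t := by
  have h1 := h.hasDerivAt_duhamel hζ t ξ
  refine (h1.star.mul h1).congr_deriv ?_
  simp only [RCLike.star_def, map_add, map_mul, map_neg, Complex.conj_I, Complex.conj_ofReal,
    Complex.conj_conj]
  ring

/-- The increment of the modified energy. -/
theorem IsSmoothSolution.energy_identity (h : IsSmoothSolution ω ζ₀ u₀ u)
    (hζ : Continuous ζ₀) {s : ℝ} (hs : s ≤ 0) (t : ℝ) :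
    (∫ ξ, weight s ξ * (conj (duhamel ω ζ₀ u₀ u t ξ) * duhamel ω ζ₀ u₀ u t ξ))
      - ∫ ξ, weight s ξ * (conj (duhamel ω ζ₀ u₀ u 0 ξ) * duhamel ω ζ₀ u₀ u 0 ξ)
    = Complex.I * ω / 2 * ∫ p, symbol s p *
        (∫ r in (0 : ℝ)..t, ζ₀ r * quad (duhamel ω ζ₀ u₀ u r) p) ∂vol3 := by
  have hfm := h.measurable_duhamel hζ
  set f := duhamel ω ζ₀ u₀ u with hf
  have hFm := h.measurable_forcing hζ
  have hconj : Measurable fun z : ℂ => conj z := Complex.continuous_conj.measurable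
  have hw := (continuous_weight s).measurable
  have hnc : ∀ z : ℂ, ‖conj z‖ₑ = ‖z‖ₑ := fun z => by
    rw [← ofReal_norm, ← ofReal_norm, RCLike.norm_conj]
  have hwn : ∀ ξ, ‖(weight s ξ : ℂ)‖ₑ ≤ 1 := fun ξ => by
    rw [← ofReal_norm, Complex.norm_real, Real.norm_of_nonneg (weight_pos _ _).le,
      ← ENNReal.ofReal_one]
    exact ENNReal.ofReal_le_ofReal (weight_le_one hs _)
  set N1 : ℝ → ℝ := fun t => (weightedL1 (fourierL2 (u t))).toReal
  set N2 : ℝ → ℝ := fun t => (eLpNorm (u t) 2 volume).toReal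
  have hN1 : Continuous N1 := h.continuous_weightedL1
  have hN2 : Continuous N2 := h.continuous_eLpNorm
  set a : ℝ → ℝ → ℂ := fun r ξ => weight s ξ * (conj (f r ξ) * forcing ω ζ₀ u r ξ) with ha
  have ham : Measurable (Function.uncurry a) := by
    have e : Function.uncurry a = fun p : ℝ × ℝ => (weight s p.2 : ℂ) *
      (conj (Function.uncurry f p) * Function.uncurry (forcing ω ζ₀ u) p) := rfl
    rw [e]
    fun_prop
  have hab : ∀ r, ∫⁻ ξ, ‖a r ξ‖ₑ ≤ ENNReal.ofReal (N1 r * (|ζ₀ r| * |ω| * (N1 r * N2 r ^ 2))) := by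
    intro r
    calc ∫⁻ ξ, ‖a r ξ‖ₑ ≤ ∫⁻ ξ, ‖f r ξ‖ₑ * ENNReal.ofReal (|ζ₀ r| * |ω| * (N1 r * N2 r ^ 2)) := by
          refine lintegral_mono fun ξ => ?_
          simp only [ha, enorm_mul, hnc]
          calc _ ≤ 1 * (‖f r ξ‖ₑ * ENNReal.ofReal (|ζ₀ r| * |ω| * (N1 r * N2 r ^ 2))) := by
                gcongr
                · exact hwn ξ
                · rw [← ofReal_norm]
                  exact ENNReal.ofReal_le_ofReal (h.norm_forcing_le r ξ)
            _ = _ := one_mul _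
      _ = (∫⁻ ξ, ‖f r ξ‖ₑ) * ENNReal.ofReal (|ζ₀ r| * |ω| * (N1 r * N2 r ^ 2)) :=
          lintegral_mul_const' _ _ ENNReal.ofReal_ne_top
      _ ≤ _ := by
          rw [ENNReal.ofReal_mul ENNReal.toReal_nonneg]
          gcongr
          exact h.lintegral_duhamel_le hζ r
  set G : ℝ → ℝ → ℂ := fun r ξ => a r ξ + conj (a r ξ) with hG
  have hGm : Measurable (Function.uncurry G) := by
    have e : Function.uncurry G = fun p : ℝ × ℝ => Function.uncurry a p
      + conj (Function.uncurry a p) := rfl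
    rw [e]
    fun_prop
  have hGi : Integrable (Function.uncurry G) ((volume.restrict (uIoc 0 t)).prod volume) := by
    refine integrable_restrict_uIoc_prod hGm
      (c := fun r => 2 * (N1 r * (|ζ₀ r| * |ω| * (N1 r * N2 r ^ 2)))) (by fun_prop) (fun r => ?_) _ _
    have har : Measurable (a r) := ham.of_uncurry_left
    calc ∫⁻ ξ, ‖G r ξ‖ₑ ≤ ∫⁻ ξ, (‖a r ξ‖ₑ + ‖a r ξ‖ₑ) := by
          refine lintegral_mono fun ξ => (enorm_add_le _ _).trans ?_
          rw [hnc]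
      _ = 2 * ∫⁻ ξ, ‖a r ξ‖ₑ := by rw [lintegral_add_left har.enorm, two_mul]
      _ ≤ _ := by
          rw [ENNReal.ofReal_mul two_pos.le, ENNReal.ofReal_ofNat]
          gcongr
          exact hab r
  -- The fundamental theorem of calculus is applied at each fixed $\xi$. Two applications of Fubini
  -- then bring the time integral inside the symmetrized form, where its oscillation can be
  -- exploited.
  have hft : ∀ ξ, (weight s ξ : ℂ) * (conj (f t ξ) * f t ξ) - weight s ξ * (conj (f 0 ξ) * f 0 ξ)
      = ∫ r in (0 : ℝ)..t, G r ξ := by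
    intro ξ
    have hd : ∀ r, HasDerivAt (fun r => (weight s ξ : ℂ) * (conj (f r ξ) * f r ξ)) (G r ξ) r := by
      intro r
      refine ((h.hasDerivAt_normSq hζ r ξ).const_mul (weight s ξ : ℂ)).congr_deriv ?_
      simp only [hG, ha, map_mul, Complex.conj_ofReal, Complex.conj_conj]
      ring
    refine (intervalIntegral.integral_eq_sub_of_hasDerivAt (fun r _ => hd r)
      (Continuous.intervalIntegrable ?_ _ _)).symm
    have h1 : Continuous fun r => f r ξ :=
      continuous_iff_continuousAt.2 fun r => (h.hasDerivAt_duhamel hζ r ξ).continuousAt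
    have h2 := h.continuous_forcing hζ ξ
    have h3 : Continuous fun r => a r ξ := by
      have := Complex.continuous_conj.comp h1
      exact continuous_const.mul (this.mul h2)
    exact h3.add (Complex.continuous_conj.comp h3)
  have hint : ∀ r, Integrable fun ξ => (weight s ξ : ℂ) * (conj (f r ξ) * f r ξ) := fun r =>
    Integrable.bdd_mul (c := 1)
      ((h.memLp_duhamel hζ r).star.integrable_mul (h.memLp_duhamel hζ r))
      (Complex.measurable_ofReal.comp hw).aestronglyMeasurable
      (Eventually.of_forall fun ξ => by
        rw [Complex.norm_real, Real.norm_of_nonneg (weight_pos _ _).le]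
        exact weight_le_one hs _)
  have hGr : ∀ r, ∫ ξ, G r ξ
      = Complex.I * ω / 2 * ∫ p, ζ₀ r * (symbol s p * quad (f r) p) ∂vol3 := by
    intro r
    have har : Measurable (a r) := ham.of_uncurry_left
    have hai : Integrable (a r) :=
      ⟨har.aestronglyMeasurable, (hab r).trans_lt ENNReal.ofReal_lt_top⟩
    have hac : Integrable fun ξ => conj (a r ξ) :=
      ⟨(hconj.comp har).aestronglyMeasurable, by
        rw [hasFiniteIntegral_iff_enorm]
        simp only [hnc]
        exact hai.2⟩
    simp only [hG]
    rw [integral_add hai hac, integral_conj,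
      h.integral_weight_conj_mul_forcing hζ hs r, integral_const_mul,
      ← two_mul_sub_conj_integral_weight (h.measurable_duhamel_right hζ r)
        (h.integrable_duhamel hζ r) (h.memLp_duhamel hζ r) hs]
    simp only [map_mul, Complex.conj_I, Complex.conj_ofReal]
    ring
  rw [← integral_sub (hint t) (hint 0)]
  simp only [hft]
  rw [← intervalIntegral_integral_swap hGi]
  simp only [hGr]
  rw [intervalIntegral.integral_const_mul]
  congr 1
  rw [intervalIntegral_integral_swap]
  · congr 1; ext p
    rw [← intervalIntegral.integral_const_mul]
    congr 1; ext r
    ring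
  · have hsm := measurable_symbol s
    refine integrable_restrict_uIoc_prod (c := fun r => |ζ₀ r| * (2 * (N2 r ^ 2 * N1 r ^ 2))) ?_
      (by fun_prop) (fun r => ?_) _ _
    · have e : (Function.uncurry fun r p => (ζ₀ r : ℂ) * (symbol s p * quad (f r) p)) =
          fun q : ℝ × ((ℝ × ℝ) × ℝ) => (ζ₀ q.1 : ℂ) * (symbol s q.2 *
            (conj (Function.uncurry f (q.1, q.2.2)) * (Function.uncurry f (q.1, q.2.2 - q.2.1.1) *
              (Function.uncurry f (q.1, q.2.2 - q.2.1.2) *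
                conj (Function.uncurry f (q.1, q.2.2 - q.2.1.1 - q.2.1.2)))))) := rfl
      have := hζ.measurable
      rw [e]
      fun_prop
    · calc ∫⁻ p, ‖(ζ₀ r : ℂ) * (symbol s p * quad (f r) p)‖ₑ ∂vol3
          ≤ ∫⁻ p, ENNReal.ofReal |ζ₀ r| * (2 * ‖quad (f r) p‖ₑ) ∂vol3 := by
            refine lintegral_mono fun p => ?_
            rw [enorm_mul, enorm_mul]
            gcongr
            · rw [← ofReal_norm, Complex.norm_real, Real.norm_eq_abs]
            · rw [← ofReal_norm, Complex.norm_real, Real.norm_eq_abs, ← ENNReal.ofReal_ofNat]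
              exact ENNReal.ofReal_le_ofReal (abs_symbol_le hs p)
        _ = ENNReal.ofReal |ζ₀ r| * (2 * ∫⁻ p, ‖quad (f r) p‖ₑ ∂vol3) := by
            rw [lintegral_const_mul' _ _ ENNReal.ofReal_ne_top,
              lintegral_const_mul' _ _ ENNReal.ofNat_ne_top]
        _ ≤ _ := by
            rw [ENNReal.ofReal_mul (abs_nonneg _), ENNReal.ofReal_mul two_pos.le,
              ENNReal.ofReal_ofNat, ENNReal.ofReal_mul (by positivity)]
            gcongr
            refine (lintegral_enorm_quad_le (h.measurable_duhamel_right hζ r)).trans ?_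
            rw [h.lintegral_duhamel_sq hζ r, ENNReal.ofReal_pow ENNReal.toReal_nonneg (n := 2)
              (p := N1 r)]
            gcongr
            exact h.lintegral_duhamel_le hζ r

theorem IsSmoothSolution.hsNorm_sq_eq (h : IsSmoothSolution ω ζ₀ u₀ u)
    (hζ : Continuous ζ₀) {s : ℝ} (hs : s ≤ 0) (t : ℝ) :
    hsNorm s (u t) ^ 2 = ENNReal.ofReal (2 * Real.pi) * ENNReal.ofReal
      (∫ ξ, weight s ξ * (conj (duhamel ω ζ₀ u₀ u t ξ) * duhamel ω ζ₀ u₀ u t ξ)).re := by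
  have e : ∀ ξ, (weight s ξ : ℂ) * (conj (duhamel ω ζ₀ u₀ u t ξ) * duhamel ω ζ₀ u₀ u t ξ)
      = ((weight s ξ * ‖duhamel ω ζ₀ u₀ u t ξ‖ ^ 2 : ℝ) : ℂ) := fun ξ => by
    rw [Complex.conj_mul']
    push_cast
    rfl
  simp only [e]
  rw [integral_complex_ofReal, Complex.ofReal_re, hsNorm_sq (h.memLp t),
    ofReal_integral_eq_lintegral_ofReal]
  · congr 1
    refine lintegral_congr_ae ?_
    filter_upwards [h.duhamel_ae_eq hζ t] with ξ hξ
    rw [← hξ, ENNReal.ofReal_mul (weight_pos _ _).le, ENNReal.ofReal_pow (norm_nonneg _),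
      ofReal_norm, mul_comm]
    rfl
  · refine Integrable.bdd_mul (c := 1) ((memLp_two_iff_integrable_sq_norm
      (h.memLp_duhamel hζ t).1).1 (h.memLp_duhamel hζ t))
      (continuous_weight s).aestronglyMeasurable (Eventually.of_forall fun ξ => ?_)
    rw [Real.norm_of_nonneg (weight_pos _ _).le]
    exact weight_le_one hs _
  · exact Eventually.of_forall fun ξ => mul_nonneg (weight_pos _ _).le (by positivity)

/-- The energy estimate in integrated form. -/
theorem IsSmoothSolution.hsNorm_sq_le (h : IsSmoothSolution ω ζ₀ u₀ u)
    (hζ : Continuous ζ₀) (hω : |ω| = 1) {s : ℝ} (hs : s ≤ 0) (t : ℝ) :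
    hsNorm s (u t) ^ 2 ≤ hsNorm s u₀ ^ 2 + ENNReal.ofReal Real.pi * ∫⁻ p, ‖symbol s p‖ₑ *
        ‖∫ r in (0 : ℝ)..t, (ζ₀ r : ℂ) * quad (duhamel ω ζ₀ u₀ u r) p‖ₑ ∂vol3 := by
  have h0 := h.hsNorm_sq_eq hζ hs 0
  rw [h.initial] at h0
  rw [h.hsNorm_sq_eq hζ hs t, h0]
  have hE := h.energy_identity hζ hs t
  set A := ∫ ξ, (weight s ξ : ℂ) * (conj (duhamel ω ζ₀ u₀ u t ξ) * duhamel ω ζ₀ u₀ u t ξ)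
  set A0 := ∫ ξ, (weight s ξ : ℂ) * (conj (duhamel ω ζ₀ u₀ u 0 ξ) * duhamel ω ζ₀ u₀ u 0 ξ)
  set D := ∫ p, (symbol s p : ℂ) *
        (∫ r in (0 : ℝ)..t, (ζ₀ r : ℂ) * quad (duhamel ω ζ₀ u₀ u r) p) ∂vol3
  have h1 : A.re ≤ A0.re + 1 / 2 * ‖D‖ := by
    have h2 := Complex.re_le_norm (A - A0)
    rw [hE, norm_mul, norm_div, norm_mul, Complex.norm_I, Complex.norm_real, Real.norm_eq_abs,
      hω] at h2
    rw [← hE] at h2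
    simp at h2
    linarith
  calc _ ≤ ENNReal.ofReal (2 * Real.pi) * ENNReal.ofReal (A0.re + 1 / 2 * ‖D‖) := by gcongr
    _ ≤ ENNReal.ofReal (2 * Real.pi) * (ENNReal.ofReal A0.re + ENNReal.ofReal (1 / 2 * ‖D‖)) := by
        gcongr
        exact ENNReal.ofReal_add_le
    _ = ENNReal.ofReal (2 * Real.pi) * ENNReal.ofReal A0.re + ENNReal.ofReal Real.pi * ‖D‖ₑ := by
        rw [mul_add, ← ENNReal.ofReal_mul Real.two_pi_pos.le (q := 1 / 2 * ‖D‖), ← ofReal_norm D,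
          ← ENNReal.ofReal_mul Real.pi_pos.le]
        congr 2
        ring
    _ ≤ _ := by
        gcongr
        refine (enorm_integral_le_lintegral_enorm _).trans (le_of_eq ?_)
        refine lintegral_congr fun p => ?_
        rw [enorm_mul]
        congr 1
        rw [← ofReal_norm, ← ofReal_norm, Complex.norm_real]

end SmoothSolution

/-! ### Averaging over the position of the time window. -/

theorem fourier_fourierChar_mul (h : ℝ → ℂ) (τ σ : ℝ) :
    𝓕 (fun t => (Real.fourierChar (-(t * τ)) : ℂ) * h t) σ = 𝓕 h (τ + σ) := by
  rw [Real.fourier_real_eq, Real.fourier_real_eq]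
  congr 1; ext t
  rw [Circle.smul_def, smul_eq_mul, Circle.smul_def, smul_eq_mul, ← mul_assoc,
    ← fourierChar_add_coe]
  congr 3
  ring

theorem fourier_comp_neg (h : ℝ → ℂ) (σ : ℝ) : 𝓕 (fun t => h (-t)) σ = 𝓕 h (-σ) := by
  rw [Real.fourier_real_eq, Real.fourier_real_eq, ← integral_neg_eq_self]
  simp

/-- Plancherel's identity for the translation parameter of a localized function. -/
theorem lintegral_fourier_localized_sq {η h : ℝ → ℂ} (hη : Continuous η) (hηc : HasCompactSupport η)
    (hh : Continuous h) (hhc : HasCompactSupport h) (τ : ℝ) :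
    ∫⁻ t₀, ‖𝓕 (fun t => η (t - t₀) * h t) τ‖ₑ ^ 2
      = ∫⁻ σ, ‖𝓕 η σ‖ₑ ^ 2 * ‖𝓕 h (τ - σ)‖ₑ ^ 2 := by
  obtain ⟨k, hk⟩ : ∃ k : ℝ → ℂ, k = fun t => (Real.fourierChar (-(t * τ)) : ℂ) * h t := ⟨_, rfl⟩
  have hkc : Continuous k := hk ▸ (continuous_fourierChar_coe.comp (by fun_prop)).mul hh
  have hks : HasCompactSupport k := hk ▸ hhc.mul_left
  have hn : Continuous fun t => η (-t) := hη.comp continuous_neg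
  have hns : HasCompactSupport fun t => η (-t) := hηc.comp_homeomorph (Homeomorph.neg ℝ)
  obtain ⟨c, hc⟩ : ∃ c : ℝ → ℂ,
    c = k ⋆[ContinuousLinearMap.mul ℂ ℂ, volume] fun t => η (-t) := ⟨_, rfl⟩
  have hcc : Continuous c :=
    hc ▸ hns.continuous_convolution_right _ hkc.locallyIntegrable hn
  have hcs : HasCompactSupport c := by
    rw [hc]
    exact HasCompactSupport.convolution (μ := volume) (ContinuousLinearMap.mul ℂ ℂ) hks hns
  -- As a function of `t₀` the localized transform is the convolution of the modulated `h` with the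
  -- reflected `η`.
  have e1 : ∀ t₀, 𝓕 (fun t => η (t - t₀) * h t) τ = c t₀ := by
    intro t₀
    rw [Real.fourier_real_eq, hc, convolution_def]
    congr 1; ext t
    simp only [hk, ContinuousLinearMap.mul_apply', Circle.smul_def, smul_eq_mul, neg_sub]
    ring
  have e2 : ∀ σ, 𝓕 c σ = 𝓕 h (τ + σ) * 𝓕 η (-σ) := by
    intro σ
    rw [hc, Real.fourier_mul_convolution_eq (hkc.integrable_of_hasCompactSupport hks)
      (hn.integrable_of_hasCompactSupport hns), hk, fourier_fourierChar_mul, fourier_comp_neg]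
  simp only [e1]
  rw [← lintegral_fourier_sq (hcc.memLp_of_hasCompactSupport hcs)
    (hcc.integrable_of_hasCompactSupport hcs), ← lintegral_neg_eq_self]
  refine lintegral_congr fun σ => ?_
  rw [e2, neg_neg, enorm_mul, mul_pow, mul_comm, ← sub_eq_add_neg]

theorem bracket_add_le_mul (x y : ℝ) : bracket (x + y) ≤ 2 * bracket x * bracket y := by
  have h1 := bracket_add_le x y
  have h2 := abs_le_bracket y
  nlinarith [one_le_bracket x, one_le_bracket y]

/-- Peetre's inequality. -/
theorem jap_add_le {r : ℝ} (hr : 0 ≤ r) (x y : ℝ) :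
    jap r (x + y) ≤ ENNReal.ofReal (2 ^ r) * jap r x * jap r y := by
  rw [jap, jap, jap, ← ENNReal.ofReal_mul (by positivity), ← ENNReal.ofReal_mul
    (mul_nonneg (by positivity) (Real.rpow_nonneg (bracket_pos _).le _)),
    ← Real.mul_rpow two_pos.le (bracket_pos _).le,
    ← Real.mul_rpow (mul_nonneg two_pos.le (bracket_pos _).le) (bracket_pos _).le]
  exact ENNReal.ofReal_le_ofReal
    (Real.rpow_le_rpow (bracket_pos _).le (bracket_add_le_mul x y) hr)

/-- The windowed transforms control the full one. Peetre's inequality moves the weight from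
$\tau-\sigma$ to $\tau$ at the price $\langle\sigma\rangle^r$, which is compensated in the constant
on the left. No partition of unity is needed: $\eta\neq0$ makes that constant positive. -/
theorem lintegral_localized_weighted_le {η h : ℝ → ℂ} (hη : Continuous η)
    (hηc : HasCompactSupport η) (hh : Continuous h) (hhc : HasCompactSupport h) {r : ℝ}
    (hr : 0 ≤ r) (θ : ℝ) :
    (∫⁻ σ, ‖𝓕 η σ‖ₑ ^ 2 * jap (-r) (2 * Real.pi * σ)) *
        ∫⁻ τ, ‖𝓕 h τ‖ₑ ^ 2 * jap r (2 * Real.pi * τ + θ)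
      ≤ ENNReal.ofReal (2 ^ r) *
        ∫⁻ τ, (∫⁻ t₀, ‖𝓕 (fun t => η (t - t₀) * h t) τ‖ₑ ^ 2) * jap r (2 * Real.pi * τ + θ) := by
  have h1 := (continuous_fourier (hη.integrable_of_hasCompactSupport hηc)).measurable
  have h2 := (continuous_fourier (hh.integrable_of_hasCompactSupport hhc)).measurable
  simp only [lintegral_fourier_localized_sq hη hηc hh hhc]
  have e : ∀ τ, (∫⁻ σ, ‖𝓕 η σ‖ₑ ^ 2 * ‖𝓕 h (τ - σ)‖ₑ ^ 2) * jap r (2 * Real.pi * τ + θ)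
      = ∫⁻ σ, ‖𝓕 η σ‖ₑ ^ 2 * ‖𝓕 h (τ - σ)‖ₑ ^ 2 * jap r (2 * Real.pi * τ + θ) := fun τ =>
    (lintegral_mul_const' _ _ (jap_ne_top _ _)).symm
  simp only [e]
  rw [lintegral_lintegral_swap (Measurable.aemeasurable (by fun_prop)),
    ← lintegral_const_mul _ (Measurable.lintegral_prod_right' (f := fun p : ℝ × ℝ =>
      ‖𝓕 η p.1‖ₑ ^ 2 * ‖𝓕 h (p.2 - p.1)‖ₑ ^ 2 * jap r (2 * Real.pi * p.2 + θ)) (by fun_prop)),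
    ← lintegral_mul_const _ (by fun_prop)]
  refine lintegral_mono fun σ => ?_
  dsimp only
  rw [← lintegral_sub_right_eq_self (fun τ => ‖𝓕 h τ‖ₑ ^ 2 * jap r (2 * Real.pi * τ + θ)) σ,
    ← lintegral_const_mul' _ _ ENNReal.ofReal_ne_top, ← lintegral_const_mul _ (by fun_prop)]
  refine lintegral_mono fun τ => ?_
  dsimp only
  have hp := jap_add_le hr (2 * Real.pi * τ + θ) (-(2 * Real.pi * σ))
  have e2 : 2 * Real.pi * τ + θ + -(2 * Real.pi * σ) = 2 * Real.pi * (τ - σ) + θ := by ring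
  rw [e2, jap_neg] at hp
  calc _ ≤ ‖𝓕 η σ‖ₑ ^ 2 * jap (-r) (2 * Real.pi * σ) * (‖𝓕 h (τ - σ)‖ₑ ^ 2 *
        (ENNReal.ofReal (2 ^ r) * jap r (2 * Real.pi * τ + θ) * jap r (2 * Real.pi * σ))) := by
        gcongr
    _ = ENNReal.ofReal (2 ^ r) * (‖𝓕 η σ‖ₑ ^ 2 * ‖𝓕 h (τ - σ)‖ₑ ^ 2 *
        jap r (2 * Real.pi * τ + θ)) * (jap (-r) (2 * Real.pi * σ) * jap r (2 * Real.pi * σ)) := by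
        ring
    _ = _ := by rw [jap_mul, neg_add_cancel, jap_zero, mul_one]

theorem lintegral_fourier_weighted_pos {η : ℝ → ℂ} (hη : Continuous η) (hηc : HasCompactSupport η)
    (hη0 : η 0 ≠ 0) (r : ℝ) : 0 < ∫⁻ σ, ‖𝓕 η σ‖ₑ ^ 2 * jap (-r) (2 * Real.pi * σ) := by
  have hi : Integrable η := hη.integrable_of_hasCompactSupport hηc
  have hm := (continuous_fourier hi).measurable
  rw [pos_iff_ne_zero, Ne, lintegral_eq_zero_iff (by fun_prop)]
  intro h
  have h2 : ∫⁻ x, ‖η x‖ₑ ^ 2 = 0 := by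
    rw [← lintegral_fourier_sq (hη.memLp_of_hasCompactSupport hηc) hi,
      lintegral_eq_zero_iff (by fun_prop)]
    filter_upwards [h] with σ hσ
    simpa [jap_ne_zero] using hσ
  rw [lintegral_eq_zero_iff (by fun_prop)] at h2
  have h3 : η =ᵐ[volume] 0 := by
    filter_upwards [h2] with x hx
    simpa using hx
  have := (Continuous.ae_eq_iff_eq volume hη continuous_zero).1 h3
  exact hη0 (by rw [this]; rfl)

/-! ### From the $Y$ norm to a weighted $L^2$ bound. -/

theorem xNorm_congr {b : ℝ} {u v : SpaceTime → ℂ} (h : u =ᵐ[volume] v) : xNorm b u = xNorm b v := by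
  unfold xNorm hat
  rw [fourierL2_congr h]
  by_cases hu : MemLp u 2 (volume : Measure SpaceTime)
  · rw [if_pos hu, if_pos ((memLp_congr_ae h).1 hu)]
  · rw [if_neg hu, if_neg fun hv => hu ((memLp_congr_ae h).2 hv)]

theorem le_xNorm_spaceInv_sq {g : ℝ → ℝ → ℂ} (hg : Measurable (Function.uncurry g))
    (hg1 : Integrable (Function.uncurry g) (volume.prod volume))
    (hg2 : MemLp (Function.uncurry g) 2 (volume.prod volume)) (b : ℝ) :
    ∫⁻ τ, ∫⁻ ξ, ‖timeFourier g τ ξ‖ₑ ^ 2 * jap (2 * b) (2 * Real.pi * τ + phase ξ)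
      ≤ xNorm b (fun p => spaceInv g (p 0) (p 1)) ^ 2 := by
  have hm := measurable_timeFourier hg
  have hph := continuous_phase.measurable
  rw [xNorm, if_pos (memLp_spaceInv hg hg1 hg2), ← ENNReal.rpow_natCast, ← ENNReal.rpow_mul]
  norm_num
  have e : ∀ q : SpaceTime, ‖hat (fun p : SpaceTime => spaceInv g (p 0) (p 1)) q‖ₑ ^ 2 *
      ENNReal.ofReal (bracket (q 0 + q 1 ^ 2) ^ (2 * b))
      = (fun q : SpaceTime => ‖fourierL2 (fun p : SpaceTime => spaceInv g (p 0) (p 1)) q‖ₑ ^ 2 *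
        jap (2 * b) (2 * Real.pi * q 0 + phase (q 1))) ((2 * Real.pi)⁻¹ • q) := by
    intro q
    have hpi := Real.pi_pos.ne'
    simp only [hat, jap, PiLp.smul_apply, smul_eq_mul, phase]
    congr 4
    field_simp
    ring
  simp only [e]
  rw [lintegral_comp_smul (fun q : SpaceTime =>
      ‖fourierL2 (fun p : SpaceTime => spaceInv g (p 0) (p 1)) q‖ₑ ^ 2 *
        jap (2 * b) (2 * Real.pi * q 0 + phase (q 1))) (by positivity),
    ← lintegral_spaceTime (F := fun τ ξ => ‖timeFourier g τ ξ‖ₑ ^ 2 *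
      jap (2 * b) (2 * Real.pi * τ + phase ξ)) (by fun_prop)]
  have e2 : ∫⁻ q : SpaceTime, ‖fourierL2 (fun p : SpaceTime => spaceInv g (p 0) (p 1)) q‖ₑ ^ 2 *
        jap (2 * b) (2 * Real.pi * q 0 + phase (q 1))
      = ∫⁻ p : SpaceTime, ‖timeFourier g (p 0) (p 1)‖ₑ ^ 2 *
        jap (2 * b) (2 * Real.pi * p 0 + phase (p 1)) := by
    refine lintegral_congr_ae ?_
    filter_upwards [fourierL2_spaceInv hg hg1 hg2] with q hq
    rw [hq]
  rw [e2]
  -- The Jacobian $(2\pi)^2\ge1$ between the two frequency normalizations is discarded, so only an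
  -- inequality is claimed.
  refine le_mul_of_one_le_left' ?_
  rw [← ENNReal.ofReal_one]
  refine ENNReal.ofReal_le_ofReal ?_
  rw [finrank_euclideanSpace_fin, inv_pow, inv_inv, abs_of_pos (by positivity)]
  nlinarith [Real.pi_gt_three]

/-- Time slices of the spatial Fourier transform of a function with compact support in time. -/
structure IsSliceFamily (R : ℝ) (g : ℝ → ℝ → ℂ) : Prop where
  measurable : Measurable (Function.uncurry g)
  lintegral_lt_top : ∫⁻ t, ∫⁻ ξ, ‖g t ξ‖ₑ < ∞
  lintegral_sq_lt_top : ∫⁻ t, ∫⁻ ξ, ‖g t ξ‖ₑ ^ 2 < ∞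
  continuous : ∀ ξ, Continuous fun t => g t ξ
  eq_zero : ∀ t ξ, R < |t| → g t ξ = 0

/-- Restriction to frequencies `|2πξ| ≤ N`. -/
noncomputable def truncFreq (N : ℝ) (g : ℝ → ℝ → ℂ) (t ξ : ℝ) : ℂ :=
  {ξ : ℝ | |2 * Real.pi * ξ| ≤ N}.indicator (g t) ξ

/-- The parabolic dilation on the frequency side. -/
noncomputable def dilateFreq (l : ℝ) (g : ℝ → ℝ → ℂ) (t ξ : ℝ) : ℂ := g (l ^ 2 * t) (l⁻¹ * ξ)

/-- Localization in time. -/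
noncomputable def localizeTime (η : ℝ → ℂ) (t₀ : ℝ) (g : ℝ → ℝ → ℂ) (t ξ : ℝ) : ℂ :=
  η (t - t₀) * g t ξ

theorem lintegral_lintegral_comp_mul (F : ℝ → ℝ → ℝ≥0∞)
    {a c : ℝ} (ha : a ≠ 0) (hc : c ≠ 0) : ∫⁻ t, ∫⁻ x, F (a * t) (c * x)
      = ENNReal.ofReal |a⁻¹| * ENNReal.ofReal |c⁻¹| * ∫⁻ t, ∫⁻ x, F t x := by
  rw [lintegral_comp_const_mul (fun t => ∫⁻ x, F t (c * x)) ha, mul_assoc,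
    ← lintegral_const_mul' (ENNReal.ofReal |c⁻¹|) _ ENNReal.ofReal_ne_top]
  simp only [lintegral_comp_const_mul (F _) hc]

namespace IsSliceFamily

variable {R : ℝ} {g : ℝ → ℝ → ℂ}

theorem integrable (h : IsSliceFamily R g) :
    Integrable (Function.uncurry g) (volume.prod volume) := by
  refine ⟨h.measurable.aestronglyMeasurable, ?_⟩
  rw [hasFiniteIntegral_iff_enorm, lintegral_prod _ h.measurable.enorm.aemeasurable]
  exact h.lintegral_lt_top

theorem memLp (h : IsSliceFamily R g) :
    MemLp (Function.uncurry g) 2 (volume.prod volume) := by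
  rw [memLp_two_iff_lintegral h.measurable.aestronglyMeasurable,
    lintegral_prod _ (h.measurable.enorm.pow_const 2).aemeasurable]
  exact h.lintegral_sq_lt_top

theorem hasCompactSupport (h : IsSliceFamily R g) (ξ : ℝ) : HasCompactSupport fun t => g t ξ := by
  refine HasCompactSupport.of_support_subset_isCompact (isCompact_Icc (a := -R) (b := R)) ?_
  intro t ht
  by_contra hn
  exact ht (h.eq_zero t ξ (not_le.1 fun h' => hn (abs_le.1 h')))

theorem trunc (h : IsSliceFamily R g) (N : ℝ) : IsSliceFamily R (truncFreq N g) where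
  measurable := by
    have e : Function.uncurry (truncFreq N g)
        = {p : ℝ × ℝ | |2 * Real.pi * p.2| ≤ N}.indicator (Function.uncurry g) := by
      ext p
      simp only [Function.uncurry, truncFreq, indicator, mem_ofPred_eq]
    rw [e]
    exact h.measurable.indicator (measurableSet_le (by fun_prop) (by fun_prop))
  lintegral_lt_top := (lintegral_mono fun t => lintegral_mono fun ξ =>
    enorm_indicator_le_enorm_self _ _).trans_lt h.lintegral_lt_top
  lintegral_sq_lt_top := (lintegral_mono fun t => lintegral_mono fun ξ => pow_le_pow_left₀
    zero_le (enorm_indicator_le_enorm_self _ _) 2).trans_lt h.lintegral_sq_lt_top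
  continuous ξ := by
    by_cases hξ : |2 * Real.pi * ξ| ≤ N
    · simpa only [truncFreq, indicator, mem_ofPred_eq, hξ, if_true] using h.continuous ξ
    · simpa only [truncFreq, indicator, mem_ofPred_eq, hξ, if_false] using continuous_const
  eq_zero t ξ ht := by
    simp [truncFreq, indicator, h.eq_zero t ξ ht]

theorem dilate (h : IsSliceFamily R g) {l : ℝ} (hl : 0 < l) :
    IsSliceFamily (R / l ^ 2) (dilateFreq l g) where
  measurable := h.measurable.comp
    (by fun_prop : Measurable fun p : ℝ × ℝ => (l ^ 2 * p.1, l⁻¹ * p.2))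
  lintegral_lt_top := by
    have := lintegral_lintegral_comp_mul (fun t ξ => ‖g t ξ‖ₑ)
      (pow_pos hl 2).ne' (inv_pos.2 hl).ne'
    simp only [dilateFreq, this]
    exact ENNReal.mul_lt_top (by finiteness) h.lintegral_lt_top
  lintegral_sq_lt_top := by
    have := lintegral_lintegral_comp_mul (fun t ξ => ‖g t ξ‖ₑ ^ 2)
      (pow_pos hl 2).ne' (inv_pos.2 hl).ne'
    simp only [dilateFreq, this]
    exact ENNReal.mul_lt_top (by finiteness) h.lintegral_sq_lt_top
  continuous ξ := (h.continuous (l⁻¹ * ξ)).comp (by fun_prop)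
  eq_zero t ξ ht := by
    refine h.eq_zero _ _ ?_
    rw [div_lt_iff₀ (by positivity)] at ht
    rw [abs_mul, abs_of_pos (by positivity), mul_comm]
    exact ht

theorem localize (h : IsSliceFamily R g) {η : ℝ → ℂ} (hη : Continuous η)
    (hηc : HasCompactSupport η) (t₀ : ℝ) : IsSliceFamily R (localizeTime η t₀ g) := by
  obtain ⟨M, hM⟩ := hηc.exists_bound_of_continuous hη
  have hM' : ∀ t, ‖η t‖ₑ ≤ ENNReal.ofReal M := fun t => by
    rw [← ofReal_norm]
    exact ENNReal.ofReal_le_ofReal (hM t)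
  refine ⟨?_, ?_, ?_, fun ξ => ?_, fun t ξ ht => ?_⟩
  · have := hη.measurable
    exact ((by fun_prop : Measurable fun p : ℝ × ℝ => η (p.1 - t₀))).mul h.measurable
  · calc _ ≤ ∫⁻ t, ∫⁻ ξ, ENNReal.ofReal M * ‖g t ξ‖ₑ := by
          refine lintegral_mono fun t => lintegral_mono fun ξ => ?_
          rw [localizeTime, enorm_mul]
          gcongr
          exact hM' _
      _ = ENNReal.ofReal M * ∫⁻ t, ∫⁻ ξ, ‖g t ξ‖ₑ := by
          simp only [lintegral_const_mul' _ _ ENNReal.ofReal_ne_top]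
      _ < ∞ := ENNReal.mul_lt_top (by finiteness) h.lintegral_lt_top
  · calc _ ≤ ∫⁻ t, ∫⁻ ξ, ENNReal.ofReal M ^ 2 * ‖g t ξ‖ₑ ^ 2 := by
          refine lintegral_mono fun t => lintegral_mono fun ξ => ?_
          rw [localizeTime, enorm_mul, mul_pow]
          gcongr
          exact hM' _
      _ = ENNReal.ofReal M ^ 2 * ∫⁻ t, ∫⁻ ξ, ‖g t ξ‖ₑ ^ 2 := by
          simp only [lintegral_const_mul' _ _ (ENNReal.pow_ne_top ENNReal.ofReal_ne_top)]
      _ < ∞ := ENNReal.mul_lt_top (by finiteness) h.lintegral_sq_lt_top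
  · exact (hη.comp (by fun_prop)).mul (h.continuous ξ)
  · rw [localizeTime, h.eq_zero t ξ ht, mul_zero]

end IsSliceFamily

theorem timeFourier_trunc (N : ℝ) (g : ℝ → ℝ → ℂ) (τ ξ : ℝ) :
    timeFourier (truncFreq N g) τ ξ
      = {ξ : ℝ | |2 * Real.pi * ξ| ≤ N}.indicator (timeFourier g τ) ξ := by
  by_cases hξ : |2 * Real.pi * ξ| ≤ N
  · simp only [timeFourier, truncFreq, indicator, mem_ofPred_eq, hξ, if_true]
  · simp only [timeFourier, truncFreq, indicator, mem_ofPred_eq, hξ, if_false, Real.fourier_real_eq,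
      smul_zero, integral_zero]

theorem timeFourier_dilate {l : ℝ} (hl : 0 < l) (g : ℝ → ℝ → ℂ) (τ ξ : ℝ) :
    timeFourier (dilateFreq l g) τ ξ
      = ((l ^ 2)⁻¹ : ℝ) * timeFourier g ((l ^ 2)⁻¹ * τ) (l⁻¹ * ξ) := by
  have := Measure.integral_comp_mul_left
    (fun t => Real.fourierChar (-(t * ((l ^ 2)⁻¹ * τ))) • g t (l⁻¹ * ξ)) (l ^ 2)
  rw [abs_of_pos (by positivity)] at this
  rw [timeFourier, timeFourier, Real.fourier_real_eq, Real.fourier_real_eq, ← Complex.real_smul,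
    ← this]
  congr 1; ext t
  rw [dilateFreq]
  congr 3
  field_simp

theorem spaceInv_dilate {l : ℝ} (hl : 0 < l) (g : ℝ → ℝ → ℂ) (t x : ℝ) :
    spaceInv (dilateFreq l g) t x = l * spaceInv g (l ^ 2 * t) (l * x) := by
  have := Measure.integral_comp_mul_left
    (fun ξ => Real.fourierChar (l * x * ξ) • g (l ^ 2 * t) ξ) l⁻¹
  rw [inv_inv, abs_of_pos hl] at this
  rw [spaceInv, spaceInv, Real.fourierInv_eq, Real.fourierInv_eq, ← Complex.real_smul]
  simp only [RCLike.inner_apply, conj_trivial]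
  rw [← this]
  congr 1; ext ξ
  have e : l * x * (l⁻¹ * ξ) = x * ξ := by field_simp
  rw [dilateFreq, e]

theorem spaceInv_localize (η : ℝ → ℂ) (t₀ : ℝ) (g : ℝ → ℝ → ℂ) (t x : ℝ) :
    spaceInv (localizeTime η t₀ g) t x = η (t - t₀) * spaceInv g t x := by
  rw [spaceInv, spaceInv, Real.fourierInv_eq, Real.fourierInv_eq, ← integral_const_mul]
  congr 1; ext ξ
  simp only [localizeTime, Circle.smul_def, smul_eq_mul]
  ring

theorem IsSliceFamily.lpProj_spaceInv {R : ℝ} {g : ℝ → ℝ → ℂ} (h : IsSliceFamily R g) (N : ℝ) :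
    lpProj N (fun p => spaceInv g (p 0) (p 1))
      =ᵐ[volume] fun p => spaceInv (truncFreq N g) (p 0) (p 1) := by
  have hN := h.trunc N
  have e : {q : SpaceTime | |2 * Real.pi * q 1| ≤ N}.indicator
      (fourierL2 fun p : SpaceTime => spaceInv g (p 0) (p 1))
      =ᵐ[volume] fourierL2 fun p : SpaceTime => spaceInv (truncFreq N g) (p 0) (p 1) := by
    filter_upwards [fourierL2_spaceInv h.measurable h.integrable h.memLp,
      fourierL2_spaceInv hN.measurable hN.integrable hN.memLp] with q h1 h2
    rw [h2, timeFourier_trunc]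
    simp only [indicator, mem_ofPred_eq, h1]
  rw [lpProj, fourierInvL2_congr e]
  exact fourierInvL2_fourierL2 (memLp_spaceInv hN.measurable hN.integrable hN.memLp)

theorem quasiMeasurePreserving_const_mul {c : ℝ} (hc : c ≠ 0) :
    Measure.QuasiMeasurePreserving (fun x : ℝ => c * x) := by
  refine ⟨by fun_prop, ?_⟩
  rw [Real.map_volume_mul_left hc]
  exact Measure.smul_absolutelyContinuous

/-- `lpProj` is determined only almost everywhere, so composing it with the dilation requires null
sets to pull back to null sets. -/
theorem quasiMeasurePreserving_scale {l : ℝ} (hl : 0 < l) :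
    Measure.QuasiMeasurePreserving (fun p : SpaceTime => (!₂[l ^ 2 * p 0, l * p 1] : SpaceTime)) :=
  (measurePreserving_spaceTimeEquiv.symm _).quasiMeasurePreserving.comp
    ((MeasureTheory.QuasiMeasurePreserving.prodMap
      (quasiMeasurePreserving_const_mul (pow_pos hl 2).ne')
      (quasiMeasurePreserving_const_mul hl.ne')).comp
      measurePreserving_spaceTimeEquiv.quasiMeasurePreserving)

theorem IsSliceFamily.localized_scaled {R : ℝ} {g : ℝ → ℝ → ℂ} (h : IsSliceFamily R g)
    (η : ℝ → ℂ) (t₀ N : ℝ) {l : ℝ} (hl : 0 < l) :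
    (fun p : SpaceTime => η (p 0 - t₀) *
        scaleOp l (lpProj N fun p => spaceInv g (p 0) (p 1)) p)
      =ᵐ[volume] fun p => spaceInv (localizeTime η t₀ (dilateFreq l (truncFreq N g))) (p 0) (p 1) := by
  filter_upwards [(quasiMeasurePreserving_scale hl).ae_eq_comp (h.lpProj_spaceInv N)] with p hp
  rw [spaceInv_localize, spaceInv_dilate hl, scaleOp]
  congr 2

theorem IsSliceFamily.le_yNorm_sq {R : ℝ} {g : ℝ → ℝ → ℂ} (h : IsSliceFamily R g)
    {η : ℝ → ℂ} (hη : Continuous η) (hηc : HasCompactSupport η) (s b t₀ : ℝ) {N : ℝ} (hN : 1 ≤ N) :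
    ∫⁻ τ, ∫⁻ ξ, ‖timeFourier (localizeTime η t₀ (dilateFreq (N ^ (2 * s)) (truncFreq N g))) τ ξ‖ₑ ^ 2
        * jap (2 * b) (2 * Real.pi * τ + phase ξ)
      ≤ yNorm η s b (fun p => spaceInv g (p 0) (p 1)) ^ 2 := by
  have hl : 0 < N ^ (2 * s) := Real.rpow_pos_of_pos (by linarith) _
  have hh := ((h.trunc N).dilate hl).localize hη hηc t₀
  refine (le_xNorm_spaceInv_sq hh.measurable hh.integrable hh.memLp b).trans ?_
  rw [← xNorm_congr (h.localized_scaled η t₀ N hl)]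
  gcongr
  exact le_iSup_of_le t₀ (le_iSup₂_of_le N hN le_rfl)

theorem measurable_timeFourier_localizeTime {η : ℝ → ℂ} (hη : Continuous η) {g : ℝ → ℝ → ℂ}
    (hg : Measurable (Function.uncurry g)) :
    Measurable fun p : (ℝ × ℝ) × ℝ => timeFourier (localizeTime η p.1.1 g) p.1.2 p.2 := by
  have h : StronglyMeasurable (fun q : ((ℝ × ℝ) × ℝ) × ℝ =>
      (Real.fourierChar (-inner ℝ q.2 q.1.1.2) : ℂ) * (η (q.2 - q.1.1.1) * g q.2 q.1.2)) := by
    apply Measurable.stronglyMeasurable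
    apply Measurable.mul
    · exact (continuous_subtype_val.comp (Real.continuous_fourierChar.comp
        (by fun_prop))).measurable
    · exact (hη.comp (by fun_prop)).measurable.mul
        (hg.comp (by fun_prop : Measurable fun q : ((ℝ × ℝ) × ℝ) × ℝ => (q.2, q.1.2)))
  have := h.integral_prod_right' (ν := volume)
  refine (congrArg Measurable ?_).mp this.measurable
  ext p
  simp [timeFourier, localizeTime, Real.fourier_eq, Circle.smul_def]

theorem lintegral_rotate {K : ℝ → ℝ → ℝ → ℝ≥0∞}
    (hK : Measurable fun p : (ℝ × ℝ) × ℝ => K p.1.1 p.1.2 p.2) :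
    ∫⁻ x, ∫⁻ y, ∫⁻ z, K x y z = ∫⁻ z, ∫⁻ y, ∫⁻ x, K x y z := by
  have h1 : Measurable fun p : ℝ × ℝ => ∫⁻ z, K p.1 p.2 z := hK.lintegral_prod_right'
  have h2 : ∀ y, Measurable fun p : ℝ × ℝ => K p.1 y p.2 := fun y =>
    hK.comp (by fun_prop : Measurable fun p : ℝ × ℝ => ((p.1, y), p.2))
  have h3 : Measurable fun p : ℝ × ℝ => ∫⁻ x, K x p.1 p.2 :=
    Measurable.lintegral_prod_left' (f := fun q : ℝ × (ℝ × ℝ) => K q.1 q.2.1 q.2.2)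
      (hK.comp (by fun_prop : Measurable fun q : ℝ × (ℝ × ℝ) => ((q.1, q.2.1), q.2.2)))
  rw [lintegral_lintegral_swap h1.aemeasurable,
    lintegral_congr fun y => lintegral_lintegral_swap (h2 y).aemeasurable,
    lintegral_lintegral_swap h3.aemeasurable]

/-- Windows with $|t_0|>R_0+R$ miss the support of $h$, so integrating the uniform bound over $t_0$
costs only the length $2(R_0+R)$. -/
theorem IsSliceFamily.mul_lintegral_le {R : ℝ} {h : ℝ → ℝ → ℂ} (hh : IsSliceFamily R h)
    {η : ℝ → ℂ} (hη : Continuous η) (hηc : HasCompactSupport η) {R₀ : ℝ}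
    (hR : ∀ t, R₀ < |t| → η t = 0) {r : ℝ} (hr : 0 ≤ r) {A : ℝ≥0∞}
    (hA : ∀ t₀, ∫⁻ τ, ∫⁻ ξ, ‖timeFourier (localizeTime η t₀ h) τ ξ‖ₑ ^ 2
        * jap r (2 * Real.pi * τ + phase ξ) ≤ A) :
    (∫⁻ σ, ‖𝓕 η σ‖ₑ ^ 2 * jap (-r) (2 * Real.pi * σ)) *
        ∫⁻ ξ, ∫⁻ τ, ‖timeFourier h τ ξ‖ₑ ^ 2 * jap r (2 * Real.pi * τ + phase ξ)
      ≤ ENNReal.ofReal (2 ^ r) * (ENNReal.ofReal (2 * (R₀ + R)) * A) := by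
  have hph := continuous_phase.measurable
  have hm := measurable_timeFourier hh.measurable
  have hml := measurable_timeFourier_localizeTime hη hh.measurable
  have h1 : ∫⁻ t₀, ∫⁻ τ, ∫⁻ ξ, ‖timeFourier (localizeTime η t₀ h) τ ξ‖ₑ ^ 2
        * jap r (2 * Real.pi * τ + phase ξ) ≤ ENNReal.ofReal (2 * (R₀ + R)) * A := by
    calc _ ≤ ∫⁻ t₀, (Icc (-(R₀ + R)) (R₀ + R)).indicator (fun _ => A) t₀ := by
          refine lintegral_mono fun t₀ => ?_
          by_cases ht : t₀ ∈ Icc (-(R₀ + R)) (R₀ + R)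
          · rw [indicator_of_mem ht]
            exact hA t₀
          · have h0 : ∀ t ξ, localizeTime η t₀ h t ξ = 0 := by
              intro t ξ
              rw [localizeTime]
              by_cases h2 : R < |t|
              · rw [hh.eq_zero t ξ h2, mul_zero]
              · rw [hR, zero_mul]
                by_contra h3
                refine ht (abs_le.1 ?_)
                have : |t₀| ≤ |t - t₀| + |t| := by
                  have := abs_sub_abs_le_abs_sub t₀ t
                  rw [abs_sub_comm] at this
                  linarith
                linarith
            simp [timeFourier, h0, Real.fourier_real_eq]
      _ = ENNReal.ofReal (2 * (R₀ + R)) * A := by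
          rw [lintegral_indicator measurableSet_Icc, setLIntegral_const, Real.volume_Icc, mul_comm]
          congr 2
          ring
  rw [lintegral_rotate (by fun_prop)] at h1
  calc _ = ∫⁻ ξ, (∫⁻ σ, ‖𝓕 η σ‖ₑ ^ 2 * jap (-r) (2 * Real.pi * σ)) *
        ∫⁻ τ, ‖timeFourier h τ ξ‖ₑ ^ 2 * jap r (2 * Real.pi * τ + phase ξ) := by
        rw [lintegral_const_mul _ (Measurable.lintegral_prod_left' (f := fun p : ℝ × ℝ =>
          ‖timeFourier h p.1 p.2‖ₑ ^ 2 * jap r (2 * Real.pi * p.1 + phase p.2)) (by fun_prop))]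
    _ ≤ ∫⁻ ξ, ENNReal.ofReal (2 ^ r) * ∫⁻ τ, ∫⁻ t₀, ‖timeFourier (localizeTime η t₀ h) τ ξ‖ₑ ^ 2
        * jap r (2 * Real.pi * τ + phase ξ) := by
        refine lintegral_mono fun ξ => (lintegral_localized_weighted_le hη hηc
          (hh.continuous ξ) (hh.hasCompactSupport ξ) hr (phase ξ)).trans ?_
        simp only [← lintegral_mul_const' _ _ (jap_ne_top _ _)]
        rfl
    _ = ENNReal.ofReal (2 ^ r) * ∫⁻ ξ, ∫⁻ τ, ∫⁻ t₀,
        ‖timeFourier (localizeTime η t₀ h) τ ξ‖ₑ ^ 2 * jap r (2 * Real.pi * τ + phase ξ) :=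
        lintegral_const_mul' _ _ ENNReal.ofReal_ne_top
    _ ≤ _ := by gcongr

theorem mul_jap_le_jap_mul {l : ℝ} (hl : 0 < l) (hl1 : l ≤ 1) {r : ℝ} (hr : 0 ≤ r) (θ : ℝ) :
    ENNReal.ofReal (l ^ r) * jap r θ ≤ jap r (l * θ) := by
  rw [jap, jap, ← ENNReal.ofReal_mul (by positivity), ← Real.mul_rpow hl.le (bracket_pos _).le]
  refine ENNReal.ofReal_le_ofReal (Real.rpow_le_rpow (mul_pos hl (bracket_pos _)).le ?_ hr)
  refine (abs_le_of_sq_le_sq' ?_ (bracket_pos _).le).2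
  rw [mul_pow, bracket_sq, bracket_sq]
  nlinarith

/-- The squared amplitude $l^{-4}$ and the Jacobian $l^3$ give $l^{-1}$. The modulation is
multiplied by $l^2\le1$, which lowers its weight by at most $(l^2)^r$. -/
theorem lintegral_timeFourier_dilateFreq_ge {g : ℝ → ℝ → ℂ} {l : ℝ} (hl : 0 < l) (hl1 : l ≤ 1)
    {r : ℝ} (hr : 0 ≤ r) :
    ENNReal.ofReal (l⁻¹ * (l ^ 2) ^ r) *
        ∫⁻ ξ, ∫⁻ τ, ‖timeFourier g τ ξ‖ₑ ^ 2 * jap r (2 * Real.pi * τ + phase ξ)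
      ≤ ∫⁻ ξ, ∫⁻ τ, ‖timeFourier (dilateFreq l g) τ ξ‖ₑ ^ 2
        * jap r (2 * Real.pi * τ + phase ξ) := by
  have hl2 : 0 < l ^ 2 := by positivity
  obtain ⟨k, hk⟩ : ∃ k : ℝ → ℝ → ℝ≥0∞, k = fun ξ τ => ENNReal.ofReal ((l ^ 2)⁻¹ ^ 2) *
    (‖timeFourier g τ ξ‖ₑ ^ 2 * jap r (l ^ 2 * (2 * Real.pi * τ + phase ξ))) := ⟨_, rfl⟩
  have e : ∀ ξ τ, ‖timeFourier (dilateFreq l g) τ ξ‖ₑ ^ 2 * jap r (2 * Real.pi * τ + phase ξ)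
      = k (l⁻¹ * ξ) ((l ^ 2)⁻¹ * τ) := by
    intro ξ τ
    have e1 : l ^ 2 * (2 * Real.pi * ((l ^ 2)⁻¹ * τ) + phase (l⁻¹ * ξ))
        = 2 * Real.pi * τ + phase ξ := by
      unfold phase
      field_simp
    rw [timeFourier_dilate hl, enorm_mul, mul_pow, hk]
    beta_reduce
    rw [e1, mul_assoc, ← ofReal_norm (((l ^ 2)⁻¹ : ℝ) : ℂ), Complex.norm_real,
      Real.norm_of_nonneg (by positivity), ENNReal.ofReal_pow (by positivity)]
  simp only [e]
  rw [lintegral_lintegral_comp_mul _ (inv_pos.2 hl).ne' (inv_pos.2 hl2).ne', inv_inv, inv_inv,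
    abs_of_pos hl, abs_of_pos hl2, hk, mul_assoc (ENNReal.ofReal l)]
  simp only [← lintegral_const_mul' _ _ ENNReal.ofReal_ne_top]
  refine lintegral_mono fun ξ => lintegral_mono fun τ => ?_
  calc ENNReal.ofReal (l⁻¹ * (l ^ 2) ^ r) *
        (‖timeFourier g τ ξ‖ₑ ^ 2 * jap r (2 * Real.pi * τ + phase ξ))
      = ENNReal.ofReal l * (ENNReal.ofReal (l ^ 2) * (ENNReal.ofReal ((l ^ 2)⁻¹ ^ 2) *
        (‖timeFourier g τ ξ‖ₑ ^ 2 *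
          (ENNReal.ofReal ((l ^ 2) ^ r) * jap r (2 * Real.pi * τ + phase ξ))))) := by
        have e2 : l⁻¹ * (l ^ 2) ^ r = l * (l ^ 2 * ((l ^ 2)⁻¹ ^ 2 * (l ^ 2) ^ r)) := by
          field_simp
        rw [e2, ENNReal.ofReal_mul (by positivity), ENNReal.ofReal_mul (by positivity),
          ENNReal.ofReal_mul (by positivity)]
        ring
    _ ≤ _ := by
        gcongr
        exact mul_jap_le_jap_mul hl2 (pow_le_one₀ hl.le hl1) hr _

/-- With $l=N^{2s}$, undoing the dilation costs $l^{1-4b}$ and the number of unit windows in the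
dilated time support costs $l^{-2}$. The total is $l^{-1-4b}=N^{-2s(1+4b)}$. -/
theorem IsSliceFamily.mul_lintegral_truncFreq_le {R : ℝ} (hR0 : 0 ≤ R) {g : ℝ → ℝ → ℂ}
    (h : IsSliceFamily R g) {η : ℝ → ℂ} (hη : Continuous η) (hηc : HasCompactSupport η) {R₀ : ℝ}
    (hR₀ : 0 ≤ R₀) (hR : ∀ t, R₀ < |t| → η t = 0) {s b : ℝ} (hs : s ≤ 0) (hb : 0 ≤ b) {N : ℝ}
    (hN : 1 ≤ N) :
    (∫⁻ σ, ‖𝓕 η σ‖ₑ ^ 2 * jap (-(2 * b)) (2 * Real.pi * σ)) *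
        ∫⁻ ξ, ∫⁻ τ, ‖timeFourier (truncFreq N g) τ ξ‖ₑ ^ 2
          * jap (2 * b) (2 * Real.pi * τ + phase ξ)
      ≤ ENNReal.ofReal (2 ^ (2 * b) * (2 * (R₀ + R))) * ENNReal.ofReal (N ^ (-(2 * s) * (1 + 4 * b)))
        * yNorm η s b (fun p => spaceInv g (p 0) (p 1)) ^ 2 := by
  have hN0 : 0 < N := by linarith
  set l := N ^ (2 * s) with hl
  have hl0 : 0 < l := Real.rpow_pos_of_pos hN0 _
  have hl1 : l ≤ 1 := Real.rpow_le_one_of_one_le_of_nonpos hN (by linarith)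
  set Y := yNorm η s b (fun p => spaceInv g (p 0) (p 1))
  set c := ∫⁻ σ, ‖𝓕 η σ‖ₑ ^ 2 * jap (-(2 * b)) (2 * Real.pi * σ)
  set S := ∫⁻ ξ, ∫⁻ τ, ‖timeFourier (truncFreq N g) τ ξ‖ₑ ^ 2
          * jap (2 * b) (2 * Real.pi * τ + phase ξ)
  have h1 := ((h.trunc N).dilate hl0).mul_lintegral_le hη hηc hR (r := 2 * b) (by linarith)
    (fun t₀ => h.le_yNorm_sq hη hηc s b t₀ hN)
  have h2 := lintegral_timeFourier_dilateFreq_ge (g := truncFreq N g) hl0 hl1 (r := 2 * b)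
    (by linarith)
  have hp : 0 < l⁻¹ * (l ^ 2) ^ (2 * b) := by positivity
  have hfac : N ^ (-(2 * s) * (1 + 4 * b)) = (l⁻¹ * (l ^ 2) ^ (2 * b))⁻¹ * (l ^ 2)⁻¹ := by
    have e1 : (l⁻¹ * (l ^ 2) ^ (2 * b))⁻¹ * (l ^ 2)⁻¹ = l ^ (-1 - 4 * b) := by
      rw [mul_inv, inv_inv, ← Real.rpow_natCast l 2, ← Real.rpow_mul hl0.le,
        ← Real.rpow_neg hl0.le, ← Real.rpow_neg hl0.le]
      nth_rewrite 1 [← Real.rpow_one l]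
      rw [← Real.rpow_add hl0, ← Real.rpow_add hl0]
      congr 1
      push_cast
      ring
    rw [e1, hl, ← Real.rpow_mul hN0.le]
    congr 1
    ring
  calc c * S = ENNReal.ofReal ((l⁻¹ * (l ^ 2) ^ (2 * b))⁻¹) *
        (c * (ENNReal.ofReal (l⁻¹ * (l ^ 2) ^ (2 * b)) * S)) := by
        have : ENNReal.ofReal ((l⁻¹ * (l ^ 2) ^ (2 * b))⁻¹) *
            ENNReal.ofReal (l⁻¹ * (l ^ 2) ^ (2 * b)) = 1 := by
          rw [← ENNReal.ofReal_mul (by positivity), inv_mul_cancel₀ hp.ne', ENNReal.ofReal_one]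
        calc c * S = 1 * (c * S) := (one_mul _).symm
          _ = _ := by rw [← this]; ring
    _ ≤ ENNReal.ofReal ((l⁻¹ * (l ^ 2) ^ (2 * b))⁻¹) * (ENNReal.ofReal (2 ^ (2 * b)) *
        (ENNReal.ofReal (2 * (R₀ + R / l ^ 2)) * Y ^ 2)) := by
        refine mul_le_mul' le_rfl (le_trans (mul_le_mul' le_rfl h2) h1)
    _ ≤ ENNReal.ofReal ((l⁻¹ * (l ^ 2) ^ (2 * b))⁻¹) * (ENNReal.ofReal (2 ^ (2 * b)) *
        (ENNReal.ofReal (2 * (R₀ + R) * (l ^ 2)⁻¹) * Y ^ 2)) := by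
        refine mul_le_mul' le_rfl (mul_le_mul' le_rfl (mul_le_mul' (ENNReal.ofReal_le_ofReal ?_)
          le_rfl))
        -- Since $l\le1$, the window radius $R_0$ is also absorbed into the dilated length.
        have : 1 ≤ (l ^ 2)⁻¹ := (one_le_inv₀ (by positivity)).2 (pow_le_one₀ hl0.le hl1)
        rw [div_eq_mul_inv]
        nlinarith
    _ = _ := by
        rw [hfac, ENNReal.ofReal_mul (by positivity : 0 ≤ 2 * (R₀ + R)),
          ENNReal.ofReal_mul (by positivity : (0 : ℝ) ≤ 2 ^ (2 * b)),
          ENNReal.ofReal_mul (by positivity : 0 ≤ (l⁻¹ * (l ^ 2) ^ (2 * b))⁻¹)]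
        ring

/-- The single term with $2^n\le\langle x\rangle<2^{n+1}$ already suffices. The balls $|x|\le
2^{n+1}$ are those seen by $P_{<N}$ with $N=2^{n+1}$. -/
theorem jap_neg_le_tsum {a : ℝ} (ha : 0 ≤ a) (x : ℝ) :
    jap (-a) x ≤ ∑' n : ℕ, ENNReal.ofReal (2 ^ a * ((2 : ℝ) ^ (n + 1)) ^ (-a)) *
      {x : ℝ | |x| ≤ 2 ^ (n + 1)}.indicator 1 x := by
  obtain ⟨n, h1, h2⟩ := exists_nat_pow_near (one_le_bracket x) one_lt_two
  refine le_trans ?_ (ENNReal.le_tsum n)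
  have hx : x ∈ {x : ℝ | |x| ≤ 2 ^ (n + 1)} := (abs_le_bracket x).trans h2.le
  rw [indicator_of_mem hx, Pi.one_apply, mul_one]
  refine ENNReal.ofReal_le_ofReal ?_
  have e : (2 : ℝ) ^ a * ((2 : ℝ) ^ (n + 1)) ^ (-a) = ((2 : ℝ) ^ n) ^ (-a) := by
    rw [pow_succ, Real.mul_rpow (by positivity) two_pos.le, mul_left_comm, ← Real.rpow_add two_pos,
      add_neg_cancel, Real.rpow_zero, mul_one]
  rw [e]
  exact Real.rpow_le_rpow_of_nonpos (by positivity) h1 (by linarith)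

theorem tsum_rpow_two_lt_top {d : ℝ} (hd : d < 0) :
    ∑' n : ℕ, ENNReal.ofReal (((2 : ℝ) ^ (n + 1)) ^ d) < ∞ := by
  have e : ∀ n : ℕ, ENNReal.ofReal (((2 : ℝ) ^ (n + 1)) ^ d) = ENNReal.ofReal (2 ^ d) ^ (n + 1) := by
    intro n
    rw [← ENNReal.ofReal_pow (by positivity), ← Real.rpow_natCast, ← Real.rpow_mul two_pos.le,
      mul_comm, Real.rpow_mul two_pos.le, Real.rpow_natCast]
  simp only [e]
  have h1 : ENNReal.ofReal ((2 : ℝ) ^ d) < 1 := by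
    rw [← ENNReal.ofReal_one]
    exact (ENNReal.ofReal_lt_ofReal_iff one_pos).2 (Real.rpow_lt_one_of_one_lt_of_neg one_lt_two hd)
  rw [ENNReal.tsum_geometric_add_one]
  refine ENNReal.mul_lt_top ENNReal.ofReal_lt_top (ENNReal.inv_lt_top.2 (tsub_pos_of_lt h1))

/-- The `Y` norm controls a weighted `L²` norm of the space-time Fourier transform. -/
theorem exists_lintegral_timeFourier_le_yNorm {η : ℝ → ℂ} (hη : Continuous η)
    (hηc : HasCompactSupport η) (hη0 : η 0 ≠ 0) {R : ℝ} (hR0 : 0 ≤ R) {s b a : ℝ} (hs : s ≤ 0)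
    (hb : 0 ≤ b) (ha0 : 0 ≤ a) (ha : -s * (1 + 4 * b) < a) :
    ∃ C : ℝ≥0, ∀ g : ℝ → ℝ → ℂ, IsSliceFamily R g →
      ∫⁻ ξ, ∫⁻ τ, ‖timeFourier g τ ξ‖ₑ ^ 2 * jap (2 * b) (2 * Real.pi * τ + phase ξ) *
          jap (-(2 * a)) (2 * Real.pi * ξ)
        ≤ C * yNorm η s b (fun p => spaceInv g (p 0) (p 1)) ^ 2 := by
  have hph := continuous_phase.measurable
  obtain ⟨R₀, hR₀, hR⟩ : ∃ R₀ : ℝ, 0 ≤ R₀ ∧ ∀ t, R₀ < |t| → η t = 0 := by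
    obtain ⟨r, hr⟩ := hηc.isCompact.isBounded.subset_closedBall 0
    refine ⟨max r 0, le_max_right _ _, fun t ht => image_eq_zero_of_notMem_tsupport fun hmem => ?_⟩
    have := hr hmem
    rw [mem_closedBall_zero_iff, Real.norm_eq_abs] at this
    exact absurd ht (not_lt.2 (this.trans (le_max_left _ _)))
  set c := ∫⁻ σ, ‖𝓕 η σ‖ₑ ^ 2 * jap (-(2 * b)) (2 * Real.pi * σ) with hc
  have hc0 : c ≠ 0 := (lintegral_fourier_weighted_pos hη hηc hη0 (2 * b)).ne'
  have hct : c ≠ ∞ := by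
    refine ne_top_of_le_ne_top ?_ (lintegral_mono fun σ =>
      mul_le_of_le_one_right' (jap_le_one (by linarith) _) : c ≤ ∫⁻ σ, ‖𝓕 η σ‖ₑ ^ 2)
    rw [lintegral_fourier_sq (hη.memLp_of_hasCompactSupport hηc)
      (hη.integrable_of_hasCompactSupport hηc)]
    exact ((memLp_two_iff_lintegral hη.aestronglyMeasurable).1
      (hη.memLp_of_hasCompactSupport hηc)).ne
  set A := ENNReal.ofReal (2 ^ (2 * b) * (2 * (R₀ + R)))
  set D := ∑' n : ℕ, ENNReal.ofReal (((2 : ℝ) ^ (n + 1)) ^ (-(2 * a) + -(2 * s) * (1 + 4 * b)))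
  -- The dyadic sum is geometric exactly because $a>-s(1+4b)$.
  have hD : D < ∞ := tsum_rpow_two_lt_top (by linarith)
  set K := c⁻¹ * (ENNReal.ofReal (2 ^ (2 * a)) * A * D) with hK
  have hKt : K ≠ ∞ := ENNReal.mul_ne_top (ENNReal.inv_ne_top.2 hc0)
    (ENNReal.mul_ne_top (ENNReal.mul_ne_top ENNReal.ofReal_ne_top ENNReal.ofReal_ne_top) hD.ne)
  refine ⟨K.toNNReal, fun g hg => ?_⟩
  rw [ENNReal.coe_toNNReal hKt]
  set Y := yNorm η s b (fun p => spaceInv g (p 0) (p 1))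
  have hm := measurable_timeFourier hg.measurable
  set H : ℝ → ℝ≥0∞ := fun ξ => ∫⁻ τ, ‖timeFourier g τ ξ‖ₑ ^ 2 *
    jap (2 * b) (2 * Real.pi * τ + phase ξ) with hH
  have hHm : Measurable H := Measurable.lintegral_prod_left' (f := fun p : ℝ × ℝ =>
    ‖timeFourier g p.1 p.2‖ₑ ^ 2 * jap (2 * b) (2 * Real.pi * p.1 + phase p.2)) (by fun_prop)
  have hS : ∀ n : ℕ, c * ∫⁻ ξ, {x : ℝ | |x| ≤ 2 ^ (n + 1)}.indicator 1 (2 * Real.pi * ξ) * H ξ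
      ≤ A * ENNReal.ofReal (((2 : ℝ) ^ (n + 1)) ^ (-(2 * s) * (1 + 4 * b))) * Y ^ 2 := by
    intro n
    refine le_trans (le_of_eq ?_) (hg.mul_lintegral_truncFreq_le hR0 hη hηc hR₀ hR hs hb
      (one_le_pow₀ one_le_two))
    congr 1
    refine lintegral_congr fun ξ => ?_
    simp only [timeFourier_trunc]
    by_cases hξ : |2 * Real.pi * ξ| ≤ 2 ^ (n + 1)
    · simp only [indicator, mem_ofPred_eq, hξ, if_true, Pi.one_apply, one_mul, hH]
    · simp only [indicator, mem_ofPred_eq, hξ, if_false, zero_mul, enorm_zero, ne_eq,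
        OfNat.ofNat_ne_zero, not_false_eq_true, zero_pow, lintegral_zero]
  have hind : ∀ n : ℕ, Measurable fun ξ : ℝ =>
      {x : ℝ | |x| ≤ 2 ^ (n + 1)}.indicator (1 : ℝ → ℝ≥0∞) (2 * Real.pi * ξ) := fun n =>
    (measurable_one.indicator (measurableSet_le (by fun_prop) (by fun_prop))).comp (by fun_prop)
  calc _ = ∫⁻ ξ, jap (-(2 * a)) (2 * Real.pi * ξ) * H ξ := by
        refine lintegral_congr fun ξ => ?_
        rw [lintegral_mul_const' _ _ (jap_ne_top _ _), mul_comm]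
    _ ≤ ∫⁻ ξ, ∑' n : ℕ, ENNReal.ofReal (2 ^ (2 * a) * ((2 : ℝ) ^ (n + 1)) ^ (-(2 * a))) *
        ({x : ℝ | |x| ≤ 2 ^ (n + 1)}.indicator 1 (2 * Real.pi * ξ) * H ξ) := by
        refine lintegral_mono fun ξ => ?_
        simp only [← mul_assoc, ENNReal.tsum_mul_right]
        gcongr
        exact jap_neg_le_tsum (by linarith) _
    _ = ∑' n : ℕ, ENNReal.ofReal (2 ^ (2 * a) * ((2 : ℝ) ^ (n + 1)) ^ (-(2 * a))) *
        ∫⁻ ξ, ({x : ℝ | |x| ≤ 2 ^ (n + 1)}.indicator 1 (2 * Real.pi * ξ) * H ξ) := by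
        refine (lintegral_tsum fun n => (((hind n).mul hHm).const_mul _).aemeasurable).trans ?_
        congr 1; ext n
        exact lintegral_const_mul _ ((hind n).mul hHm)
    _ ≤ ∑' n : ℕ, ENNReal.ofReal (2 ^ (2 * a) * ((2 : ℝ) ^ (n + 1)) ^ (-(2 * a))) *
        (c⁻¹ * (A * ENNReal.ofReal (((2 : ℝ) ^ (n + 1)) ^ (-(2 * s) * (1 + 4 * b))) * Y ^ 2)) := by
        refine ENNReal.tsum_le_tsum fun n => ?_
        gcongr
        rw [← ENNReal.mul_le_iff_le_inv hc0 hct]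
        exact hS n
    _ = ∑' n : ℕ, c⁻¹ * (ENNReal.ofReal (2 ^ (2 * a)) * A) * Y ^ 2 *
        ENNReal.ofReal (((2 : ℝ) ^ (n + 1)) ^ (-(2 * a) + -(2 * s) * (1 + 4 * b))) := by
        congr 1; ext n
        rw [Real.rpow_add (by positivity), ENNReal.ofReal_mul (by positivity),
          ENNReal.ofReal_mul (by positivity)]
        ring
    _ = K * Y ^ 2 := by
        rw [ENNReal.tsum_mul_left, hK]
        ring

/-! ### Bounds for the symmetrized symbol. -/

/-- The function `(1 + x²)^s`. -/
noncomputable def bump (s x : ℝ) : ℝ := (1 + x ^ 2) ^ s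

theorem weight_eq_bump (s ξ : ℝ) : weight s ξ = bump s (2 * Real.pi * ξ) := by
  rw [weight, bump, bracket, Real.sqrt_eq_rpow, ← Real.rpow_mul (by positivity)]
  congr 1
  ring

theorem bump_eq_bracket (s x : ℝ) : bump s x = bracket x ^ (2 * s) := by
  rw [bump, bracket, Real.sqrt_eq_rpow, ← Real.rpow_mul (by positivity)]
  congr 1
  ring

/-- With $q=\langle x\rangle/\langle y\rangle\le1$, the difference is $\langle
x\rangle^{2s}(1-q^{-2s})$. As $0\le-2s\le1$, this is at most $1-q$, and the bracket is 1-Lipschitz.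
The gain is a full inverse power of the larger bracket. -/
theorem abs_bump_sub_le_aux {s x y : ℝ} (hs : -(1 / 2) ≤ s) (hs0 : s ≤ 0)
    (h : bracket x ≤ bracket y) : |bump s x - bump s y| ≤ |x - y| / bracket y := by
  have hx := bracket_pos x
  have hy := bracket_pos y
  have h1 : bump s y = bump s x * (bracket x / bracket y) ^ (-(2 * s)) := by
    rw [bump_eq_bracket, bump_eq_bracket, Real.div_rpow hx.le hy.le, Real.rpow_neg hx.le,
      Real.rpow_neg hy.le]
    have := (Real.rpow_pos_of_pos hx (2 * s)).ne'
    field_simp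
  have hq0 : 0 < bracket x / bracket y := div_pos hx hy
  have hq1 : bracket x / bracket y ≤ 1 := (div_le_one hy).2 h
  have h2 : bracket x / bracket y ≤ (bracket x / bracket y) ^ (-(2 * s)) := by
    conv_lhs => rw [← Real.rpow_one (bracket x / bracket y)]
    exact Real.rpow_le_rpow_of_exponent_ge hq0 hq1 (by linarith)
  have h3 : (bracket x / bracket y) ^ (-(2 * s)) ≤ 1 :=
    Real.rpow_le_one hq0.le hq1 (by linarith)
  have h4 : bump s x ≤ 1 := by
    rw [bump_eq_bracket]
    exact Real.rpow_le_one_of_one_le_of_nonpos (one_le_bracket _) (by linarith)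
  have h5 : 0 ≤ bump s x := by unfold bump; positivity
  have h6 : |bump s x - bump s y| ≤ 1 - bracket x / bracket y := by
    rw [h1, abs_of_nonneg (by nlinarith)]
    nlinarith
  refine h6.trans ?_
  rw [one_sub_div hy.ne']
  gcongr
  have := abs_bracket_sub_le y x
  rw [abs_sub_comm y x] at this
  exact (le_abs_self _).trans this

theorem abs_bump_sub_le {s x y : ℝ} (hs : -(1 / 2) ≤ s) (hs0 : s ≤ 0) :
    |bump s x - bump s y| ≤ |x - y| / max (bracket x) (bracket y) := by
  rcases le_total (bracket x) (bracket y) with h | h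
  · rw [max_eq_right h]
    exact abs_bump_sub_le_aux hs hs0 h
  · rw [max_eq_left h, abs_sub_comm, abs_sub_comm x]
    exact abs_bump_sub_le_aux hs hs0 h

/-- The derivative of `bump`. -/
noncomputable def bumpDeriv (s x : ℝ) : ℝ := 2 * s * x * (1 + x ^ 2) ^ (s - 1)

theorem hasDerivAt_one_add_sq_rpow (s x : ℝ) :
    HasDerivAt (fun x : ℝ => (1 + x ^ 2) ^ s) (2 * x * s * (1 + x ^ 2) ^ (s - 1)) x := by
  have h1 : HasDerivAt (fun x : ℝ => 1 + x ^ 2) (2 * x) x := by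
    simpa using (hasDerivAt_pow 2 x).const_add 1
  exact h1.rpow_const (Or.inl (by positivity))

theorem hasDerivAt_bump (s x : ℝ) : HasDerivAt (bump s) (bumpDeriv s x) x :=
  (hasDerivAt_one_add_sq_rpow s x).congr_deriv (by unfold bumpDeriv; ring)

theorem hasDerivAt_bumpDeriv (s x : ℝ) : HasDerivAt (bumpDeriv s)
    (2 * s * (1 + x ^ 2) ^ (s - 1) + 4 * s * (s - 1) * x ^ 2 * (1 + x ^ 2) ^ (s - 2)) x := by
  have h1 := ((hasDerivAt_id x).const_mul (2 * s)).mul (hasDerivAt_one_add_sq_rpow (s - 1) x)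
  refine h1.congr_deriv ?_
  simp only [id]
  rw [show s - 1 - 1 = s - 2 by ring]
  ring

theorem abs_bumpDeriv_deriv_le {s : ℝ} (hs : -(1 / 2) ≤ s) (hs0 : s ≤ 0) (x : ℝ) :
    |2 * s * (1 + x ^ 2) ^ (s - 1) + 4 * s * (s - 1) * x ^ 2 * (1 + x ^ 2) ^ (s - 2)|
      ≤ 4 / bracket x ^ 2 := by
  rw [bracket_sq]
  have hp : 0 < 1 + x ^ 2 := by positivity
  have h1 : (1 + x ^ 2) ^ (s - 1) = (1 + x ^ 2) ^ s / (1 + x ^ 2) := by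
    rw [Real.rpow_sub_one hp.ne']
  have h2 : (1 + x ^ 2) ^ (s - 2) = (1 + x ^ 2) ^ s / (1 + x ^ 2) ^ 2 := by
    rw [Real.rpow_sub hp, Real.rpow_ofNat]
  have h3 : (1 + x ^ 2) ^ s ≤ 1 :=
    Real.rpow_le_one_of_one_le_of_nonpos (by nlinarith) hs0
  have h4 : 0 < (1 + x ^ 2) ^ s := Real.rpow_pos_of_pos hp s
  have h5 : x ^ 2 / (1 + x ^ 2) ≤ 1 := (div_le_one hp).2 (by linarith)
  have h6 : 0 ≤ x ^ 2 / (1 + x ^ 2) := by positivity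
  have e : 2 * s * (1 + x ^ 2) ^ (s - 1) + 4 * s * (s - 1) * x ^ 2 * (1 + x ^ 2) ^ (s - 2)
      = ((1 + x ^ 2) ^ s * (2 * s + 4 * s * (s - 1) * (x ^ 2 / (1 + x ^ 2)))) / (1 + x ^ 2) := by
    rw [h1, h2]
    field_simp
  rw [e, abs_div, abs_of_pos hp]
  gcongr
  rw [abs_mul, abs_of_pos h4]
  set q := x ^ 2 / (1 + x ^ 2)
  have h8 : 0 ≤ s * (s - 1) := by nlinarith
  have h9 : s * (s - 1) ≤ 3 / 4 := by nlinarith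
  have h10 : 0 ≤ s * (s - 1) * q := by positivity
  have h11 : s * (s - 1) * q ≤ 3 / 4 := by nlinarith
  have h7 : |2 * s + 4 * s * (s - 1) * q| ≤ 4 := by
    rw [abs_le]
    constructor <;> nlinarith
  calc _ ≤ 1 * |2 * s + 4 * s * (s - 1) * q| := by gcongr
    _ ≤ 4 := by linarith

/-- The second order mixed difference of `bump`. -/
noncomputable def mixedDiff (s X A B : ℝ) : ℝ :=
  bump s X - bump s (X - A) - bump s (X - B) + bump s (X - A - B)

/-- The mean value inequality is used twice, first for `bumpDeriv` over a step $A$ and then for the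
difference function over a step $B$. All points involved lie in the ball of radius $|A|+|B|$ about
$X$. -/
theorem abs_mixedDiff_le_of_bracket_ge {s : ℝ} (hs : -(1 / 2) ≤ s) (hs0 : s ≤ 0) (X A B : ℝ)
    {K : ℝ} (hK : 0 < K) (h : ∀ z, |z - X| ≤ |A| + |B| → K ≤ bracket z) :
    |mixedDiff s X A B| ≤ 4 / K ^ 2 * |A| * |B| := by
  set S : Set ℝ := Metric.closedBall X (|A| + |B|)
  have hS : Convex ℝ S := convex_closedBall _ _
  have hSm : ∀ z, z ∈ S ↔ |z - X| ≤ |A| + |B| := fun z => by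
    rw [Metric.mem_closedBall, Real.dist_eq]
  have h1 : ∀ y ∈ S, ∀ z ∈ S, |bumpDeriv s y - bumpDeriv s z| ≤ 4 / K ^ 2 * |y - z| := by
    intro y hy z hz
    refine hS.norm_image_sub_le_of_norm_hasDerivWithin_le
      (fun w _ => (hasDerivAt_bumpDeriv s w).hasDerivWithinAt) (fun w hw => ?_) hz hy
    refine (abs_bumpDeriv_deriv_le hs hs0 w).trans ?_
    have := h w ((hSm w).1 hw)
    gcongr
  set T : Set ℝ := Metric.closedBall X |B|
  have hT : Convex ℝ T := convex_closedBall _ _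
  have hTm : ∀ z, z ∈ T ↔ |z - X| ≤ |B| := fun z => by
    rw [Metric.mem_closedBall, Real.dist_eq]
  have h2 : ∀ y, HasDerivAt (fun y => bump s y - bump s (y - A))
      (bumpDeriv s y - bumpDeriv s (y - A)) y := fun y =>
    (hasDerivAt_bump s y).sub ((hasDerivAt_bump s (y - A)).comp_sub_const y A)
  have h3 := hT.norm_image_sub_le_of_norm_hasDerivWithin_le (C := 4 / K ^ 2 * |A|) (x := X - B)
    (y := X) (fun w _ => (h2 w).hasDerivWithinAt) (fun w hw => by
      have hw' := (hTm w).1 hw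
      have := h1 w ((hSm w).2 (by linarith [abs_nonneg A])) (w - A) ((hSm _).2 (by
        calc |w - A - X| = |(w - X) - A| := by ring_nf
          _ ≤ |w - X| + |A| := abs_sub _ _
          _ ≤ _ := by linarith))
      rwa [sub_sub_cancel] at this) ((hTm _).2 (by simp)) ((hTm _).2 (by simp))
  rw [Real.norm_eq_abs, Real.norm_eq_abs, sub_sub_cancel] at h3
  refine le_trans (le_of_eq ?_) h3
  rw [mixedDiff]
  congr 1
  rw [sub_right_comm X B A]
  ring

/-- If both steps are small compared with the largest bracket, second derivatives apply and all
brackets are comparable. Otherwise $|B|$ dominates the brackets, and two first differences over the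
shorter step $A$ suffice. -/
theorem abs_mixedDiff_le {s : ℝ} (hs : -(1 / 2) ≤ s) (hs0 : s ≤ 0) {X A B : ℝ} (hAB : |A| ≤ |B|) :
    |mixedDiff s X A B| ≤ 16 * |A| * |B| / (max (bracket X) (bracket (X - A)) *
      max (bracket (X - B)) (bracket (X - A - B))) := by
  set m₁ := max (bracket X) (bracket (X - A)) with hm₁
  set m₂ := max (bracket (X - B)) (bracket (X - A - B)) with hm₂
  have p₁ : 0 < m₁ := lt_max_of_lt_left (bracket_pos _)
  have p₂ : 0 < m₂ := lt_max_of_lt_left (bracket_pos _)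
  set M := max m₁ m₂ with hM
  have pM : 0 < M := lt_max_of_lt_left p₁
  by_cases hB : |B| < M / 8
  · have hp : ∃ q, |q - X| ≤ |A| + |B| ∧ bracket q = M := by
      have a0 := abs_nonneg A
      have b0 := abs_nonneg B
      rcases max_choice m₁ m₂ with e | e
      · rcases max_choice (bracket X) (bracket (X - A)) with e' | e'
        · exact ⟨X, by simp; linarith, by rw [hM, e, hm₁, e']⟩
        · exact ⟨X - A, by simp, by rw [hM, e, hm₁, e']⟩
      · rcases max_choice (bracket (X - B)) (bracket (X - A - B)) with e' | e'
        · exact ⟨X - B, by simp, by rw [hM, e, hm₂, e']⟩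
        · refine ⟨X - A - B, ?_, by rw [hM, e, hm₂, e']⟩
          calc |X - A - B - X| = |(-A) - B| := by ring_nf
            _ ≤ |-A| + |B| := abs_sub _ _
            _ = _ := by rw [abs_neg]
    obtain ⟨q, hq, hqM⟩ := hp
    -- Here $|A|+|B|\le2|B|<M/4$, so any such point is within $M/2$ of the one attaining the
    -- maximum. The constant 16 is $4/(1/2)^2$.
    have hK : ∀ z, |z - X| ≤ |A| + |B| → M / 2 ≤ bracket z := by
      intro z hz
      have h1 := (le_abs_self _).trans (abs_bracket_sub_le q z)
      have h2 : |q - z| ≤ |q - X| + |z - X| := by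
        calc |q - z| = |(q - X) - (z - X)| := by ring_nf
          _ ≤ _ := abs_sub _ _
      linarith
    refine (abs_mixedDiff_le_of_bracket_ge hs hs0 X A B (by positivity) hK).trans ?_
    have h3 : m₁ * m₂ ≤ M * M := by gcongr <;> simp [hM]
    calc 4 / (M / 2) ^ 2 * |A| * |B| = 16 * |A| * |B| / (M * M) := by field_simp; ring
      _ ≤ _ := by gcongr
  · rw [not_lt] at hB
    have h1 := abs_bump_sub_le (x := X) (y := X - A) hs hs0
    have h2 := abs_bump_sub_le (x := X - B) (y := X - A - B) hs hs0
    rw [sub_sub_cancel, ← hm₁] at h1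
    rw [show X - B - (X - A - B) = A by ring, ← hm₂] at h2
    have h3 : |mixedDiff s X A B| ≤ |A| / m₁ + |A| / m₂ := by
      have e : mixedDiff s X A B
        = (bump s X - bump s (X - A)) - (bump s (X - B) - bump s (X - A - B)) := by
        rw [mixedDiff]; ring
      rw [e]
      exact (abs_sub _ _).trans (add_le_add h1 h2)
    refine h3.trans ?_
    -- Both maxima are at most $M\le8|B|$ in this case.
    have h4 : m₁ + m₂ ≤ 16 * |B| := by
      have : m₁ ≤ M := le_max_left _ _
      have : m₂ ≤ M := le_max_right _ _
      linarith
    rw [div_add_div _ _ p₁.ne' p₂.ne']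
    gcongr
    nlinarith [abs_nonneg A]

theorem bracket_sub_le_two_mul_max (x y : ℝ) : bracket (x - y) ≤ 2 * max (bracket x) (bracket y) := by
  have h1 := bracket_add_le x (-y)
  rw [abs_neg, ← sub_eq_add_neg] at h1
  have := abs_le_bracket y
  have := le_max_left (bracket x) (bracket y)
  have := le_max_right (bracket x) (bracket y)
  linarith

/-- The four brackets multiply to at most $(m_1m_2)^2$, so the mixed difference bound still leaves
$(m_1m_2)^{-(1-2a)}$. This is converted to decay in $A$ and $B$ through $\langle A\rangle\langle
B\rangle\le4m_1m_2$. -/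
theorem abs_mixedDiff_mul_le_aux {s a : ℝ} (hs : -(1 / 2) ≤ s) (hs0 : s ≤ 0) (ha : 0 ≤ a)
    (ha2 : a ≤ 1 / 2) {X A B : ℝ} (hAB : |A| ≤ |B|) :
    |mixedDiff s X A B| * ((bracket X * bracket (X - A) * bracket (X - B) *
      bracket (X - A - B)) ^ a) ≤ 64 * |A| * |B| * (bracket A * bracket B) ^ (-(1 - 2 * a)) := by
  have hb := fun x => (bracket_pos x).le
  set m₁ := max (bracket X) (bracket (X - A)) with hm₁
  set m₂ := max (bracket (X - B)) (bracket (X - A - B)) with hm₂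
  have p₁ : 0 < m₁ := lt_max_of_lt_left (bracket_pos _)
  have p₂ : 0 < m₂ := lt_max_of_lt_left (bracket_pos _)
  have h1 : (bracket X * bracket (X - A) * bracket (X - B) * bracket (X - A - B)) ^ a
      ≤ (m₁ * m₂) ^ (2 * a) := by
    rw [Real.rpow_mul (by positivity), Real.rpow_two]
    refine Real.rpow_le_rpow (mul_nonneg (mul_nonneg (mul_nonneg (hb _) (hb _)) (hb _)) (hb _)) ?_ ha
    have i1 : bracket X * bracket (X - A) ≤ m₁ * m₁ :=
      mul_le_mul (le_max_left _ _) (le_max_right _ _) (hb _) p₁.le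
    have i2 : bracket (X - B) * bracket (X - A - B) ≤ m₂ * m₂ :=
      mul_le_mul (le_max_left _ _) (le_max_right _ _) (hb _) p₂.le
    calc _ = (bracket X * bracket (X - A)) * (bracket (X - B) * bracket (X - A - B)) := by ring
      _ ≤ (m₁ * m₁) * (m₂ * m₂) := mul_le_mul i1 i2 (mul_nonneg (hb _) (hb _)) (by positivity)
      _ = _ := by ring
  have hA1 : bracket A ≤ 2 * m₁ := by
    have := bracket_sub_le_two_mul_max X (X - A)
    rwa [sub_sub_cancel] at this
  have hA2 : bracket A ≤ 2 * m₂ := by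
    have := bracket_sub_le_two_mul_max (X - B) (X - A - B)
    rwa [show X - B - (X - A - B) = A by ring] at this
  have hB : bracket B ≤ 2 * max m₁ m₂ := by
    have := bracket_sub_le_two_mul_max X (X - B)
    rw [sub_sub_cancel] at this
    have h1 : max (bracket X) (bracket (X - B)) ≤ max m₁ m₂ :=
      max_le_max (le_max_left _ _) (le_max_left _ _)
    linarith
  -- Both $m_1$ and $m_2$ control $\langle A\rangle$, but only the larger one controls $\langle
  -- B\rangle$, so $A$ is paired with the smaller.
  have h2 : bracket A * bracket B ≤ 4 * (m₁ * m₂) := by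
    rcases le_total m₁ m₂ with h | h
    · rw [max_eq_right h] at hB
      nlinarith [bracket_pos A, bracket_pos B]
    · rw [max_eq_left h] at hB
      nlinarith [bracket_pos A, bracket_pos B]
  have pp : 0 < m₁ * m₂ := mul_pos p₁ p₂
  have pAB : 0 < bracket A * bracket B := mul_pos (bracket_pos _) (bracket_pos _)
  have h3 : (m₁ * m₂) ^ (-(1 - 2 * a)) ≤ 4 * (bracket A * bracket B) ^ (-(1 - 2 * a)) := by
    calc (m₁ * m₂) ^ (-(1 - 2 * a)) ≤ (bracket A * bracket B / 4) ^ (-(1 - 2 * a)) :=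
          Real.rpow_le_rpow_of_nonpos (by positivity) (by linarith) (by linarith)
      _ = (bracket A * bracket B) ^ (-(1 - 2 * a)) * 4 ^ (1 - 2 * a) := by
          rw [Real.div_rpow pAB.le (by norm_num), Real.rpow_neg (x := 4) (by norm_num), div_inv_eq_mul]
      _ ≤ (bracket A * bracket B) ^ (-(1 - 2 * a)) * 4 ^ (1 : ℝ) := by
          gcongr
          · norm_num
          · linarith
      _ = _ := by rw [Real.rpow_one, mul_comm]
  calc _ ≤ 16 * |A| * |B| / (m₁ * m₂) * (m₁ * m₂) ^ (2 * a) := by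
        have := abs_mixedDiff_le (X := X) hs hs0 hAB
        refine mul_le_mul this h1 (Real.rpow_nonneg (mul_nonneg (mul_nonneg (mul_nonneg (hb _)
          (hb _)) (hb _)) (hb _)) _) (by positivity)
    _ = 16 * |A| * |B| * (m₁ * m₂) ^ (-(1 - 2 * a)) := by
        rw [show -(1 - 2 * a) = 2 * a - 1 by ring, Real.rpow_sub_one pp.ne']
        ring
    _ ≤ 16 * |A| * |B| * (4 * (bracket A * bracket B) ^ (-(1 - 2 * a))) := by gcongr
    _ = _ := by ring

theorem abs_mixedDiff_mul_le {s a : ℝ} (hs : -(1 / 2) ≤ s) (hs0 : s ≤ 0) (ha : 0 ≤ a)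
    (ha2 : a ≤ 1 / 2) (X A B : ℝ) :
    |mixedDiff s X A B| * ((bracket X * bracket (X - A) * bracket (X - B) *
      bracket (X - A - B)) ^ a) ≤ 64 * |A| * |B| * (bracket A * bracket B) ^ (-(1 - 2 * a)) := by
  rcases le_total |A| |B| with h | h
  · exact abs_mixedDiff_mul_le_aux hs hs0 ha ha2 h
  · have := abs_mixedDiff_mul_le_aux (X := X) hs hs0 ha ha2 h
    have e : mixedDiff s X B A = mixedDiff s X A B := by
      rw [mixedDiff, mixedDiff, sub_right_comm X B A]
      ring
    rw [e, sub_right_comm X B A] at this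
    convert this using 1
    · ring_nf
    · ring_nf

theorem symbol_eq_mixedDiff (s : ℝ) (p) :
    symbol s p = mixedDiff s (2 * Real.pi * p.2) (2 * Real.pi * p.1.1) (2 * Real.pi * p.1.2) := by
  simp only [symbol, mixedDiff, weight_eq_bump]
  ring_nf

/-- The four frequencies of the quadrilinear form. -/
def freq (p : (ℝ × ℝ) × ℝ) : Fin 4 → ℝ := ![p.2, p.2 - p.1.1, p.2 - p.1.2, p.2 - p.1.1 - p.1.2]

/-- The weight controlling the symmetrized symbol. -/
noncomputable def crossWeight (θ : ℝ) (p : (ℝ × ℝ) × ℝ) : ℝ≥0∞ :=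
  ENNReal.ofReal |p.1.1 * p.1.2| * (jap (-θ) p.1.1 * jap (-θ) p.1.2)

theorem enorm_symbol_mul_le {s a : ℝ} (hs : -(1 / 2) ≤ s) (hs0 : s ≤ 0) (ha : 0 ≤ a)
    (ha2 : a ≤ 1 / 2) (p : (ℝ × ℝ) × ℝ) :
    ‖symbol s p‖ₑ * ∏ j, jap a (2 * Real.pi * freq p j)
      ≤ ENNReal.ofReal (256 * Real.pi ^ 2) * crossWeight (1 - 2 * a) p := by
  have hpi := Real.two_pi_pos
  have hb := fun x => (bracket_pos x).le
  have h1 := abs_mixedDiff_mul_le hs hs0 ha ha2 (2 * Real.pi * p.2) (2 * Real.pi * p.1.1)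
    (2 * Real.pi * p.1.2)
  have hle : ∀ x, bracket x ≤ bracket (2 * Real.pi * x) := fun x => bracket_le_bracket (by
    rw [abs_mul, abs_of_pos hpi]
    nlinarith [abs_nonneg x, Real.pi_gt_three])
  have h2 : (bracket (2 * Real.pi * p.1.1) * bracket (2 * Real.pi * p.1.2)) ^ (-(1 - 2 * a))
      ≤ bracket p.1.1 ^ (-(1 - 2 * a)) * bracket p.1.2 ^ (-(1 - 2 * a)) := by
    rw [← Real.mul_rpow (hb _) (hb _)]
    exact Real.rpow_le_rpow_of_nonpos (mul_pos (bracket_pos _) (bracket_pos _))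
      (mul_le_mul (hle _) (hle _) (hb _) (hb _)) (by linarith)
  have hr := fun x r => Real.rpow_nonneg (hb x) r
  have hL : ‖symbol s p‖ₑ * ∏ j, jap a (2 * Real.pi * freq p j)
      = ENNReal.ofReal (|mixedDiff s (2 * Real.pi * p.2) (2 * Real.pi * p.1.1)
        (2 * Real.pi * p.1.2)| * (bracket (2 * Real.pi * p.2) *
        bracket (2 * Real.pi * p.2 - 2 * Real.pi * p.1.1) *
        bracket (2 * Real.pi * p.2 - 2 * Real.pi * p.1.2) *
        bracket (2 * Real.pi * p.2 - 2 * Real.pi * p.1.1 - 2 * Real.pi * p.1.2)) ^ a) := by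
    rw [Real.mul_rpow (mul_nonneg (mul_nonneg (hb _) (hb _)) (hb _)) (hb _),
      Real.mul_rpow (mul_nonneg (hb _) (hb _)) (hb _), Real.mul_rpow (hb _) (hb _),
      ENNReal.ofReal_mul (abs_nonneg _),
      ENNReal.ofReal_mul (mul_nonneg (mul_nonneg (hr _ _) (hr _ _)) (hr _ _)),
      ENNReal.ofReal_mul (mul_nonneg (hr _ _) (hr _ _)), ENNReal.ofReal_mul (hr _ _),
      symbol_eq_mixedDiff, ← ofReal_norm, Real.norm_eq_abs, Fin.prod_univ_four]
    simp only [freq, Matrix.cons_val, jap, mul_sub]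
  have hR : ENNReal.ofReal (256 * Real.pi ^ 2) * crossWeight (1 - 2 * a) p
      = ENNReal.ofReal (256 * Real.pi ^ 2 * (|p.1.1 * p.1.2| *
        (bracket p.1.1 ^ (-(1 - 2 * a)) * bracket p.1.2 ^ (-(1 - 2 * a))))) := by
    rw [ENNReal.ofReal_mul (by positivity : 0 ≤ 256 * Real.pi ^ 2),
      ENNReal.ofReal_mul (abs_nonneg (p.1.1 * p.1.2)), ENNReal.ofReal_mul (hr _ _)]
    rfl
  rw [hL, hR]
  refine ENNReal.ofReal_le_ofReal (h1.trans ?_)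
  rw [abs_mul (2 * Real.pi), abs_mul (2 * Real.pi), abs_mul p.1.1, abs_of_pos hpi]
  calc _ ≤ 64 * (2 * Real.pi * |p.1.1|) * (2 * Real.pi * |p.1.2|) *
        (bracket p.1.1 ^ (-(1 - 2 * a)) * bracket p.1.2 ^ (-(1 - 2 * a))) := by gcongr
    _ = _ := by ring

/-! ### Multilinear estimates with resonance. -/

/-- The `L²` norm of an extended nonnegative function. -/
noncomputable def lnorm {X : Type*} [MeasurableSpace X] (μ : Measure X) (f : X → ℝ≥0∞) : ℝ≥0∞ :=
  (∫⁻ x, f x ^ 2 ∂μ) ^ (1 / 2 : ℝ)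

theorem rpow_half_sq (x : ℝ≥0∞) : (x ^ (1 / 2 : ℝ)) ^ 2 = x := by
  rw [← ENNReal.rpow_natCast, ← ENNReal.rpow_mul]
  norm_num

theorem rpow_half_le_of_le_sq {x y : ℝ≥0∞} (h : x ^ 2 ≤ y) : x ≤ y ^ (1 / 2 : ℝ) := by
  rw [← ENNReal.pow_le_pow_left_iff two_ne_zero, rpow_half_sq]
  exact h

theorem lnorm_sq {X : Type*} [MeasurableSpace X] (μ : Measure X) (f : X → ℝ≥0∞) :
    lnorm μ f ^ 2 = ∫⁻ x, f x ^ 2 ∂μ := rpow_half_sq _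

theorem lintegral_mul_le_lnorm {X : Type*} [MeasurableSpace X] {μ : Measure X} {f g : X → ℝ≥0∞}
    (hf : Measurable f) (hg : Measurable g) : ∫⁻ x, f x * g x ∂μ ≤ lnorm μ f * lnorm μ g := by
  rw [← ENNReal.pow_le_pow_left_iff two_ne_zero, mul_pow, lnorm_sq, lnorm_sq]
  exact lintegral_mul_sq_le hf.aemeasurable hg.aemeasurable

theorem ofReal_abs_le_jap {r : ℝ} (hr : 1 ≤ r) (x : ℝ) : ENNReal.ofReal |x| ≤ jap r x := by
  refine le_trans (ENNReal.ofReal_le_ofReal (abs_le_bracket x)) ?_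
  refine le_trans (le_of_eq ?_) (jap_mono hr x)
  rw [jap, Real.rpow_one]

theorem ofReal_abs_mul_jap_neg_le_one {r : ℝ} (hr : 1 ≤ r) (x : ℝ) :
    ENNReal.ofReal |x| * jap (-r) x ≤ 1 := by
  calc _ ≤ jap r x * jap (-r) x := by gcongr; exact ofReal_abs_le_jap hr x
    _ = 1 := by rw [jap_mul, add_neg_cancel, jap_zero]

theorem ofReal_abs_mul_jap_resonance_le (α β : ℝ) :
    ENNReal.ofReal |α * β| * jap (-1) (4 * Real.pi * (α * β)) ≤ 1 := by
  refine le_trans ?_ (ofReal_abs_mul_jap_neg_le_one le_rfl (4 * Real.pi * (α * β)))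
  refine mul_le_mul' (ENNReal.ofReal_le_ofReal ?_) le_rfl
  rw [abs_mul (4 * Real.pi), abs_of_pos (by positivity : 0 < 4 * Real.pi)]
  nlinarith [abs_nonneg (α * β), Real.pi_gt_three]

/-- The resonance function. -/
noncomputable def resonance (p : (ℝ × ℝ) × ℝ) : ℝ := 4 * Real.pi * (p.1.1 * p.1.2)

/-- Of the two factors $|\alpha\beta|$, one is cancelled by the resonance weight; in the other,
$|\beta|$ is cancelled by $\langle\beta\rangle^{-2\theta}$. The surviving $|\alpha|$ is the Jacobian
consumed by `lintegral_comp_resonance_le`. -/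
theorem crossWeight_sq_mul_le {θ : ℝ} (hθ : 1 / 2 < θ) (p : (ℝ × ℝ) × ℝ) :
    (crossWeight θ p * jap (-(1 / 2)) (resonance p)) ^ 2
      ≤ ENNReal.ofReal |p.1.1| * jap (-(2 * θ)) p.1.1 := by
  have h1 := ofReal_abs_mul_jap_resonance_le p.1.1 p.1.2
  have h2 := ofReal_abs_mul_jap_neg_le_one (r := 2 * θ) (by linarith) p.1.2
  calc (crossWeight θ p * jap (-(1 / 2)) (resonance p)) ^ 2
      = ENNReal.ofReal |p.1.1 * p.1.2| * ENNReal.ofReal |p.1.1 * p.1.2| *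
        (jap (-θ) p.1.1 ^ 2 * jap (-θ) p.1.2 ^ 2) * jap (-(1 / 2)) (resonance p) ^ 2 := by
        rw [crossWeight]; ring
    _ = (ENNReal.ofReal |p.1.1 * p.1.2| * jap (-1) (4 * Real.pi * (p.1.1 * p.1.2))) *
        (ENNReal.ofReal |p.1.2| * jap (-(2 * θ)) p.1.2) *
        (ENNReal.ofReal |p.1.1| * jap (-(2 * θ)) p.1.1) := by
        rw [jap_pow_two, jap_pow_two, jap_pow_two, resonance]
        norm_num
        ring
    _ ≤ 1 * 1 * (ENNReal.ofReal |p.1.1| * jap (-(2 * θ)) p.1.1) := by gcongr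
    _ = _ := by rw [one_mul, one_mul]

theorem measurable_crossWeight (θ : ℝ) : Measurable (crossWeight θ) := by
  unfold crossWeight
  fun_prop

theorem measurable_resonance : Measurable resonance := by
  unfold resonance
  fun_prop

theorem lintegral_comp_resonance_le (F : ℝ → ℝ≥0∞) (α c : ℝ) :
    ENNReal.ofReal |α| * ∫⁻ β, F (c + 4 * Real.pi * (α * β)) ≤ ∫⁻ y, F y := by
  by_cases hα : α = 0
  · simp [hα]
  have e : ∀ β, F (c + 4 * Real.pi * (α * β)) = (fun y => F (c + y)) (4 * Real.pi * α * β) :=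
    fun β => by ring_nf
  have hne : 4 * Real.pi * α ≠ 0 := by positivity
  simp only [e]
  rw [lintegral_comp_const_mul (fun y => F (c + y)) hne, lintegral_add_left_eq_self, ← mul_assoc,
    ← ENNReal.ofReal_mul (abs_nonneg _), ← abs_mul]
  refine mul_le_of_le_one_left' ?_
  rw [← ENNReal.ofReal_one]
  refine ENNReal.ofReal_le_ofReal ?_
  have : α * (4 * Real.pi * α)⁻¹ = (4 * Real.pi)⁻¹ := by field_simp
  rw [this, abs_of_pos (by positivity)]
  refine inv_le_one_of_one_le₀ ?_
  nlinarith [Real.pi_gt_three]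

section Multilinear

variable {G : ℝ → ℝ → ℝ≥0∞} {κ G₂ G₃ G₄ : ℝ → ℝ≥0∞} {θ : ℝ}

/-- Cauchy–Schwarz in $\beta$ for fixed $\alpha$ and $x$. The squared factor containing $G$ is
integrated in the resonance variable $4\pi\alpha\beta$, where smoothing by $\kappa$ is bounded on
$L^2$ by its mass. -/
theorem lintegral_kernel_le (hG : Measurable (Function.uncurry G)) (hκ : Measurable κ)
    (hG₃ : Measurable G₃) (hG₄ : Measurable G₄) (hθ : 1 / 2 < θ) (c α x : ℝ) :
    ∫⁻ β, crossWeight θ ((α, β), x) * jap (-(1 / 2)) (resonance ((α, β), x)) *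
        (∫⁻ σ, κ (σ - (c + resonance ((α, β), x))) * G σ x) * (G₃ (x - β) * G₄ (x - α - β))
      ≤ (∫⁻ y, κ y) * (jap (-θ) α * ((∫⁻ σ, G σ x ^ 2) ^ (1 / 2 : ℝ) *
        (∫⁻ y, G₃ y ^ 2 * G₄ (y - α) ^ 2) ^ (1 / 2 : ℝ))) := by
  have hcw := measurable_crossWeight θ
  have hres := measurable_resonance
  have hGx : Measurable fun σ => G σ x :=
    hG.comp (by fun_prop : Measurable fun σ : ℝ => (σ, x))
  have hI : Measurable fun β : ℝ => ∫⁻ σ, κ (σ - (c + resonance ((α, β), x))) * G σ x :=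
    Measurable.lintegral_prod_right'
      (f := fun q : ℝ × ℝ => κ (q.2 - (c + resonance ((α, q.1), x))) * G q.2 x) (by fun_prop)
  set k := ∫⁻ y, κ y with hk
  set E := ∫⁻ σ, G σ x ^ 2 with hE
  have hI2 : ∀ β, (∫⁻ σ, κ (σ - (c + resonance ((α, β), x))) * G σ x) ^ 2
      ≤ k * ∫⁻ σ, κ (σ - (c + resonance ((α, β), x))) * G σ x ^ 2 := by
    intro β
    have hs : ∀ y : ℝ≥0∞, y = y ^ (1 / 2 : ℝ) * y ^ (1 / 2 : ℝ) := fun y => by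
      rw [← sq, rpow_half_sq]
    calc (∫⁻ σ, κ (σ - (c + resonance ((α, β), x))) * G σ x) ^ 2
        = (∫⁻ σ, κ (σ - (c + resonance ((α, β), x))) ^ (1 / 2 : ℝ) *
          (κ (σ - (c + resonance ((α, β), x))) ^ (1 / 2 : ℝ) * G σ x)) ^ 2 := by
          simp only [← mul_assoc, ← hs]
      _ ≤ _ := lintegral_mul_sq_le (Measurable.aemeasurable (by fun_prop))
          (Measurable.aemeasurable (by fun_prop))
      _ = _ := by
          simp only [mul_pow, rpow_half_sq]
          congr 1
          exact lintegral_sub_right_eq_self κ _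
  have hJ : ∫⁻ β, (crossWeight θ ((α, β), x) * jap (-(1 / 2)) (resonance ((α, β), x)) *
        ∫⁻ σ, κ (σ - (c + resonance ((α, β), x))) * G σ x) ^ 2
      ≤ k ^ 2 * (jap (-(2 * θ)) α * E) := by
    calc _ ≤ ∫⁻ β, ENNReal.ofReal |α| * jap (-(2 * θ)) α *
          (k * ∫⁻ σ, κ (σ - (c + resonance ((α, β), x))) * G σ x ^ 2) := by
          refine lintegral_mono fun β => ?_
          rw [mul_pow]
          exact mul_le_mul' (crossWeight_sq_mul_le hθ ((α, β), x)) (hI2 β)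
      _ = jap (-(2 * θ)) α * (ENNReal.ofReal |α| *
          ∫⁻ β, k * ∫⁻ σ, κ (σ - (c + resonance ((α, β), x))) * G σ x ^ 2) := by
          rw [lintegral_const_mul' _ _ (ENNReal.mul_ne_top ENNReal.ofReal_ne_top (jap_ne_top _ _))]
          ring
      _ ≤ jap (-(2 * θ)) α * ∫⁻ y, k * ∫⁻ σ, κ (σ - y) * G σ x ^ 2 := by
          gcongr
          exact lintegral_comp_resonance_le (fun y => k * ∫⁻ σ, κ (σ - y) * G σ x ^ 2) α c
      _ = jap (-(2 * θ)) α * (k * (k * E)) := by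
          rw [lintegral_const_mul _ (Measurable.lintegral_prod_right'
            (f := fun q : ℝ × ℝ => κ (q.2 - q.1) * G q.2 x ^ 2) (by fun_prop)),
            lintegral_lintegral_swap (Measurable.aemeasurable (by fun_prop))]
          have : ∀ σ, ∫⁻ y, κ (σ - y) * G σ x ^ 2 = k * G σ x ^ 2 := fun σ => by
            rw [lintegral_mul_const _ (by fun_prop), lintegral_sub_left_eq_self κ σ]
          simp only [this]
          rw [lintegral_const_mul _ (by fun_prop)]
      _ = _ := by ring
  have hQ : ∫⁻ β, (G₃ (x - β) * G₄ (x - α - β)) ^ 2 = ∫⁻ y, G₃ y ^ 2 * G₄ (y - α) ^ 2 := by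
    rw [← lintegral_sub_left_eq_self (fun y => G₃ y ^ 2 * G₄ (y - α) ^ 2) x]
    refine lintegral_congr fun β => ?_
    rw [mul_pow, sub_right_comm]
  refine (lintegral_mul_le_lnorm (by fun_prop) (by fun_prop)).trans ?_
  have e1 : jap (-(2 * θ)) α ^ (1 / 2 : ℝ) = jap (-θ) α := by
    rw [show -(2 * θ) = 2 * (-θ) by ring, ← jap_pow_two, ← ENNReal.rpow_natCast, ← ENNReal.rpow_mul]
    norm_num
  have e2 : (k ^ 2) ^ (1 / 2 : ℝ) = k := by
    rw [← ENNReal.rpow_natCast, ← ENNReal.rpow_mul]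
    norm_num
  calc _ ≤ (k ^ 2 * (jap (-(2 * θ)) α * E)) ^ (1 / 2 : ℝ) *
        (∫⁻ y, G₃ y ^ 2 * G₄ (y - α) ^ 2) ^ (1 / 2 : ℝ) := by
        rw [lnorm, lnorm, hQ]
        gcongr
    _ = _ := by
        rw [ENNReal.mul_rpow_of_nonneg _ _ (by norm_num), ENNReal.mul_rpow_of_nonneg _ _
          (by norm_num), e1, e2]
        ring

theorem lintegral_vol3 {F : (ℝ × ℝ) × ℝ → ℝ≥0∞} (hF : Measurable F) :
    ∫⁻ p, F p ∂vol3 = ∫⁻ α, ∫⁻ x, ∫⁻ β, F ((α, β), x) := by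
  rw [lintegral_prod _ hF.aemeasurable, lintegral_prod _ hF.lintegral_prod_right'.aemeasurable]
  refine lintegral_congr fun α => ?_
  exact lintegral_lintegral_swap (f := fun β x => F ((α, β), x)) (hF.comp
    (by fun_prop : Measurable fun q : ℝ × ℝ => ((α, q.1), q.2))).aemeasurable

/-- The constant in the trilinear kernel estimate. -/
noncomputable def kernelConst (κ : ℝ → ℝ≥0∞) (θ : ℝ) : ℝ≥0∞ :=
  (∫⁻ y, κ y) * lnorm volume (jap (-θ))

/-- After the $\beta$ integration, Cauchy–Schwarz in $x$ separates $G$ from $G_2$. Cauchy–Schwarz in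
$\alpha$ then separates $\langle\alpha\rangle^{-\theta}$, square integrable for $\theta>1/2$, from
the autocorrelation of $G_3^2$ and $G_4^2$. -/
theorem lintegral_kernel_mul_le (hG : Measurable (Function.uncurry G)) (hκ : Measurable κ)
    (hG₂ : Measurable G₂) (hG₃ : Measurable G₃) (hG₄ : Measurable G₄) (hθ : 1 / 2 < θ) (c : ℝ) :
    ∫⁻ p, crossWeight θ p * jap (-(1 / 2)) (resonance p) *
        (∫⁻ σ, κ (σ - (c + resonance p)) * G σ p.2) *
        (G₂ (p.2 - p.1.1) * (G₃ (p.2 - p.1.2) * G₄ (p.2 - p.1.1 - p.1.2))) ∂vol3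
      ≤ kernelConst κ θ * (lnorm (volume.prod volume) (Function.uncurry G) *
        (lnorm volume G₂ * (lnorm volume G₃ * lnorm volume G₄))) := by
  have hcw := measurable_crossWeight θ
  have hres := measurable_resonance
  have hI : Measurable fun p : (ℝ × ℝ) × ℝ => ∫⁻ σ, κ (σ - (c + resonance p)) * G σ p.2 :=
    Measurable.lintegral_prod_right'
      (f := fun q : ((ℝ × ℝ) × ℝ) × ℝ => κ (q.2 - (c + resonance q.1)) * G q.2 q.1.2) (by fun_prop)
  have hm : Measurable fun p : (ℝ × ℝ) × ℝ => crossWeight θ p * jap (-(1 / 2)) (resonance p) *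
        (∫⁻ σ, κ (σ - (c + resonance p)) * G σ p.2) *
        (G₂ (p.2 - p.1.1) * (G₃ (p.2 - p.1.2) * G₄ (p.2 - p.1.1 - p.1.2))) := by fun_prop
  set E : ℝ → ℝ≥0∞ := fun x => ∫⁻ σ, G σ x ^ 2 with hE
  have hEm : Measurable E := Measurable.lintegral_prod_left' (f := fun q : ℝ × ℝ => G q.1 q.2 ^ 2)
    (by fun_prop)
  set Q : ℝ → ℝ≥0∞ := fun α => ∫⁻ y, G₃ y ^ 2 * G₄ (y - α) ^ 2 with hQ
  have hQm : Measurable Q := Measurable.lintegral_prod_right'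
    (f := fun q : ℝ × ℝ => G₃ q.2 ^ 2 * G₄ (q.2 - q.1) ^ 2) (by fun_prop)
  set k := ∫⁻ y, κ y with hk
  have hE2 : lnorm volume (fun x => E x ^ (1 / 2 : ℝ))
      = lnorm (volume.prod volume) (Function.uncurry G) := by
    rw [lnorm, lnorm]
    simp only [rpow_half_sq]
    rw [lintegral_prod_symm _ (Measurable.aemeasurable (by fun_prop))]
    rfl
  have hQ2 : lnorm volume (fun x => Q x ^ (1 / 2 : ℝ)) = lnorm volume G₃ * lnorm volume G₄ := by
    rw [lnorm, lnorm, lnorm, ← ENNReal.mul_rpow_of_nonneg _ _ (by norm_num)]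
    simp only [rpow_half_sq, hQ]
    rw [lintegral_lintegral_swap (Measurable.aemeasurable (by fun_prop)),
      ← lintegral_mul_const _ (by fun_prop)]
    congr 1
    refine lintegral_congr fun y => ?_
    rw [lintegral_const_mul _ (by fun_prop), lintegral_sub_left_eq_self (fun z => G₄ z ^ 2) y]
  rw [lintegral_vol3 hm]
  calc _ ≤ ∫⁻ α, ∫⁻ x, k * (jap (-θ) α * Q α ^ (1 / 2 : ℝ)) *
        (G₂ (x - α) * E x ^ (1 / 2 : ℝ)) := by
        refine lintegral_mono fun α => lintegral_mono fun x => ?_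
        calc _ = G₂ (x - α) * ∫⁻ β, crossWeight θ ((α, β), x) *
              jap (-(1 / 2)) (resonance ((α, β), x)) *
              (∫⁻ σ, κ (σ - (c + resonance ((α, β), x))) * G σ x) *
              (G₃ (x - β) * G₄ (x - α - β)) := by
              have hIα : Measurable fun β : ℝ =>
                  ∫⁻ σ, κ (σ - (c + resonance ((α, β), x))) * G σ x :=
                hI.comp (by fun_prop : Measurable fun β : ℝ => ((α, β), x))
              rw [← lintegral_const_mul _ (by fun_prop)]
              refine lintegral_congr fun β => ?_
              ring
          _ ≤ G₂ (x - α) * (k * (jap (-θ) α * (E x ^ (1 / 2 : ℝ) * Q α ^ (1 / 2 : ℝ)))) := by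
              gcongr
              exact lintegral_kernel_le hG hκ hG₃ hG₄ hθ c α x
          _ = _ := by ring
    _ ≤ ∫⁻ α, k * (jap (-θ) α * Q α ^ (1 / 2 : ℝ)) *
        (lnorm volume G₂ * lnorm (volume.prod volume) (Function.uncurry G)) := by
        refine lintegral_mono fun α => ?_
        dsimp only
        rw [lintegral_const_mul _ (by fun_prop)]
        gcongr
        refine (lintegral_mul_le_lnorm (by fun_prop) (by fun_prop)).trans ?_
        rw [hE2]
        gcongr
        rw [lnorm, lnorm, lintegral_sub_right_eq_self (fun x => G₂ x ^ 2) α]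
    _ = k * (∫⁻ α, jap (-θ) α * Q α ^ (1 / 2 : ℝ)) *
        (lnorm volume G₂ * lnorm (volume.prod volume) (Function.uncurry G)) := by
        rw [lintegral_mul_const _ (by fun_prop), lintegral_const_mul _ (by fun_prop)]
    _ ≤ k * (lnorm volume (jap (-θ)) * (lnorm volume G₃ * lnorm volume G₄)) *
        (lnorm volume G₂ * lnorm (volume.prod volume) (Function.uncurry G)) := by
        gcongr
        refine (lintegral_mul_le_lnorm (by fun_prop) (by fun_prop)).trans ?_
        rw [hQ2]
    _ = _ := by
        rw [kernelConst]
        ring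

end Multilinear

/-- The signs in the resonance relation. -/
def sgn : Fin 4 → ℝ := ![1, -1, -1, 1]

theorem measurable_freq (j : Fin 4) : Measurable fun p => freq p j := by
  fin_cases j <;> simp only [freq] <;> simp <;> fun_prop

theorem lintegral_relabel_le {r : (ℝ × ℝ) × ℝ → (ℝ × ℝ) × ℝ} (hr : MeasurePreserving r vol3 vol3)
    (h : ∀ p, r (r p) = p) {F F' : (ℝ × ℝ) × ℝ → ℝ≥0∞} {C : ℝ≥0∞} (hF : ∀ p, F' p = F (r p))
    (hC : ∫⁻ p, F p ∂vol3 ≤ C) : ∫⁻ p, F' p ∂vol3 ≤ C := by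
  simp only [hF]
  rwa [lintegral_relabel hr h]

/-- A relabelling brings the factor with distinguished modulation to the first frequency. Two of the
relabellings flip the sign of the resonance, which is harmless as $\kappa$ is even. -/
theorem lintegral_kernel_freq_le {G : ℝ → ℝ → ℝ≥0∞} {κ : ℝ → ℝ≥0∞} {θ : ℝ}
    (hG : Measurable (Function.uncurry G)) (hκ : Measurable κ) (hκe : ∀ y, κ (-y) = κ y)
    (hθ : 1 / 2 < θ) (j : Fin 4) {g : Fin 3 → ℝ → ℝ≥0∞} (hg : ∀ i, Measurable (g i)) (c : ℝ) :
    ∫⁻ p, crossWeight θ p * jap (-(1 / 2)) (resonance p) *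
        (∫⁻ σ, κ (sgn j * σ + c - resonance p) * G σ (freq p j)) *
        (∏ i, g i (freq p (j.succAbove i))) ∂vol3
      ≤ kernelConst κ θ * (lnorm (volume.prod volume) (Function.uncurry G) *
        ∏ i, lnorm volume (g i)) := by
  have hneg : ∀ σ h : ℝ, κ (-σ + c - h) = κ (σ - (c + -h)) := fun σ h => by
    rw [← hκe]; congr 1; ring
  have hpos : ∀ σ h : ℝ, κ (σ + c - h) = κ (σ - (-c + h)) := fun σ h => by
    congr 1; ring
  fin_cases j
  · have h1 := lintegral_kernel_mul_le hG hκ (hg 0) (hg 1) (hg 2) hθ (-c)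
    have e4 : ∀ p, ∏ i, g i (freq p ((0 : Fin 4).succAbove i)) = g 0 (p.2 - p.1.1) *
        (g 1 (p.2 - p.1.2) * g 2 (p.2 - p.1.1 - p.1.2)) := fun p => by
      rw [Fin.prod_univ_three, mul_assoc]; rfl
    have e5 : ∀ σ, sgn 0 * σ = σ := fun σ => one_mul σ
    simp only [← hpos] at h1
    simp only [Fin.zero_eta, e4, e5, Fin.prod_univ_three, mul_assoc (lnorm volume (g 0))]
    exact h1
  · refine lintegral_relabel_le measurePreserving_relabel₁ relabel₁_relabel₁ (fun p => ?_)
      ((lintegral_kernel_mul_le hG hκ (hg 0) (hg 2) (hg 1) hθ c).trans_eq ?_)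
    · have e1 : resonance (relabel₁ p) = -resonance p := by simp [resonance, relabel₁]
      have e2 : crossWeight θ (relabel₁ p) = crossWeight θ p := by
        simp [crossWeight, relabel₁, jap_neg]
      have e3 : ∏ i, g i (freq p ((1 : Fin 4).succAbove i)) = g 0 p.2 *
          (g 1 (p.2 - p.1.2) * g 2 (p.2 - p.1.1 - p.1.2)) := by
        rw [Fin.prod_univ_three, mul_assoc]; rfl
      have e4 : ∀ σ, sgn 1 * σ = -σ := fun σ => neg_one_mul σ
      have e5 : freq p 1 = p.2 - p.1.1 := rfl
      simp only [Fin.mk_one, e3, e4, e5]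
      rw [e1, e2, jap_neg]
      simp only [← hneg]
      have h1 : p.2 - p.1.1 - -p.1.1 = p.2 := by ring
      simp only [relabel₁, h1]
      ring
    · rw [Fin.prod_univ_three]; ring
  · refine lintegral_relabel_le measurePreserving_relabel₃ relabel₃_relabel₃ (fun p => ?_)
      ((lintegral_kernel_mul_le hG hκ (hg 2) (hg 0) (hg 1) hθ c).trans_eq ?_)
    · have e1 : resonance (relabel₃ p) = -resonance p := by simp [resonance, relabel₃]
      have e2 : crossWeight θ (relabel₃ p) = crossWeight θ p := by
        simp [crossWeight, relabel₃, jap_neg]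
      have e3 : ∏ i, g i (freq p ((2 : Fin 4).succAbove i)) = g 0 p.2 *
          (g 1 (p.2 - p.1.1) * g 2 (p.2 - p.1.1 - p.1.2)) := by
        rw [Fin.prod_univ_three, mul_assoc]; rfl
      have e4 : ∀ σ, sgn 2 * σ = -σ := fun σ => neg_one_mul σ
      have e5 : freq p 2 = p.2 - p.1.2 := rfl
      simp only [Fin.reduceFinMk, e3, e4, e5]
      rw [e1, e2, jap_neg]
      simp only [← hneg]
      have h1 : p.2 - p.1.2 - -p.1.2 = p.2 := by ring
      have h2 : p.2 - p.1.2 - p.1.1 = p.2 - p.1.1 - p.1.2 := by ring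
      have h3 : p.2 - p.1.1 - p.1.2 - -p.1.2 = p.2 - p.1.1 := by ring
      simp only [relabel₃, h1, h2, h3]
      ring
    · rw [Fin.prod_univ_three]; ring
  · refine lintegral_relabel_le measurePreserving_relabel₂ relabel₂_relabel₂ (fun p => ?_)
      ((lintegral_kernel_mul_le hG hκ (hg 2) (hg 1) (hg 0) hθ (-c)).trans_eq ?_)
    · have e1 : resonance (relabel₂ p) = resonance p := by simp [resonance, relabel₂]
      have e2 : crossWeight θ (relabel₂ p) = crossWeight θ p := by
        simp [crossWeight, relabel₂, jap_neg]
      have e3 : ∏ i, g i (freq p ((3 : Fin 4).succAbove i)) = g 0 p.2 *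
          (g 1 (p.2 - p.1.1) * g 2 (p.2 - p.1.2)) := by
        rw [Fin.prod_univ_three, mul_assoc]; rfl
      have e4 : ∀ σ, sgn 3 * σ = σ := fun σ => one_mul σ
      have e5 : freq p 3 = p.2 - p.1.1 - p.1.2 := rfl
      simp only [Fin.reduceFinMk, e3, e4, e5]
      rw [e1, e2]
      simp only [← hpos]
      have h1 : p.2 - (p.1.1 + p.1.2) - -p.1.1 = p.2 - p.1.2 := by ring
      have h2 : p.2 - (p.1.1 + p.1.2) - -p.1.2 = p.2 - p.1.1 := by ring
      have h3 : p.2 - p.1.2 - -p.1.2 = p.2 := by ring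
      have h4 : p.2 - (p.1.1 + p.1.2) = p.2 - p.1.1 - p.1.2 := by ring
      simp only [relabel₂, h1, h2, h3]
      simp only [h4]
      ring
    · rw [Fin.prod_univ_three]; ring

theorem lintegral_pi_succ {n : ℕ} (j : Fin (n + 1)) {F : (Fin (n + 1) → ℝ) → ℝ≥0∞}
    (hF : Measurable F) :
    ∫⁻ σ, F σ = ∫⁻ τ : Fin n → ℝ, ∫⁻ a, F (j.insertNth a τ) := by
  have h := (volume_preserving_piFinSuccAbove (fun _ : Fin (n + 1) => ℝ) j).symm
  rw [← h.lintegral_comp_emb (MeasurableEquiv.measurableEmbedding _) F, Measure.volume_eq_prod]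
  exact lintegral_prod_symm _ (hF.comp (MeasurableEquiv.measurable _)).aemeasurable

theorem lintegral_pi_prod {n : ℕ} {f : Fin n → ℝ → ℝ≥0∞} (hf : ∀ i, Measurable (f i)) :
    ∫⁻ σ : Fin n → ℝ, ∏ i, f i (σ i) = ∏ i, ∫⁻ y, f i y := by
  induction n with
  | zero => simp [volume_pi]
  | succ n ih =>
    have h1 : Measurable fun σ : Fin (n + 1) → ℝ => ∏ i, f i (σ i) :=
      Finset.measurable_prod _ fun i _ => (hf i).comp (measurable_pi_apply i)
    have h2 : Measurable fun σ : Fin n → ℝ => ∏ i, f (Fin.succ i) (σ i) :=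
      Finset.measurable_prod _ fun i _ => (hf i.succ).comp (measurable_pi_apply i)
    rw [lintegral_pi_succ 0 h1, Fin.prod_univ_succ, ← ih fun i => hf i.succ,
      ← lintegral_const_mul _ h2]
    refine lintegral_congr fun τ => ?_
    rw [← lintegral_mul_const _ (hf 0)]
    refine lintegral_congr fun a => ?_
    rw [Fin.prod_univ_succ]
    simp

section

variable {G : ℝ → ℝ → ℝ≥0∞} {θ b : ℝ}

theorem lintegral_jap_mul_lnorm_le (hG : Measurable (Function.uncurry G)) :
    ∫⁻ τ, jap (-b) τ * lnorm volume (G τ)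
      ≤ lnorm volume (jap (-b)) * lnorm (volume.prod volume) (Function.uncurry G) := by
  have hm : Measurable fun τ => lnorm volume (G τ) :=
    (Measurable.lintegral_prod_right' (f := fun q : ℝ × ℝ => G q.1 q.2 ^ 2) (by fun_prop)).pow_const _
  refine (lintegral_mul_le_lnorm (by fun_prop) hm).trans (le_of_eq ?_)
  congr 1
  rw [lnorm, lnorm]
  simp only [lnorm_sq]
  rw [lintegral_prod _ (Measurable.aemeasurable (by fun_prop))]
  rfl

/-- The other three modulations are frozen and enter the kernel only as a translation. They are
integrated last, by Cauchy–Schwarz against $\langle\cdot\rangle^{-b}$; the distinguished modulation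
has spent its weight on the resonance. -/
theorem lintegral_single_modulation_le (hG : Measurable (Function.uncurry G))
    (hθ : 1 / 2 < θ) {κ : ℝ → ℝ≥0∞} (hκ : Measurable κ) (hκe : ∀ y, κ (-y) = κ y) (j : Fin 4) :
    ∫⁻ p, crossWeight θ p * jap (-(1 / 2)) (resonance p) *
        (∫⁻ σ : Fin 4 → ℝ, κ (∑ i, sgn i * σ i - resonance p) * G (σ j) (freq p j) *
          ∏ i, (jap (-b) (σ (j.succAbove i)) *
            G (σ (j.succAbove i)) (freq p (j.succAbove i)))) ∂vol3
      ≤ kernelConst κ θ * lnorm volume (jap (-b)) ^ 3 *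
        lnorm (volume.prod volume) (Function.uncurry G) ^ 4 := by
  have hcw := measurable_crossWeight θ
  have hres := measurable_resonance
  have hfr := measurable_freq
  have hm : Measurable fun q : ((ℝ × ℝ) × ℝ) × (Fin 4 → ℝ) =>
      κ (∑ i, sgn i * q.2 i - resonance q.1) * G (q.2 j) (freq q.1 j) *
          ∏ i, (jap (-b) (q.2 (j.succAbove i)) *
            G (q.2 (j.succAbove i)) (freq q.1 (j.succAbove i))) := by
    fun_prop
  have hm' : Measurable fun q : (((ℝ × ℝ) × ℝ) × (Fin 3 → ℝ)) × ℝ =>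
      κ (sgn j * q.2 + ∑ i, sgn (j.succAbove i) * q.1.2 i - resonance q.1.1) *
        G q.2 (freq q.1.1 j) := by
    fun_prop
  have hm2 : Measurable fun q : ((ℝ × ℝ) × ℝ) × (Fin 3 → ℝ) =>
      ∫⁻ a, κ (sgn j * a + ∑ i, sgn (j.succAbove i) * q.2 i - resonance q.1) *
        G a (freq q.1 j) := hm'.lintegral_prod_right'
  have e : ∀ p, ∫⁻ σ : Fin 4 → ℝ, κ (∑ i, sgn i * σ i - resonance p) * G (σ j) (freq p j) *
          ∏ i, (jap (-b) (σ (j.succAbove i)) *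
            G (σ (j.succAbove i)) (freq p (j.succAbove i)))
      = ∫⁻ τ : Fin 3 → ℝ, (∫⁻ a, κ (sgn j * a + ∑ i, sgn (j.succAbove i) * τ i - resonance p) *
        G a (freq p j)) * ∏ i, (jap (-b) (τ i) * G (τ i) (freq p (j.succAbove i))) := by
    intro p
    have hmp : Measurable fun σ : Fin 4 → ℝ => κ (∑ i, sgn i * σ i - resonance p) *
        G (σ j) (freq p j) * ∏ i, (jap (-b) (σ (j.succAbove i)) *
          G (σ (j.succAbove i)) (freq p (j.succAbove i))) :=
      hm.comp (measurable_const.prodMk measurable_id)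
    rw [lintegral_pi_succ j hmp]
    refine lintegral_congr fun τ => ?_
    simp only [Fin.insertNth_apply_same, Fin.insertNth_apply_succAbove,
      Fin.sum_univ_succAbove _ j]
    rw [lintegral_mul_const]
    fun_prop
  simp only [e]
  set L := lnorm (volume.prod volume) (Function.uncurry G)
  calc _ = ∫⁻ p, (∫⁻ τ : Fin 3 → ℝ, crossWeight θ p * jap (-(1 / 2)) (resonance p) *
        ((∫⁻ a, κ (sgn j * a + ∑ i, sgn (j.succAbove i) * τ i - resonance p) *
        G a (freq p j)) * ∏ i, (jap (-b) (τ i) * G (τ i) (freq p (j.succAbove i))))) ∂vol3 := by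
        refine lintegral_congr fun p => ?_
        rw [lintegral_const_mul]
        exact (hm2.comp (measurable_const.prodMk measurable_id)).mul (by fun_prop)
    _ = ∫⁻ τ : Fin 3 → ℝ, ∫⁻ p, crossWeight θ p * jap (-(1 / 2)) (resonance p) *
        ((∫⁻ a, κ (sgn j * a + ∑ i, sgn (j.succAbove i) * τ i - resonance p) *
        G a (freq p j)) * ∏ i, (jap (-b) (τ i) * G (τ i) (freq p (j.succAbove i)))) ∂vol3 := by
        refine lintegral_lintegral_swap (Measurable.aemeasurable ?_)
        have : Measurable fun q : ((ℝ × ℝ) × ℝ) × (Fin 3 → ℝ) =>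
          crossWeight θ q.1 * jap (-(1 / 2)) (resonance q.1) *
            ((∫⁻ a, κ (sgn j * a + ∑ i, sgn (j.succAbove i) * q.2 i - resonance q.1) *
              G a (freq q.1 j)) *
            ∏ i, (jap (-b) (q.2 i) * G (q.2 i) (freq q.1 (j.succAbove i)))) := by fun_prop
        exact this
    _ ≤ ∫⁻ τ : Fin 3 → ℝ, kernelConst κ θ * (L * ∏ i, (jap (-b) (τ i) * lnorm volume (G (τ i)))) := by
        refine lintegral_mono fun τ => ?_
        have h1 := lintegral_kernel_freq_le hG hκ hκe hθ j (g := fun i ξ => jap (-b) (τ i) * G (τ i) ξ)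
          (fun i => by fun_prop) (∑ i, sgn (j.succAbove i) * τ i)
        have h2 : ∀ i, lnorm volume (fun ξ => jap (-b) (τ i) * G (τ i) ξ)
            = jap (-b) (τ i) * lnorm volume (G (τ i)) := fun i => by
          rw [lnorm]
          simp only [mul_pow]
          rw [lintegral_const_mul' _ _ (ENNReal.pow_ne_top (jap_ne_top _ _)),
            ENNReal.mul_rpow_of_nonneg _ _ (by norm_num), ← ENNReal.rpow_natCast,
            ← ENNReal.rpow_mul]
          norm_num
          rfl
        simp only [h2] at h1
        refine le_trans (le_of_eq ?_) h1
        refine lintegral_congr fun p => ?_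
        rw [mul_assoc (crossWeight θ p * _)]
    _ = kernelConst κ θ * (L * ∏ _i : Fin 3, ∫⁻ τ, jap (-b) τ * lnorm volume (G τ)) := by
        have hmn : Measurable fun τ => jap (-b) τ * lnorm volume (G τ) :=
          (measurable_jap _).mul ((Measurable.lintegral_prod_right'
            (f := fun q : ℝ × ℝ => G q.1 q.2 ^ 2) (by fun_prop)).pow_const _)
        have hmp : Measurable fun τ : Fin 3 → ℝ =>
            ∏ i, (jap (-b) (τ i) * lnorm volume (G (τ i))) :=
          Finset.measurable_prod _ fun i _ => hmn.comp (measurable_pi_apply i)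
        rw [lintegral_const_mul _ (hmp.const_mul _), lintegral_const_mul _ hmp,
          ← lintegral_pi_prod fun _ => hmn]
    _ ≤ kernelConst κ θ * (L * ∏ _i : Fin 3, (lnorm volume (jap (-b)) * L)) := by
        gcongr
        exact lintegral_jap_mul_lnorm_le hG
    _ = _ := by
        rw [Fin.prod_univ_three]
        ring

end

theorem prod_freq (g : ℝ → ℝ≥0∞) (p : (ℝ × ℝ) × ℝ) : ∏ j, g (freq p j)
    = g p.2 * (g (p.2 - p.1.1) * (g (p.2 - p.1.2) * g (p.2 - p.1.1 - p.1.2))) := by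
  rw [Fin.prod_univ_four, mul_assoc, mul_assoc]
  rfl

/-- At fixed $\alpha$ the integral splits into two autocorrelations, each at most $\|g\|_2^2$. -/
theorem lintegral_weighted_prod_freq_le {w g : ℝ → ℝ≥0∞} (hw : Measurable w) (hg : Measurable g) :
    ∫⁻ p, w p.1.1 * ∏ j, g (freq p j) ∂vol3 ≤ (∫⁻ α, w α) * (∫⁻ x, g x ^ 2) ^ 2 := by
  simp only [prod_freq]
  rw [lintegral_vol3 (by fun_prop), ← lintegral_mul_const _ hw]
  refine lintegral_mono fun α => ?_
  have h1 : ∀ x, ∫⁻ β, w α * (g x * (g (x - α) * (g (x - β) * g (x - α - β))))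
      = w α * (g x * g (x - α)) * ∫⁻ y, g y * g (y - α) := by
    intro x
    rw [← lintegral_sub_left_eq_self (fun y => g y * g (y - α)) x,
      ← lintegral_const_mul _ (by fun_prop)]
    refine lintegral_congr fun β => ?_
    rw [sub_right_comm x β α]
    ring
  dsimp only
  simp only [h1]
  rw [lintegral_mul_const _ (by fun_prop), lintegral_const_mul _ (by fun_prop), mul_assoc, sq]
  exact mul_le_mul' le_rfl (mul_le_mul' (lintegral_mul_shift_le hg α) (lintegral_mul_shift_le hg α))

theorem measurePreserving_swap_params :
    MeasurePreserving (fun p : (ℝ × ℝ) × ℝ => ((p.1.2, p.1.1), p.2)) vol3 vol3 :=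
  (Measure.measurePreserving_swap (μ := (volume : Measure ℝ)) (ν := volume)).prod
    (MeasurePreserving.id volume)

theorem lintegral_weighted_prod_freq_le_swap {w g : ℝ → ℝ≥0∞} (hw : Measurable w)
    (hg : Measurable g) :
    ∫⁻ p, w p.1.2 * ∏ j, g (freq p j) ∂vol3 ≤ (∫⁻ α, w α) * (∫⁻ x, g x ^ 2) ^ 2 := by
  refine lintegral_relabel_le measurePreserving_swap_params (fun _ => rfl) (fun p => ?_)
    (lintegral_weighted_prod_freq_le hw hg)
  simp only [prod_freq]
  rw [sub_right_comm p.2 p.1.2 p.1.1, mul_left_comm (g (p.2 - p.1.1))]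

/-- A full inverse power of the resonance cancels $|\alpha\beta|$. The rest is split into weights in
one variable, integrable for $2\theta>1$. -/
theorem crossWeight_mul_jap_le (θ : ℝ) (p : (ℝ × ℝ) × ℝ) :
    crossWeight θ p * jap (-1) (resonance p) ≤ jap (-(2 * θ)) p.1.1 + jap (-(2 * θ)) p.1.2 := by
  calc crossWeight θ p * jap (-1) (resonance p)
      = (ENNReal.ofReal |p.1.1 * p.1.2| * jap (-1) (4 * Real.pi * (p.1.1 * p.1.2))) *
        (jap (-θ) p.1.1 * jap (-θ) p.1.2) := by
        rw [crossWeight, resonance]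
        ring
    _ ≤ 1 * (jap (-θ) p.1.1 * jap (-θ) p.1.2) := by
        gcongr
        exact ofReal_abs_mul_jap_resonance_le _ _
    _ ≤ jap (-θ) p.1.1 ^ 2 + jap (-θ) p.1.2 ^ 2 := by
        rw [one_mul]
        rcases le_total (jap (-θ) p.1.1) (jap (-θ) p.1.2) with h | h
        · refine le_add_left ?_
          rw [sq]
          gcongr
        · refine le_add_right ?_
          rw [sq]
          gcongr
    _ = _ := by
        rw [jap_pow_two, jap_pow_two, mul_neg]

section

variable {G : ℝ → ℝ → ℝ≥0∞} {θ b : ℝ}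

theorem lintegral_no_modulation_le (hG : Measurable (Function.uncurry G)) :
    ∫⁻ p, crossWeight θ p * jap (-1) (resonance p) *
        (∫⁻ σ : Fin 4 → ℝ, ∏ j, (jap (-b) (σ j) * G (σ j) (freq p j))) ∂vol3
      ≤ 2 * (∫⁻ α, jap (-(2 * θ)) α) * lnorm volume (jap (-b)) ^ 4 *
        lnorm (volume.prod volume) (Function.uncurry G) ^ 4 := by
  set g : ℝ → ℝ≥0∞ := fun ξ => ∫⁻ σ, jap (-b) σ * G σ ξ with hg
  have hgm : Measurable g := Measurable.lintegral_prod_left'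
    (f := fun q : ℝ × ℝ => jap (-b) q.1 * G q.1 q.2) (by fun_prop)
  have hfr := measurable_freq
  have e : ∀ p, ∫⁻ σ : Fin 4 → ℝ, ∏ j, (jap (-b) (σ j) * G (σ j) (freq p j))
      = ∏ j, g (freq p j) := fun p =>
    lintegral_pi_prod (f := fun j y => jap (-b) y * G y (freq p j)) fun j => by fun_prop
  have hg2 : ∫⁻ x, g x ^ 2 ≤ lnorm volume (jap (-b)) ^ 2 *
      lnorm (volume.prod volume) (Function.uncurry G) ^ 2 := by
    rw [lnorm_sq, lnorm_sq, lintegral_prod_symm _ (Measurable.aemeasurable (by fun_prop)),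
      ← lintegral_const_mul _ (Measurable.lintegral_prod_left'
        (f := fun q : ℝ × ℝ => Function.uncurry G q ^ 2) (by fun_prop))]
    refine lintegral_mono fun ξ => ?_
    exact lintegral_mul_sq_le (Measurable.aemeasurable (by fun_prop))
      (Measurable.aemeasurable (by fun_prop))
  simp only [e]
  calc _ ≤ ∫⁻ p, (jap (-(2 * θ)) p.1.1 * ∏ j, g (freq p j) +
        jap (-(2 * θ)) p.1.2 * ∏ j, g (freq p j)) ∂vol3 := by
        refine lintegral_mono fun p => ?_
        dsimp only
        rw [← add_mul]
        gcongr
        exact crossWeight_mul_jap_le θ p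
    _ = (∫⁻ p, jap (-(2 * θ)) p.1.1 * ∏ j, g (freq p j) ∂vol3) +
        ∫⁻ p, jap (-(2 * θ)) p.1.2 * ∏ j, g (freq p j) ∂vol3 :=
        lintegral_add_left (by fun_prop) _
    _ ≤ (∫⁻ α, jap (-(2 * θ)) α) * (∫⁻ x, g x ^ 2) ^ 2 +
        (∫⁻ α, jap (-(2 * θ)) α) * (∫⁻ x, g x ^ 2) ^ 2 :=
        add_le_add (lintegral_weighted_prod_freq_le (by fun_prop) hgm)
          (lintegral_weighted_prod_freq_le_swap (by fun_prop) hgm)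
    _ ≤ (∫⁻ α, jap (-(2 * θ)) α) * (lnorm volume (jap (-b)) ^ 2 *
          lnorm (volume.prod volume) (Function.uncurry G) ^ 2) ^ 2 +
        (∫⁻ α, jap (-(2 * θ)) α) * (lnorm volume (jap (-b)) ^ 2 *
          lnorm (volume.prod volume) (Function.uncurry G) ^ 2) ^ 2 := by gcongr
    _ = _ := by ring

end

theorem jap_neg_le_of_bracket_le {r x y : ℝ} (hr : 0 ≤ r) (hr1 : r ≤ 1)
    (h : bracket x ≤ 5 * bracket y) : jap (-r) y ≤ 5 * jap (-r) x := by
  rw [jap, jap, ← ENNReal.ofReal_ofNat, ← ENNReal.ofReal_mul (by norm_num)]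
  refine ENNReal.ofReal_le_ofReal ?_
  have hx := bracket_pos x
  calc bracket y ^ (-r) ≤ (bracket x / 5) ^ (-r) :=
        Real.rpow_le_rpow_of_nonpos (by positivity) (by linarith) (by linarith)
    _ = 5 ^ r * bracket x ^ (-r) := by
        rw [Real.div_rpow hx.le (by norm_num), Real.rpow_neg (x := 5) (by norm_num), div_inv_eq_mul,
          mul_comm]
    _ ≤ 5 ^ (1 : ℝ) * bracket x ^ (-r) := by
        gcongr
        norm_num
    _ = _ := by rw [Real.rpow_one]

theorem bracket_resonance_le (σ : Fin 4 → ℝ) (h : ℝ) :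
    bracket h ≤ bracket (∑ i, sgn i * σ i - h) + ∑ i, bracket (σ i) := by
  have e : ∑ i, sgn i * σ i = σ 0 - σ 1 - σ 2 + σ 3 := by
    rw [Fin.sum_univ_four]
    simp only [sgn, Matrix.cons_val]
    ring
  rw [e, Fin.sum_univ_four]
  have h1 := bracket_add_le (σ 0 - σ 1 - σ 2 + σ 3 - h) (-(σ 0 - σ 1 - σ 2 + σ 3))
  rw [show σ 0 - σ 1 - σ 2 + σ 3 - h + -(σ 0 - σ 1 - σ 2 + σ 3) = -h by ring, bracket_neg,
    abs_neg] at h1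
  have h2 : |σ 0 - σ 1 - σ 2 + σ 3| ≤ |σ 0| + |σ 1| + |σ 2| + |σ 3| := by
    have := abs_add_le (σ 0 - σ 1 - σ 2) (σ 3)
    have := abs_sub (σ 0 - σ 1) (σ 2)
    have := abs_sub (σ 0) (σ 1)
    linarith
  linarith [abs_le_bracket (σ 0), abs_le_bracket (σ 1), abs_le_bracket (σ 2), abs_le_bracket (σ 3)]

/-- One of the modulations dominates the resonance function. -/
theorem jap_neg_one_mul_prod_le {b : ℝ} (hb : b ∈ Ioo (1 / 2 : ℝ) 1) (σ : Fin 4 → ℝ) (h : ℝ)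
    (f : Fin 4 → ℝ≥0∞) :
    jap (-1) (∑ i, sgn i * σ i - h) * ∏ j, (jap (-b) (σ j) * f j)
      ≤ 5 * (jap (-1) h * ∏ j, (jap (-b) (σ j) * f j)) +
        ∑ j, 5 * (jap (-(1 / 2)) h * (jap (-(1 / 2 + b)) (∑ i, sgn i * σ i - h) * f j *
          ∏ i, (jap (-b) (σ (Fin.succAbove j i)) * f (Fin.succAbove j i)))) := by
  obtain ⟨hb1, hb2⟩ := hb
  set y := ∑ i, sgn i * σ i - h with hy
  by_cases hc : bracket h ≤ 5 * bracket y
  · refine le_add_right ?_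
    rw [← mul_assoc]
    gcongr
    exact jap_neg_le_of_bracket_le one_pos.le le_rfl hc
  · refine le_add_left ?_
    -- The bracket of $h$ is at most the sum of five brackets, so one of them is at least a fifth of
    -- it; the cutoff frequency $y$ has been excluded.
    have hj : ∃ j, bracket h ≤ 5 * bracket (σ j) := by
      by_contra! hn
      have := bracket_resonance_le σ h
      rw [← hy, Fin.sum_univ_four] at this
      linarith [hn 0, hn 1, hn 2, hn 3]
    obtain ⟨j, hj⟩ := hj
    refine le_trans ?_ (Finset.single_le_sum (f := fun j => 5 * (jap (-(1 / 2)) h *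
      (jap (-(1 / 2 + b)) y * f j *
        ∏ i, (jap (-b) (σ (Fin.succAbove j i)) * f (Fin.succAbove j i)))))
      (fun _ _ => zero_le) (Finset.mem_univ j))
    rw [Fin.prod_univ_succAbove _ j]
    have h1 : jap (-b) (σ j) ≤ 5 * jap (-b) h := jap_neg_le_of_bracket_le (by linarith) hb2.le hj
    -- The modulation gives $\langle h\rangle^{-b}$, more than the $\langle h\rangle^{-1/2}$
    -- required. The surplus $b-1/2$ is traded for decay in $y$, improving $\langle y\rangle^{-1}$
    -- to the integrable kernel $\langle y\rangle^{-(1/2+b)}$.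
    have h2 : jap (b - 1 / 2) y ≤ jap (b - 1 / 2) h := by
      rw [jap, jap]
      refine ENNReal.ofReal_le_ofReal (Real.rpow_le_rpow (bracket_pos _).le ?_ (by linarith))
      have := bracket_pos y
      linarith
    have h3 : jap (-1) y * jap (-b) (σ j) ≤ 5 * (jap (-(1 / 2)) h * jap (-(1 / 2 + b)) y) := by
      calc jap (-1) y * jap (-b) (σ j)
          = jap (-(1 / 2 + b)) y * jap (b - 1 / 2) y * jap (-b) (σ j) := by
            rw [jap_mul]
            ring_nf
        _ ≤ jap (-(1 / 2 + b)) y * jap (b - 1 / 2) h * (5 * jap (-b) h) := by gcongr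
        _ = 5 * ((jap (b - 1 / 2) h * jap (-b) h) * jap (-(1 / 2 + b)) y) := by ring
        _ = _ := by
            rw [jap_mul]
            ring_nf
    calc _ = (jap (-1) y * jap (-b) (σ j)) * (f j *
          ∏ i, (jap (-b) (σ (Fin.succAbove j i)) * f (Fin.succAbove j i))) := by ring
      _ ≤ 5 * (jap (-(1 / 2)) h * jap (-(1 / 2 + b)) y) * (f j *
          ∏ i, (jap (-b) (σ (Fin.succAbove j i)) * f (Fin.succAbove j i))) := by gcongr
      _ = _ := by ring

theorem lnorm_jap_lt_top {r : ℝ} (hr : 1 / 2 < r) : lnorm volume (jap (-r)) < ∞ := by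
  rw [lnorm]
  refine ENNReal.rpow_lt_top_of_nonneg (by norm_num) ?_
  simp only [jap_pow_two]
  exact (lintegral_jap_lt_top (by linarith)).ne

theorem lintegral_mul_lintegral_sum_le {X Y ι : Type*} [Fintype ι] [MeasurableSpace X]
    [MeasurableSpace Y] {μ : Measure X} {ν : Measure Y} [SFinite ν] {k : ℝ≥0∞}
    {c d e : X → ℝ≥0∞} {F A : X → Y → ℝ≥0∞} {B : ι → X → Y → ℝ≥0∞} (hc : Measurable c)
    (hd : Measurable d) (he : Measurable e) (hA : Measurable (Function.uncurry A))
    (hB : ∀ j, Measurable (Function.uncurry (B j)))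
    (hF : ∀ x y, F x y ≤ k * (d x * A x y) + ∑ j, k * (e x * B j x y)) :
    ∫⁻ x, c x * ∫⁻ y, F x y ∂ν ∂μ ≤ k * ∫⁻ x, c x * d x * ∫⁻ y, A x y ∂ν ∂μ +
      ∑ j, k * ∫⁻ x, c x * e x * ∫⁻ y, B j x y ∂ν ∂μ := by
  have hAi : Measurable fun x => ∫⁻ y, A x y ∂ν := hA.lintegral_prod_right'
  have hBi : ∀ j, Measurable fun x => ∫⁻ y, B j x y ∂ν := fun j => (hB j).lintegral_prod_right'
  have hAx : ∀ x, Measurable (A x) := fun x => hA.comp (measurable_const.prodMk measurable_id)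
  have hBx : ∀ j x, Measurable (B j x) := fun j x =>
    (hB j).comp (measurable_const.prodMk measurable_id)
  calc _ ≤ ∫⁻ x, (k * (c x * d x * ∫⁻ y, A x y ∂ν) +
        ∑ j, k * (c x * e x * ∫⁻ y, B j x y ∂ν)) ∂μ := by
        refine lintegral_mono fun x => ?_
        calc _ ≤ c x * ∫⁻ y, (k * (d x * A x y) + ∑ j, k * (e x * B j x y)) ∂ν :=
              mul_le_mul' le_rfl (lintegral_mono (hF x))
          _ = _ := by
              rw [lintegral_add_left (((hAx x).const_mul _).const_mul _), lintegral_finsetSum _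
                fun j _ => ((hBx j x).const_mul _).const_mul _, lintegral_const_mul _
                ((hAx x).const_mul _), lintegral_const_mul _ (hAx x), mul_add, Finset.mul_sum]
              congr 1
              · ring
              · refine Finset.sum_congr rfl fun j _ => ?_
                rw [lintegral_const_mul _ ((hBx j x).const_mul _), lintegral_const_mul _ (hBx j x)]
                ring
    _ = _ := by
        have h1 : Measurable fun x => c x * d x * ∫⁻ y, A x y ∂ν := (hc.mul hd).mul hAi
        have h2 : ∀ j, Measurable fun x => c x * e x * ∫⁻ y, B j x y ∂ν := fun j =>
          (hc.mul he).mul (hBi j)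
        rw [lintegral_add_left (h1.const_mul k), lintegral_finsetSum _
          fun j _ => (h2 j).const_mul k, lintegral_const_mul _ h1]
        congr 1
        exact Finset.sum_congr rfl fun j _ => lintegral_const_mul _ (h2 j)

/-- The quadrilinear estimate. -/
theorem exists_quadrilinear_le {b θ : ℝ} (hb : b ∈ Ioo (1 / 2 : ℝ) 1) (hθ : 1 / 2 < θ) :
    ∃ C : ℝ≥0∞, C ≠ ∞ ∧ ∀ G : ℝ → ℝ → ℝ≥0∞, Measurable (Function.uncurry G) →
      ∫⁻ p, crossWeight θ p * (∫⁻ σ : Fin 4 → ℝ, jap (-1) (∑ i, sgn i * σ i - resonance p) *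
        ∏ j, (jap (-b) (σ j) * G (σ j) (freq p j))) ∂vol3
      ≤ C * lnorm (volume.prod volume) (Function.uncurry G) ^ 4 := by
  have hb1 := hb.1
  have hlb := (lnorm_jap_lt_top hb1).ne
  have hC₁t : 2 * (∫⁻ α, jap (-(2 * θ)) α) * lnorm volume (jap (-b)) ^ 4 ≠ ∞ :=
    ENNReal.mul_ne_top (ENNReal.mul_ne_top ENNReal.ofNat_ne_top
    (lintegral_jap_lt_top (by linarith)).ne) (ENNReal.pow_ne_top hlb)
  have hC₂t : kernelConst (jap (-(1 / 2 + b))) θ * lnorm volume (jap (-b)) ^ 3 ≠ ∞ :=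
    ENNReal.mul_ne_top (ENNReal.mul_ne_top
    (lintegral_jap_lt_top (by linarith)).ne (lnorm_jap_lt_top hθ).ne) (ENNReal.pow_ne_top hlb)
  refine ⟨5 * (2 * (∫⁻ α, jap (-(2 * θ)) α) * lnorm volume (jap (-b)) ^ 4) + ∑ _j : Fin 4,
    5 * (kernelConst (jap (-(1 / 2 + b))) θ * lnorm volume (jap (-b)) ^ 3),
    ENNReal.add_ne_top.2 ⟨ENNReal.mul_ne_top ENNReal.ofNat_ne_top hC₁t,
      ENNReal.sum_ne_top.2 fun _ _ => ENNReal.mul_ne_top ENNReal.ofNat_ne_top hC₂t⟩,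
    fun G hG => ?_⟩
  have hfr := measurable_freq
  have hres := measurable_resonance
  set A : (ℝ × ℝ) × ℝ → (Fin 4 → ℝ) → ℝ≥0∞ := fun p σ =>
    ∏ j, (jap (-b) (σ j) * G (σ j) (freq p j)) with hA
  set B : Fin 4 → (ℝ × ℝ) × ℝ → (Fin 4 → ℝ) → ℝ≥0∞ := fun j p σ =>
    jap (-(1 / 2 + b)) (∑ i, sgn i * σ i - resonance p) *
      G (σ j) (freq p j) * ∏ i, (jap (-b) (σ (j.succAbove i)) *
        G (σ (j.succAbove i)) (freq p (j.succAbove i))) with hB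
  have hAm : Measurable (Function.uncurry A) := by
    unfold Function.uncurry
    fun_prop
  have hBm : ∀ j, Measurable (Function.uncurry (B j)) := by
    unfold Function.uncurry
    fun_prop
  have hle : ∀ p σ, jap (-1) (∑ i, sgn i * σ i - resonance p) * A p σ
      ≤ 5 * (jap (-1) (resonance p) * A p σ) +
        ∑ j, 5 * (jap (-(1 / 2)) (resonance p) * B j p σ) := fun p σ =>
    jap_neg_one_mul_prod_le hb σ (resonance p) fun j => G (σ j) (freq p j)
  have hA1 := lintegral_no_modulation_le (θ := θ) (b := b) hG
  have hB1 := fun j => lintegral_single_modulation_le (b := b) hG hθ (measurable_jap (-(1 / 2 + b)))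
    (jap_neg _) j
  change ∫⁻ p, crossWeight θ p * jap (-1) (resonance p) * (∫⁻ σ, A p σ) ∂vol3 ≤ _ at hA1
  change ∀ j, ∫⁻ p, crossWeight θ p * jap (-(1 / 2)) (resonance p) * (∫⁻ σ, B j p σ) ∂vol3 ≤ _ at hB1
  change ∫⁻ p, crossWeight θ p * (∫⁻ σ, jap (-1) (∑ i, sgn i * σ i - resonance p) * A p σ) ∂vol3 ≤ _
  clear_value A B
  refine (lintegral_mul_lintegral_sum_le (measurable_crossWeight θ)
    ((measurable_jap _).comp hres) ((measurable_jap _).comp hres) hAm hBm hle).trans ?_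
  rw [add_mul, Finset.sum_mul, mul_assoc 5 (2 * _ * _)]
  refine add_le_add (mul_le_mul' le_rfl hA1) (Finset.sum_le_sum fun j _ => ?_)
  rw [mul_assoc]
  exact mul_le_mul' le_rfl (hB1 j)

/-! ### Oscillatory time integrals. -/

theorem norm_le_integral_abs_deriv {ζ : ℝ → ℝ} (hζ : ContDiff ℝ (⊤ : ℕ∞) ζ)
    (hc : HasCompactSupport ζ) (t : ℝ) : |ζ t| ≤ ∫ r, |deriv ζ r| := by
  have h1 : ContDiff ℝ 1 ζ := hζ.of_le (by exact_mod_cast le_top)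
  have hi : Integrable (deriv ζ) := (h1.continuous_deriv le_rfl).integrable_of_hasCompactSupport
    hc.deriv
  rw [← HasCompactSupport.integral_Iic_deriv_eq h1 hc t]
  exact (norm_integral_le_integral_norm _).trans
    (setIntegral_le_integral hi.norm (Eventually.of_forall fun _ => norm_nonneg _))

theorem abs_intervalIntegral_abs_le {f : ℝ → ℝ} (hf : Integrable f) (a b : ℝ) :
    |(∫ r in a..b, |f r| )| ≤ ∫ r, |f r| := by
  have h := intervalIntegral.norm_integral_le_integral_norm_uIoc (f := fun r => |f r|) (a := a) (b := b)
    (μ := volume)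
  refine h.trans ?_
  simp only [Real.norm_eq_abs, abs_abs]
  exact setIntegral_le_integral hf.norm (Eventually.of_forall fun _ => abs_nonneg _)

/-- Decay of the truncated Fourier transform of a cutoff function, in terms of its total
variation. -/
theorem enorm_oscillatory_le {ζ : ℝ → ℝ} (hζ : ContDiff ℝ (⊤ : ℕ∞) ζ) (hc : HasCompactSupport ζ)
    {B R t : ℝ} (hB : ∫ r, |deriv ζ r| ≤ B) (ht : |t| ≤ R) (y : ℝ) :
    ‖∫ r in (0 : ℝ)..t, (ζ r : ℂ) * (Real.fourierChar (-(y * r)) : ℂ)‖ₑ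
      ≤ ENNReal.ofReal (B * (3 + R)) * jap (-1) y := by
  have h1 : ContDiff ℝ 1 ζ := hζ.of_le (by exact_mod_cast le_top)
  have hcd := h1.continuous_deriv le_rfl
  have hi : Integrable (deriv ζ) := hcd.integrable_of_hasCompactSupport hc.deriv
  have hζB : ∀ r, |ζ r| ≤ B := fun r => (norm_le_integral_abs_deriv hζ hc r).trans hB
  have hB0 : 0 ≤ B := (abs_nonneg _).trans (hζB 0)
  have hR0 : 0 ≤ R := (abs_nonneg _).trans ht
  set I := ∫ r in (0 : ℝ)..t, (ζ r : ℂ) * (Real.fourierChar (-(y * r)) : ℂ) with hI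
  have hec : Continuous fun r : ℝ => (Real.fourierChar (-(y * r)) : ℂ) :=
    continuous_fourierChar_coe.comp (by fun_prop)
  have b1 : ‖I‖ ≤ B * R := by
    calc ‖I‖ ≤ B * |t - 0| := intervalIntegral.norm_integral_le_of_norm_le_const fun r _ => by
          rw [norm_mul, norm_fourierChar_coe, mul_one, Complex.norm_real]
          exact hζB r
      _ ≤ _ := by
          rw [sub_zero]
          gcongr
  -- Integration by parts: two boundary terms and the integral of the derivative contribute at most
  -- $B$ each. The sharp endpoint limits the decay to first order.
  have b2 : |y| * ‖I‖ ≤ 3 * B := by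
    have hd : ∀ r : ℝ, HasDerivAt (fun r : ℝ => (Real.fourierChar (-(y * r)) : ℂ))
        (-(2 * Real.pi * Complex.I * y) * (Real.fourierChar (-(y * r)) : ℂ)) r := fun r => by
      simp only [Real.fourierChar_apply]
      have h := ((hasDerivAt_id r).const_mul y).neg.ofReal_comp.const_mul (2 * Real.pi * Complex.I)
      have h' := h.cexp
      convert h' using 1
      · ext r
        simp [mul_comm, mul_left_comm]
      · simp only [Pi.neg_apply, id]
        push_cast
        ring_nf
    have hζd : ∀ r : ℝ, HasDerivAt (fun r : ℝ => (ζ r : ℂ)) ((deriv ζ r : ℝ) : ℂ) r := fun r =>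
      ((h1.differentiable one_ne_zero) r).hasDerivAt.ofReal_comp
    have hparts := intervalIntegral.integral_deriv_mul_eq_sub (a := 0) (b := t)
      (fun r _ => hζd r) (fun r _ => hd r)
      ((Complex.continuous_ofReal.comp hcd).intervalIntegrable _ _)
      ((continuous_const.mul hec).intervalIntegrable _ _)
    have hζc := hζ.continuous
    rw [intervalIntegral.integral_add (Continuous.intervalIntegrable (by fun_prop) _ _)
      (Continuous.intervalIntegrable (by fun_prop) _ _)] at hparts
    have e : ∫ r in (0 : ℝ)..t, (ζ r : ℂ) *
        (-(2 * Real.pi * Complex.I * y) * (Real.fourierChar (-(y * r)) : ℂ))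
        = -(2 * Real.pi * Complex.I * y) * I := by
      rw [hI, ← intervalIntegral.integral_const_mul]
      congr 1; ext r
      ring
    rw [e] at hparts
    set J := ∫ r in (0 : ℝ)..t, ((deriv ζ r : ℝ) : ℂ) * (Real.fourierChar (-(y * r)) : ℂ) with hJ
    have hJB : ‖J‖ ≤ B := by
      refine (intervalIntegral.norm_integral_le_abs_integral_norm).trans ?_
      simp only [norm_mul, norm_fourierChar_coe, mul_one, Complex.norm_real, Real.norm_eq_abs]
      exact (abs_intervalIntegral_abs_le hi 0 t).trans hB
    have e2 : (2 * Real.pi * Complex.I * y) * I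
        = J - ((ζ t : ℂ) * (Real.fourierChar (-(y * t)) : ℂ)
          - (ζ 0 : ℂ) * (Real.fourierChar (-(y * 0)) : ℂ)) := by
      linear_combination -hparts
    have e3 : 2 * Real.pi * |y| * ‖I‖ ≤ 3 * B := by
      have := congrArg norm e2
      simp only [norm_mul, Complex.norm_real, Complex.norm_I, Complex.norm_ofNat,
        Real.norm_eq_abs, abs_of_pos Real.pi_pos, mul_one] at this
      rw [this]
      refine (norm_sub_le _ _).trans ?_
      have h3 := norm_sub_le ((ζ t : ℂ) * (Real.fourierChar (-(y * t)) : ℂ))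
        ((ζ 0 : ℂ) * (Real.fourierChar (-(y * 0)) : ℂ))
      rw [norm_mul, norm_mul, norm_fourierChar_coe, norm_fourierChar_coe, mul_one, mul_one,
        Complex.norm_real, Complex.norm_real, Real.norm_eq_abs, Real.norm_eq_abs] at h3
      linarith [hζB t, hζB 0]
    have h4 : |y| * ‖I‖ ≤ 2 * Real.pi * (|y| * ‖I‖) :=
      le_mul_of_one_le_left (by positivity) (by linarith [Real.pi_gt_three])
    linarith
  rw [jap, ← ENNReal.ofReal_mul (by positivity), ← ofReal_norm]
  refine ENNReal.ofReal_le_ofReal ?_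
  rw [Real.rpow_neg_one, ← div_eq_mul_inv, le_div_iff₀ (bracket_pos y)]
  have h5 : bracket y ≤ 1 + |y| := by
    have := bracket_add_le 0 y
    rw [zero_add] at this
    have h0 : bracket 0 = 1 := by simp [bracket]
    linarith
  calc ‖I‖ * bracket y ≤ ‖I‖ * (1 + |y|) := by gcongr
    _ ≤ _ := by linarith

/-- A time integral of a product of inverse Fourier integrals. -/
theorem enorm_integral_mul_prod_le {ζ : ℝ → ℝ} (hζ : Continuous ζ) {t : ℝ} {K : ℝ≥0∞}
    (hosc : ∀ y : ℝ, ‖∫ r in (0 : ℝ)..t, (ζ r : ℂ) * (Real.fourierChar (-(y * r)) : ℂ)‖ₑ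
      ≤ K * jap (-1) y) {h H : Fin 4 → ℝ → ℂ} (hm : ∀ j, Measurable (H j))
    (hH : ∀ j, Integrable (H j))
    (hh : ∀ j r, h j r = ∫ τ, (Real.fourierChar (-(sgn j * τ * r)) : ℂ) * H j τ) :
    ‖∫ r in (0 : ℝ)..t, (ζ r : ℂ) * ∏ j, h j r‖ₑ
      ≤ K * ∫⁻ τ : Fin 4 → ℝ, jap (-1) (∑ j, sgn j * τ j) * ∏ j, ‖H j (τ j)‖ₑ := by
  have hP : Integrable fun τ : Fin 4 → ℝ => ∏ j, H j (τ j) := Integrable.fintype_prod hH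
  have hchar : ∀ (τ : Fin 4 → ℝ) (r : ℝ), ∏ j, (Real.fourierChar (-(sgn j * τ j * r)) : ℂ)
      = (Real.fourierChar (-((∑ j, sgn j * τ j) * r)) : ℂ) := fun τ r => by
    rw [Fin.prod_univ_four, ← fourierChar_add_coe, ← fourierChar_add_coe, ← fourierChar_add_coe,
      Fin.sum_univ_four]
    ring_nf
  -- A product of four one-dimensional integrals is one integral over four frequencies, whose
  -- characters combine into one with the signed sum as frequency.
  have e1 : ∀ r, ∏ j, h j r = ∫ τ : Fin 4 → ℝ,
      (Real.fourierChar (-((∑ j, sgn j * τ j) * r)) : ℂ) * ∏ j, H j (τ j) := fun r => by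
    simp only [hh]
    rw [← integral_fintype_prod_volume_eq_prod]
    refine integral_congr_ae (Eventually.of_forall fun τ => ?_)
    simp only
    rw [Finset.prod_mul_distrib, hchar]
  have e2 : ∫ r in (0 : ℝ)..t, (ζ r : ℂ) * ∏ j, h j r
      = ∫ τ : Fin 4 → ℝ, (∫ r in (0 : ℝ)..t, (ζ r : ℂ) *
        (Real.fourierChar (-((∑ j, sgn j * τ j) * r)) : ℂ)) * ∏ j, H j (τ j) := by
    have hswap := intervalIntegral_integral_swap (a := 0) (b := t) (μ := volume)
      (f := fun r (τ : Fin 4 → ℝ) => (ζ r : ℂ) *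
        ((Real.fourierChar (-((∑ j, sgn j * τ j) * r)) : ℂ) * ∏ j, H j (τ j))) ?_
    · simp only [e1, ← integral_const_mul]
      rw [hswap]
      refine integral_congr_ae (Eventually.of_forall fun τ => ?_)
      simp only
      rw [← intervalIntegral.integral_mul_const]
      congr 1; ext r
      ring
    · have hne := hP.2.ne
      refine integrable_restrict_uIoc_prod
        (c := fun r => |ζ r| * (∫⁻ τ : Fin 4 → ℝ, ‖∏ j, H j (τ j)‖ₑ).toReal) ?_
        (by fun_prop) (fun r => ?_) 0 t
      · have hec : Measurable fun q : ℝ × (Fin 4 → ℝ) =>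
            (Real.fourierChar (-((∑ j, sgn j * q.2 j) * q.1)) : ℂ) :=
          (continuous_fourierChar_coe.comp (by fun_prop)).measurable
        have hζm := hζ.measurable
        unfold Function.uncurry
        fun_prop
      · rw [ENNReal.ofReal_mul (abs_nonneg _), ENNReal.ofReal_toReal hne, ← Real.norm_eq_abs,
          ofReal_norm, ← lintegral_const_mul' _ _ enorm_ne_top]
        refine lintegral_mono fun τ => ?_
        simp only
        rw [enorm_mul, enorm_mul, ← ofReal_norm (Real.fourierChar _ : ℂ), norm_fourierChar_coe,
          ENNReal.ofReal_one, one_mul, ← ofReal_norm (ζ r : ℂ), Complex.norm_real, ofReal_norm]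
  rw [e2]
  refine (enorm_integral_le_lintegral_enorm _).trans ?_
  rw [← lintegral_const_mul]
  · refine lintegral_mono fun τ => ?_
    rw [enorm_mul, ← mul_assoc]
    refine mul_le_mul' (hosc _) (le_of_eq ?_)
    simp only [← ofReal_norm, norm_prod]
    exact ENNReal.ofReal_prod_of_nonneg fun _ _ => norm_nonneg _
  · fun_prop

/-! ### From space-time weights to the quadrilinear time integral. -/

/-- Transfers properties of almost every $\xi$ to all four frequencies of almost every
configuration. -/
theorem quasiMeasurePreserving_freq (j : Fin 4) :
    Measure.QuasiMeasurePreserving (fun p => freq p j) vol3 volume := by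
  have h0 : Measure.QuasiMeasurePreserving (fun p : (ℝ × ℝ) × ℝ => p.2) vol3 volume :=
    Measure.quasiMeasurePreserving_snd
  fin_cases j
  · exact h0
  · exact h0.comp measurePreserving_relabel₁.quasiMeasurePreserving
  · exact h0.comp measurePreserving_relabel₃.quasiMeasurePreserving
  · have := h0.comp measurePreserving_relabel₂.quasiMeasurePreserving
    refine (congrArg (Measure.QuasiMeasurePreserving · vol3 volume) ?_).mp this
    ext p
    simp [relabel₂, freq]
    ring

theorem sum_sgn_mul_freq_sq (p : (ℝ × ℝ) × ℝ) :
    ∑ j, sgn j * (2 * Real.pi * freq p j ^ 2) = resonance p := by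
  rw [Fin.sum_univ_four]
  simp only [sgn, freq, resonance, Matrix.cons_val]
  ring

/-- The size of the space-time Fourier transform, weighted and translated to the paraboloid. -/
noncomputable def shiftedWeight (a b : ℝ) (g : ℝ → ℝ → ℂ) (σ ξ : ℝ) : ℝ≥0∞ :=
  ‖timeFourier g (σ - 2 * Real.pi * ξ ^ 2) ξ‖ₑ * jap (-a) (2 * Real.pi * ξ) *
    jap b (2 * Real.pi * σ)

theorem IsSliceFamily.measurable_shiftedWeight {R : ℝ} {g : ℝ → ℝ → ℂ} (h : IsSliceFamily R g)
    (a b : ℝ) : Measurable (Function.uncurry (shiftedWeight a b g)) := by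
  have h0 : Measurable fun q : ℝ × ℝ => (q.1 - 2 * Real.pi * q.2 ^ 2, q.2) := by fun_prop
  have h1 : Measurable fun q : ℝ × ℝ => timeFourier g (q.1 - 2 * Real.pi * q.2 ^ 2) q.2 := by
    have := (measurable_timeFourier h.measurable).comp h0
    simpa only [Function.comp_def, Function.uncurry] using this
  have h2 := measurable_jap
  unfold shiftedWeight Function.uncurry
  fun_prop

theorem lintegral_shiftedWeight_slice (a b : ℝ) (g : ℝ → ℝ → ℂ) (ξ : ℝ) :
    ∫⁻ σ, shiftedWeight a b g σ ξ ^ 2 = ∫⁻ τ, ‖timeFourier g τ ξ‖ₑ ^ 2 *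
      jap (2 * b) (2 * Real.pi * τ + phase ξ) * jap (-(2 * a)) (2 * Real.pi * ξ) := by
  rw [← lintegral_add_right_eq_self _ (2 * Real.pi * ξ ^ 2)]
  refine lintegral_congr fun τ => ?_
  rw [shiftedWeight, add_sub_cancel_right, mul_pow, mul_pow, jap_pow_two, jap_pow_two,
    mul_right_comm]
  congr 3
  · rw [phase]
    ring
  · ring

theorem IsSliceFamily.lnorm_shiftedWeight_sq {R : ℝ} {g : ℝ → ℝ → ℂ} (h : IsSliceFamily R g)
    (a b : ℝ) : lnorm (volume.prod volume) (Function.uncurry (shiftedWeight a b g)) ^ 2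
      = ∫⁻ ξ, ∫⁻ τ, ‖timeFourier g τ ξ‖ₑ ^ 2 *
      jap (2 * b) (2 * Real.pi * τ + phase ξ) * jap (-(2 * a)) (2 * Real.pi * ξ) := by
  rw [lnorm_sq, lintegral_prod_symm _ ((h.measurable_shiftedWeight a b).pow_const 2).aemeasurable]
  exact lintegral_congr fun ξ => lintegral_shiftedWeight_slice a b g ξ

theorem enorm_timeFourier_le (a : ℝ) {b : ℝ} (hb : 0 ≤ b) (g : ℝ → ℝ → ℂ) (σ ξ : ℝ) :
    ‖timeFourier g (σ - 2 * Real.pi * ξ ^ 2) ξ‖ₑ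
      ≤ jap a (2 * Real.pi * ξ) * (jap (-b) σ * shiftedWeight a b g σ ξ) := by
  have h1 : jap (-b) (2 * Real.pi * σ) ≤ jap (-b) σ := by
    rw [jap, jap]
    refine ENNReal.ofReal_le_ofReal (Real.rpow_le_rpow_of_nonpos (bracket_pos _)
      (bracket_le_bracket ?_) (by linarith))
    rw [abs_mul, abs_of_pos Real.two_pi_pos]
    exact le_mul_of_one_le_left (abs_nonneg _) (by linarith [Real.pi_gt_three])
  calc ‖timeFourier g (σ - 2 * Real.pi * ξ ^ 2) ξ‖ₑ
      = (jap a (2 * Real.pi * ξ) * jap (-a) (2 * Real.pi * ξ)) *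
        (jap (-b) (2 * Real.pi * σ) * jap b (2 * Real.pi * σ)) *
        ‖timeFourier g (σ - 2 * Real.pi * ξ ^ 2) ξ‖ₑ := by
        rw [jap_mul, jap_mul, add_neg_cancel, neg_add_cancel, jap_zero, jap_zero, one_mul, one_mul]
    _ = jap a (2 * Real.pi * ξ) * (jap (-b) (2 * Real.pi * σ) * shiftedWeight a b g σ ξ) := by
        rw [shiftedWeight]
        ring
    _ ≤ _ := by gcongr

theorem IsSliceFamily.integrable_slice {R : ℝ} {g : ℝ → ℝ → ℂ} (h : IsSliceFamily R g) (ξ : ℝ) :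
    Integrable fun t => g t ξ :=
  (h.continuous ξ).integrable_of_hasCompactSupport (h.hasCompactSupport ξ)

theorem IsSliceFamily.measurable_timeFourier_slice {R : ℝ} {g : ℝ → ℝ → ℂ}
    (h : IsSliceFamily R g) (ξ : ℝ) : Measurable fun τ => timeFourier g τ ξ :=
  (continuous_fourier (h.integrable_slice ξ)).measurable

/-- Since $b>1/2$, the weighted $L^2$ bound in modulation implies integrability in $\tau$, hence
pointwise Fourier inversion in time at almost every $\xi$. -/
theorem IsSliceFamily.ae_integrable_timeFourier {R : ℝ} {g : ℝ → ℝ → ℂ} (h : IsSliceFamily R g)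
    {a b : ℝ} (hb : 1 / 2 < b)
    (hfin : lnorm (volume.prod volume) (Function.uncurry (shiftedWeight a b g)) ≠ ∞) :
    ∀ᵐ ξ : ℝ, Integrable fun τ => timeFourier g τ ξ := by
  have hm := h.measurable_shiftedWeight a b
  have h2 : ∫⁻ ξ, ∫⁻ σ, shiftedWeight a b g σ ξ ^ 2 ≠ ∞ := by
    have := ENNReal.pow_ne_top (n := 2) hfin
    rw [lnorm_sq, lintegral_prod_symm _ (hm.pow_const 2).aemeasurable] at this
    exact this
  have h3 : Measurable fun ξ => ∫⁻ σ, shiftedWeight a b g σ ξ ^ 2 :=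
    Measurable.lintegral_prod_left' (f := fun q : ℝ × ℝ =>
      Function.uncurry (shiftedWeight a b g) q ^ 2) (hm.pow_const 2)
  filter_upwards [ae_lt_top h3 h2] with ξ hξ
  refine ⟨(h.measurable_timeFourier_slice ξ).aestronglyMeasurable, ?_⟩
  rw [hasFiniteIntegral_iff_enorm, ← lintegral_sub_right_eq_self _ (2 * Real.pi * ξ ^ 2)]
  have hms : Measurable fun σ => shiftedWeight a b g σ ξ := hm.of_uncurry_right
  calc _ ≤ ∫⁻ σ, jap a (2 * Real.pi * ξ) * (jap (-b) σ * shiftedWeight a b g σ ξ) :=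
        lintegral_mono fun σ => enorm_timeFourier_le a (by linarith) g σ ξ
    _ = jap a (2 * Real.pi * ξ) * ∫⁻ σ, jap (-b) σ * shiftedWeight a b g σ ξ :=
        lintegral_const_mul _ ((measurable_jap _).mul hms)
    _ < ∞ := by
        refine ENNReal.mul_lt_top (jap_ne_top _ _).lt_top
          ((lintegral_mul_le_lnorm (measurable_jap _) hms).trans_lt
          (ENNReal.mul_lt_top (lnorm_jap_lt_top hb) ?_))
        exact ENNReal.rpow_lt_top_of_nonneg (by norm_num) hξ.ne

/-- The functions of time whose product is the quadrilinear expression. -/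
noncomputable def signedConj (j : Fin 4) (z : ℂ) : ℂ := ![conj z, z, z, conj z] j

theorem quad_eq_prod (g : ℝ → ℂ) (p) : quad g p = ∏ j, signedConj j (g (freq p j)) := by
  rw [Fin.prod_univ_four, mul_assoc, mul_assoc]
  rfl

theorem enorm_signedConj (j : Fin 4) (z : ℂ) : ‖signedConj j z‖ₑ = ‖z‖ₑ := by
  rw [← ofReal_norm, ← ofReal_norm]
  congr 1
  fin_cases j <;> simp [signedConj]

theorem continuous_signedConj (j : Fin 4) : Continuous (signedConj j) := by
  fin_cases j
  · exact Complex.continuous_conj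
  · exact continuous_id
  · exact continuous_id
  · exact Complex.continuous_conj

theorem conj_fourierChar (x : ℝ) :
    conj (Real.fourierChar x : ℂ) = (Real.fourierChar (-x) : ℂ) := by
  rw [AddChar.map_neg_eq_inv, Circle.coe_inv_eq_conj]

theorem signedConj_fourierInv (j : Fin 4) (F : ℝ → ℂ) (r : ℝ) :
    signedConj j (𝓕⁻ F r)
      = ∫ τ, (Real.fourierChar (-(sgn j * τ * r)) : ℂ) * signedConj j (F τ) := by
  have h1 : 𝓕⁻ F r = ∫ τ, (Real.fourierChar (τ * r) : ℂ) * F τ := by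
    rw [Real.fourierInv_eq]
    refine integral_congr_ae (Eventually.of_forall fun τ => ?_)
    simp [Circle.smul_def, mul_comm]
  have h2 : conj (𝓕⁻ F r) = ∫ τ, (Real.fourierChar (-(1 * τ * r)) : ℂ) * conj (F τ) := by
    rw [h1, ← integral_conj]
    refine integral_congr_ae (Eventually.of_forall fun τ => ?_)
    simp only [map_mul, conj_fourierChar, one_mul]
  have h3 : 𝓕⁻ F r = ∫ τ, (Real.fourierChar (-(-1 * τ * r)) : ℂ) * F τ := by
    rw [h1]
    refine integral_congr_ae (Eventually.of_forall fun τ => ?_)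
    simp only [neg_mul, one_mul, neg_neg]
  fin_cases j
  · exact h2
  · exact h3
  · exact h3
  · exact h2

theorem IsSliceFamily.eq_fourierInv_timeFourier {R : ℝ} {g : ℝ → ℝ → ℂ} (h : IsSliceFamily R g)
    {ξ : ℝ} (hξ : Integrable fun τ => timeFourier g τ ξ) (r : ℝ) :
    g r ξ = 𝓕⁻ (fun τ => timeFourier g τ ξ) r := by
  have := (h.continuous ξ).fourierInv_fourier_eq (h.integrable_slice ξ) hξ
  exact (congrFun this r).symm

section

variable {R : ℝ} {g : ℝ → ℝ → ℂ} {ζ : ℝ → ℝ} {t : ℝ} {K : ℝ≥0∞} {a b s : ℝ}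

theorem IsSliceFamily.enorm_integral_quad_le (h : IsSliceFamily R g) (hζ : Continuous ζ)
    (hosc : ∀ y : ℝ, ‖∫ r in (0 : ℝ)..t, (ζ r : ℂ) * (Real.fourierChar (-(y * r)) : ℂ)‖ₑ
      ≤ K * jap (-1) y) (hb : 0 ≤ b) (p : (ℝ × ℝ) × ℝ)
    (hp : ∀ j, Integrable fun τ => timeFourier g τ (freq p j)) :
    ‖∫ r in (0 : ℝ)..t, (ζ r : ℂ) * quad (g r) p‖ₑ
      ≤ K * ((∏ j, jap a (2 * Real.pi * freq p j)) *
        ∫⁻ σ : Fin 4 → ℝ, jap (-1) (∑ i, sgn i * σ i - resonance p) *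
          ∏ j, (jap (-b) (σ j) * shiftedWeight a b g (σ j) (freq p j))) := by
  have h1 := enorm_integral_mul_prod_le hζ hosc
    (h := fun j r => signedConj j (g r (freq p j)))
    (H := fun j τ => signedConj j (timeFourier g τ (freq p j)))
    (fun j => (continuous_signedConj j).measurable.comp (h.measurable_timeFourier_slice _))
    (fun j => ⟨((continuous_signedConj j).measurable.comp
      (h.measurable_timeFourier_slice _)).aestronglyMeasurable, by
        rw [hasFiniteIntegral_iff_enorm]
        simp only [enorm_signedConj]
        exact (hp j).2⟩)
    (fun j r => by
      rw [h.eq_fourierInv_timeFourier (hp j) r]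
      exact signedConj_fourierInv j _ r)
  simp only [← quad_eq_prod, enorm_signedConj] at h1
  refine h1.trans (mul_le_mul' le_rfl ?_)
  -- Each time frequency is measured from the paraboloid; the four translations add up, with signs,
  -- to the resonance function.
  rw [← lintegral_sub_right_eq_self _ (fun j => 2 * Real.pi * freq p j ^ 2)]
  have hm := (h.measurable_shiftedWeight a b)
  have hmj := measurable_jap
  rw [← lintegral_const_mul _ (by fun_prop)]
  refine lintegral_mono fun σ => ?_
  have e : ∑ j, sgn j * (σ - fun j => 2 * Real.pi * freq p j ^ 2 : Fin 4 → ℝ) j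
      = ∑ i, sgn i * σ i - resonance p := by
    simp only [Pi.sub_apply, mul_sub, Finset.sum_sub_distrib]
    rw [← sum_sgn_mul_freq_sq]
  rw [e, mul_left_comm]
  refine mul_le_mul' le_rfl ?_
  rw [← Finset.prod_mul_distrib]
  exact Finset.prod_le_prod' fun j _ => enorm_timeFourier_le a hb g (σ j) (freq p j)

theorem IsSliceFamily.lintegral_symbol_mul_le (h : IsSliceFamily R g) (hζ : Continuous ζ)
    (hosc : ∀ y : ℝ, ‖∫ r in (0 : ℝ)..t, (ζ r : ℂ) * (Real.fourierChar (-(y * r)) : ℂ)‖ₑ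
      ≤ K * jap (-1) y) (hb : 1 / 2 < b) (hs : -(1 / 2) ≤ s) (hs0 : s ≤ 0) (ha : 0 ≤ a)
    (ha2 : a ≤ 1 / 2)
    (hfin : lnorm (volume.prod volume) (Function.uncurry (shiftedWeight a b g)) ≠ ∞) :
    ∫⁻ p, ‖symbol s p‖ₑ * ‖∫ r in (0 : ℝ)..t, (ζ r : ℂ) * quad (g r) p‖ₑ ∂vol3
      ≤ K * ENNReal.ofReal (256 * Real.pi ^ 2) * ∫⁻ p, crossWeight (1 - 2 * a) p *
        (∫⁻ σ : Fin 4 → ℝ, jap (-1) (∑ i, sgn i * σ i - resonance p) *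
          ∏ j, (jap (-b) (σ j) * shiftedWeight a b g (σ j) (freq p j))) ∂vol3 := by
  have hae : ∀ᵐ p ∂vol3, ∀ j, Integrable fun τ => timeFourier g τ (freq p j) :=
    ae_all_iff.2 fun j => (quasiMeasurePreserving_freq j).ae (h.ae_integrable_timeFourier hb hfin)
  have hm := h.measurable_shiftedWeight a b
  have hmj := measurable_jap
  have hfr := measurable_freq
  have hres := measurable_resonance
  have hmi : Measurable fun p : (ℝ × ℝ) × ℝ =>
      ∫⁻ σ : Fin 4 → ℝ, jap (-1) (∑ i, sgn i * σ i - resonance p) *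
          ∏ j, (jap (-b) (σ j) * shiftedWeight a b g (σ j) (freq p j)) :=
    Measurable.lintegral_prod_right' (f := fun q : ((ℝ × ℝ) × ℝ) × (Fin 4 → ℝ) =>
      jap (-1) (∑ i, sgn i * q.2 i - resonance q.1) *
          ∏ j, (jap (-b) (q.2 j) * shiftedWeight a b g (q.2 j) (freq q.1 j))) (by fun_prop)
  have hmc : Measurable fun p : (ℝ × ℝ) × ℝ => crossWeight (1 - 2 * a) p *
      ∫⁻ σ : Fin 4 → ℝ, jap (-1) (∑ i, sgn i * σ i - resonance p) *
          ∏ j, (jap (-b) (σ j) * shiftedWeight a b g (σ j) (freq p j)) :=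
    (measurable_crossWeight _).mul hmi
  rw [← lintegral_const_mul _ hmc]
  refine lintegral_mono_ae ?_
  filter_upwards [hae] with p hp
  have h1 := h.enorm_integral_quad_le (a := a) (b := b) hζ hosc (by linarith) p hp
  have h2 := enorm_symbol_mul_le hs hs0 ha ha2 p
  generalize (∫⁻ σ : Fin 4 → ℝ, jap (-1) (∑ i, sgn i * σ i - resonance p) *
          ∏ j, (jap (-b) (σ j) * shiftedWeight a b g (σ j) (freq p j))) = I at h1 ⊢
  calc _ ≤ ‖symbol s p‖ₑ * (K * ((∏ j, jap a (2 * Real.pi * freq p j)) * I)) :=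
        mul_le_mul' le_rfl h1
    _ = K * (‖symbol s p‖ₑ * ∏ j, jap a (2 * Real.pi * freq p j)) * I := by ring
    _ ≤ K * (ENNReal.ofReal (256 * Real.pi ^ 2) * crossWeight (1 - 2 * a) p) * I := by gcongr
    _ = _ := by ring

end

/-! ### Cutoffs in time and the conclusion. -/

section SmoothSolution

variable {ω R : ℝ} {ζ₀ ζ : ℝ → ℝ} {u₀ : ℝ → ℂ} {u : ℝ → ℝ → ℂ}

/-- Time slices multiplied by a real cutoff. -/
noncomputable def cutoffTime (ζ : ℝ → ℝ) (g : ℝ → ℝ → ℂ) (t ξ : ℝ) : ℂ := (ζ t : ℂ) * g t ξ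

theorem spaceInv_cutoffTime (g : ℝ → ℝ → ℂ) (t x : ℝ) :
    spaceInv (cutoffTime ζ g) t x = (ζ t : ℂ) * 𝓕⁻ (g t) x := by
  rw [spaceInv, Real.fourierInv_eq, Real.fourierInv_eq, ← integral_const_mul]
  congr 1; ext ξ
  simp only [cutoffTime, Circle.smul_def, smul_eq_mul]
  ring

theorem lintegral_enorm_mul_ofReal_lt_top (hζ : Continuous ζ) (hc : HasCompactSupport ζ)
    {m : ℝ → ℝ} (hm : Continuous m) : ∫⁻ t, ‖ζ t‖ₑ * ENNReal.ofReal (m t) < ∞ := by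
  have hi : Integrable fun t => ζ t * m t :=
    (hζ.mul hm).integrable_of_hasCompactSupport hc.mul_right
  refine lt_of_le_of_lt (lintegral_mono fun t => ?_) hi.2
  rw [enorm_mul]
  gcongr
  rw [← ofReal_norm]
  exact ENNReal.ofReal_le_ofReal (Real.le_norm_self _)

theorem IsSmoothSolution.isSliceFamily_cutoffTime (h : IsSmoothSolution ω ζ₀ u₀ u)
    (hζ₀ : Continuous ζ₀) (hζ : Continuous ζ) (hc : HasCompactSupport ζ)
    (hR : ∀ t, R < |t| → ζ t = 0) : IsSliceFamily R (cutoffTime ζ (duhamel ω ζ₀ u₀ u)) where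
  measurable := by
    have h1 := h.measurable_duhamel hζ₀
    have h2 := hζ.measurable
    unfold cutoffTime Function.uncurry
    fun_prop
  lintegral_lt_top := by
    refine lt_of_le_of_lt (lintegral_mono fun t => ?_)
      (lintegral_enorm_mul_ofReal_lt_top hζ hc h.continuous_weightedL1)
    simp only [cutoffTime, enorm_mul]
    rw [lintegral_const_mul' _ _ enorm_ne_top, ← ofReal_norm (ζ t : ℂ), Complex.norm_real,
      ofReal_norm]
    exact mul_le_mul' le_rfl (h.lintegral_duhamel_le hζ₀ t)
  lintegral_sq_lt_top := by
    refine lt_of_le_of_lt (lintegral_mono fun t => le_of_eq ?_)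
      (lintegral_enorm_mul_ofReal_lt_top (ζ := fun t => ζ t ^ 2)
        (m := fun t => (eLpNorm (u t) 2 volume).toReal ^ 2) (hζ.pow 2)
        (hc.comp_left (g := fun x : ℝ => x ^ 2) (by simp)) (h.continuous_eLpNorm.pow 2))
    simp only [cutoffTime, enorm_mul, mul_pow]
    rw [lintegral_const_mul' _ _ (ENNReal.pow_ne_top enorm_ne_top), ← ofReal_norm (ζ t : ℂ),
      Complex.norm_real, ofReal_norm, enorm_pow, h.lintegral_duhamel_sq hζ₀ t]
  continuous ξ := by
    have h1 : Continuous fun t => duhamel ω ζ₀ u₀ u t ξ :=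
      continuous_iff_continuousAt.2 fun t => (h.hasDerivAt_duhamel hζ₀ t ξ).continuousAt
    unfold cutoffTime
    fun_prop
  eq_zero t ξ ht := by simp [cutoffTime, hR t ht]

/-- The relation $\zeta\zeta_0=\zeta_0$ iterates to $\zeta^4\zeta_0=\zeta_0$, so each of the four
factors may carry the cutoff for free. This is how $\zeta_1u$ replaces $u$. -/
theorem mul_quad_cutoffTime (hmul : ∀ t, ζ t * ζ₀ t = ζ₀ t) (g : ℝ → ℝ → ℂ) (r : ℝ) (p) :
    (ζ₀ r : ℂ) * quad (cutoffTime ζ g r) p = (ζ₀ r : ℂ) * quad (g r) p := by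
  have h : (ζ r : ℂ) * ζ₀ r = ζ₀ r := by exact_mod_cast hmul r
  simp only [quad, cutoffTime, map_mul, Complex.conj_ofReal]
  generalize conj (g r p.2) = A
  generalize g r (p.2 - p.1.1) = B
  generalize g r (p.2 - p.1.2) = C
  generalize conj (g r (p.2 - p.1.1 - p.1.2)) = D
  generalize (ζ r : ℂ) = z at *
  generalize (ζ₀ r : ℂ) = w at *
  linear_combination A * B * C * D * (z ^ 3 + z ^ 2 + z + 1) * h

end SmoothSolution

theorem hasCompactSupport_of_tsupport_subset_Ioo {T : ℝ} {ζ : ℝ → ℝ}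
    (h : tsupport ζ ⊆ Ioo (-(2 * T)) (2 * T)) : HasCompactSupport ζ :=
  HasCompactSupport.of_support_subset_isCompact isCompact_Icc
    ((subset_tsupport ζ).trans (h.trans Ioo_subset_Icc_self))

theorem proposition6p5 (T₀ s b : ℝ) (hs : s ∈ Set.Ioo (-(1 / 2) : ℝ) 0)
    (hb : b ∈ Set.Ioo (1 / 2 : ℝ) 1) (hsb : -s < 1 / 4 * (1 + 4 * b)⁻¹)
    (η : ℝ → ℂ) (hη : ContDiff ℝ (⊤ : ℕ∞) η) (hηc : HasCompactSupport η) (hη0 : η 0 ≠ 0) (B : ℝ) :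
    ∃ C : ℝ≥0, ∀ T ∈ Set.Icc 0 T₀, ∀ ζ₀ ζ₁ : ℝ → ℝ, IsCutoffPair T ζ₀ ζ₁ →
      ∫ t, |deriv ζ₀ t| ≤ B →
      ∀ ω : ℝ, ω = 1 ∨ ω = -1 → ∀ (u₀ : ℝ → ℂ) (u : ℝ → ℝ → ℂ), IsSmoothSolution ω ζ₀ u₀ u →
        c0HsNorm T s u ^ 2 ≤ hsNorm s u₀ ^ 2 +
          (C : ℝ≥0∞) * yNorm η s b (fun p => (ζ₁ (p 0) : ℂ) * u (p 0) (p 1)) ^ 4 := by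
  have hb0 : (0 : ℝ) < 1 + 4 * b := by linarith [hb.1]
  -- The lower bound makes the dyadic sum converge; the upper bound gives $\theta=1-2a>1/2$. The
  -- assumption on $s$ says exactly that such an $a$ exists.
  obtain ⟨a, ha1, ha2⟩ : ∃ a, -s * (1 + 4 * b) < a ∧ a < 1 / 4 :=
    exists_between (by rwa [← div_eq_mul_inv, lt_div_iff₀ hb0] at hsb)
  have ha0 : 0 < a := lt_trans (mul_pos (by linarith [hs.2]) hb0) ha1
  obtain ⟨Cq, hCq, hquad⟩ := exists_quadrilinear_le hb (θ := 1 - 2 * a) (by linarith)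
  rcases lt_or_ge T₀ 0 with hT₀ | hT₀
  · exact ⟨0, fun T hT => absurd (hT.1.trans hT.2) (not_le.2 hT₀)⟩
  obtain ⟨Cy, hY⟩ := exists_lintegral_timeFourier_le_yNorm (R := 2 * T₀) hη.continuous hηc hη0
    (by positivity) hs.2.le (by linarith [hb.1] : 0 ≤ b) ha0.le ha1
  set D : ℝ≥0∞ := ENNReal.ofReal Real.pi * (ENNReal.ofReal (B * (3 + 2 * T₀)) *
    ENNReal.ofReal (256 * Real.pi ^ 2) * (Cq * (Cy : ℝ≥0∞) ^ 2)) with hD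
  have hDt : D ≠ ∞ := by
    have h1 : (Cy : ℝ≥0∞) ^ 2 ≠ ∞ := ENNReal.pow_ne_top ENNReal.coe_ne_top
    exact ENNReal.mul_ne_top ENNReal.ofReal_ne_top (ENNReal.mul_ne_top (ENNReal.mul_ne_top
      ENNReal.ofReal_ne_top ENNReal.ofReal_ne_top) (ENNReal.mul_ne_top hCq h1))
  -- Adding 1 keeps the constant nonzero, so that the right side is infinite when the $Y$ norm is,
  -- despite $0\cdot\infty=0$.
  refine ⟨D.toNNReal + 1, fun T hT ζ₀ ζ₁ hcut hBV ω hω u₀ u hu => ?_⟩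
  rw [ENNReal.coe_add, ENNReal.coe_toNNReal hDt, ENNReal.coe_one]
  set Y := yNorm η s b (fun p => (ζ₁ (p 0) : ℂ) * u (p 0) (p 1)) with hYdef
  rcases eq_or_ne Y ∞ with hYt | hYt
  · rw [hYt, ENNReal.top_pow (by norm_num), ENNReal.mul_top (by simp)]
    simp
  have hζ₀ := hcut.smooth₀.continuous
  have hζ₁ := hcut.smooth₁.continuous
  have hc₀ := hasCompactSupport_of_tsupport_subset_Ioo hcut.tsupport₀
  have hc₁ := hasCompactSupport_of_tsupport_subset_Ioo hcut.tsupport₁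
  have hω1 : |ω| = 1 := by rcases hω with rfl | rfl <;> simp
  have hvan : ∀ t, 2 * T₀ < |t| → ζ₁ t = 0 := fun t ht => by
    refine image_eq_zero_of_notMem_tsupport fun hmem => ?_
    have := abs_lt.2 (hcut.tsupport₁ hmem)
    linarith [hT.2]
  have hg := hu.isSliceFamily_cutoffTime hζ₀ hζ₁ hc₁ hvan
  have hL : lnorm (volume.prod volume) (Function.uncurry
      (shiftedWeight a b (cutoffTime ζ₁ (duhamel ω ζ₀ u₀ u)))) ^ 2 ≤ Cy * Y ^ 2 := by
    rw [hg.lnorm_shiftedWeight_sq]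
    have h1 := hY _ hg
    have e : (fun p : SpaceTime => spaceInv (cutoffTime ζ₁ (duhamel ω ζ₀ u₀ u)) (p 0) (p 1))
        = fun p => (ζ₁ (p 0) : ℂ) * u (p 0) (p 1) := by
      ext p
      rw [spaceInv_cutoffTime, ← hu.eq_fourierInv_duhamel hζ₀]
    rwa [e] at h1
  have hfin : lnorm (volume.prod volume) (Function.uncurry
      (shiftedWeight a b (cutoffTime ζ₁ (duhamel ω ζ₀ u₀ u)))) ≠ ∞ := fun htop => by
    rw [htop, ENNReal.top_pow (by norm_num), top_le_iff] at hL
    exact ENNReal.mul_ne_top ENNReal.coe_ne_top (ENNReal.pow_ne_top hYt) hL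
  have hpt : ∀ t ∈ Icc (-(2 * T)) (2 * T), hsNorm s (u t) ^ 2 ≤ hsNorm s u₀ ^ 2 + (D + 1) * Y ^ 4 := by
    intro t ht
    have htR : |t| ≤ 2 * T₀ := (abs_le.2 ht).trans (by linarith [hT.2])
    refine (hu.hsNorm_sq_le hζ₀ hω1 hs.2.le t).trans (add_le_add le_rfl ?_)
    have h1 := hg.lintegral_symbol_mul_le hζ₀
      (fun y => enorm_oscillatory_le hcut.smooth₀ hc₀ hBV htR y) hb.1 hs.1.le hs.2.le ha0.le
      (by linarith) hfin
    simp only [mul_quad_cutoffTime hcut.mul_eq] at h1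
    have h2 := hquad _ (hg.measurable_shiftedWeight a b)
    calc _ ≤ ENNReal.ofReal Real.pi * (ENNReal.ofReal (B * (3 + 2 * T₀)) *
          ENNReal.ofReal (256 * Real.pi ^ 2) * (Cq * (Cy * Y ^ 2) ^ 2)) := by
          refine mul_le_mul' le_rfl (h1.trans (mul_le_mul' le_rfl
            (h2.trans (mul_le_mul' le_rfl ?_))))
          calc _ = (lnorm (volume.prod volume) (Function.uncurry
              (shiftedWeight a b (cutoffTime ζ₁ (duhamel ω ζ₀ u₀ u)))) ^ 2) ^ 2 := by ring
            _ ≤ _ := by gcongr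
      _ = D * Y ^ 4 := by
          rw [hD]
          ring
      _ ≤ (D + 1) * Y ^ 4 := mul_le_mul' le_self_add le_rfl
  calc c0HsNorm T s u ^ 2 ≤ ((hsNorm s u₀ ^ 2 + (D + 1) * Y ^ 4) ^ (1 / 2 : ℝ)) ^ 2 := by
        gcongr
        exact iSup₂_le fun t ht => rpow_half_le_of_le_sq (hpt t ht)
    _ = _ := rpow_half_sq _
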